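/- Consider the following germs at $0$ of families of symmetric $3\times3$ matrices in the variables $(x,y,z,w)\in\mathbb C^4$, odd functions $M'$ on $\mathbb C^2$, and deformations with parameter $\lambda=(\lambda_0,\dots,\lambda_{\tau-1})\in\mathbb C^\tau$. * $I_{k+1}$, $k\ge1$ ($\tau=k+1$), with $P_\lambda(x)=x^k+\lambda_{k-1}x^{k-1}+\dots+\lambda_1x+\lambda_0$: $$M_\lambda=\begin{pmatrix}x&\lambda_k&z\\ \lambda_k&y+P_\lambda(x)&w\\ z&w&y\end{pmatrix},\qquad M'_\lambda(a,c)=ac^2+a\,P_\lambda(a^2)+\lambda_kc .$$ * $II_4,II_5,II_6$ ($\tau=4,5,6$): $$M_\lambda=\begin{pmatrix}x&p_\lambda(w)&y+q_\lambda(w)\\ p_\lambda(w)&y&z\\ y+q_\lambda(w)&z&w\end{pmatrix},$$ with, respectively, $p_\lambda=w^2+\lambda_1w+\lambda_0$, $q_\lambda=\lambda_3w+\lambda_2$; $\;p_\lambda=\lambda_2w^2+\lambda_1w+\lambda_0$, $q_\lambda=w^2+\lambda_4w+\lambda_3$; $\;p_\lambda=w^3+\lambda_2w^2+\lambda_1w+\lambda_0$,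 $q_\lambda=\lambda_5w^2+\lambda_4w+\lambda_3$; and $$\begin{aligned}II_4:&\ M'_\lambda(b,c)=b^3+c^5+\lambda_0c+\lambda_1c^3+\lambda_2b+\lambda_3bc^2,\\ II_5:&\ M'_\lambda(b,c)=b^3-bc^4+\lambda_0c+\lambda_1c^3+\lambda_2c^5+\lambda_3b+\lambda_4bc^2,\\ II_6:&\ M'_\lambda(b,c)=b^3+c^7+\lambda_0c+\lambda_1c^3+\lambda_2c^5+\lambda_3b+\lambda_4bc^2+\lambda_5bc^4.\end{aligned}$$ The odd functions $M'=M'_0$ are $D_{2k+2}/\mathbb Z_2$, $E_8/\mathbb Z_2$, $J_{10}/\mathbb Z_2$, $E_{12}/\mathbb Z_2$ respectively; put $M=M_0$. An $\mathrm{SL}$-miniversal deformation of a symmetric germ $M$ is a holomorphic family of symmetric matrices, equal to $M$ at $\lambda=0$, whose initial velocities $\partial M_\lambda/\partial\lambda_i|_{\lambda=0}$ form a basis of the quotient of the space of symmetric matrix germs by the space of germs $\sum_l\xi_l\,\partial M/\partial x_l+AM+MA^\top$, with holomorphic $\xi_l$ and holomorphic trace-free $A$. An odd miniversal deformation of an odd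 function germ $f$ is a holomorphic family of odd functions, equal to $f$ at $\lambda=0$, whose initial velocities form a basis of the quotient of the space of odd function germs by the space of derivatives of $f$ along odd holomorphic vector fields. The singular Milnor number $\mu_\Delta(M)$ is the maximum over $\lambda\in\mathbb C^\tau$ of the sum of the Milnor numbers of $\det\circ M_\lambda$ at its critical points outside the zero level. The full bifurcation diagram $\Theta\subset\Lambda=\mathbb C^\tau$ of $M$ is the set of all $\lambda$ for which $\det\circ M_\lambda$ has fewer than $\mu_\Delta(M)$ distinct non-zero critical values. The full bifurcation diagram $\Theta'\subset\Lambda'=\mathbb C^\tau$ of $M'$ is the set of all $\lambda$ for which $M'_\lambda$ is not Morse or has critical value zero. Here a function is called Morse if all its critical points are nondegenerate and its critical values at distinct critical points are distinct. (All the families are quasi-homogeneous with positive weights of all variables and parameters, and everything is considered globally on $\mathbb C^4$, $\mathbb C^2$, $\mathbb C^\tau$.) **Proposition.** In each of the cases $I_{k+1}$ ($k\ge1$), $II_4$, $II_5$, $II_6$, the family $M_\lambda$ is an $\mathrm{SL}$-miniversal deformation of $M$, the family $M'_\lambda$ is an odd miniversal deformation of $M'$, and there is a biholomorphism $\Lambda\to\Lambda'$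 of the bases, sending $0$ to $0$ and mapping $\Theta$ onto $\Theta'$: $$(\Lambda,\Theta)\simeq(\Lambda',\Theta').$$ -/

import Mathlib

open Topology

noncomputable section

namespace MatrixSing

/-! ### Miniversal deformations of symmetric matrix families -/

/-- The symmetric matrix germ `V` at `0 ∈ ℂˢ` lies in the extended tangent space to the
`SL`-equivalence class of the symmetric matrix germ `M`:
`V = ∑ ξ_l ∂M/∂x_l + A M + M Aᵀ` with holomorphic `ξ_l` and a holomorphic trace-free matrix `A`.
(The matrices `E_{jl}`, `j ≠ l`, and `E_{jj} - E_{11}` generate the trace-free matrices.) -/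
def InTangentSL {s n : ℕ} (M V : (Fin s → ℂ) → Matrix (Fin n) (Fin n) ℂ) : Prop :=
  ∃ (ξ : (Fin s → ℂ) → (Fin s → ℂ)) (A : (Fin s → ℂ) → Matrix (Fin n) (Fin n) ℂ),
    AnalyticAt ℂ ξ 0 ∧
    (∀ i j, AnalyticAt ℂ (fun x => A x i j) 0) ∧
    (∀ᶠ x in 𝓝 0, (A x).trace = 0) ∧
    ∀ᶠ x in 𝓝 0, ∀ i j,
      V x i j = fderiv ℂ (fun y => M y i j) x (ξ x) + (A x * M x + M x * (A x).transpose) i j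

/-- `F` is an `SL`-miniversal deformation, with base `(ℂ^τ, 0)`, of the germ at `0 ∈ ℂˢ` of the
symmetric matrix family `M`: it is a holomorphic family of symmetric matrices with `F_0 = M`, and
its initial velocities `∂F/∂λ_l|_{λ=0}` form a basis (over `ℂ`) of the quotient of the space of all
symmetric matrix germs by the extended tangent space to the `SL`-equivalence class of `M`. -/
structure IsSLMiniversal {s n τ : ℕ} (M : (Fin s → ℂ) → Matrix (Fin n) (Fin n) ℂ)
    (F : (Fin τ → ℂ) → (Fin s → ℂ) → Matrix (Fin n) (Fin n) ℂ) : Prop where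
  analytic : ∀ i j, AnalyticAt ℂ (fun q : (Fin τ → ℂ) × (Fin s → ℂ) => F q.1 q.2 i j) (0, 0)
  symm : ∀ᶠ q : (Fin τ → ℂ) × (Fin s → ℂ) in 𝓝 (0, 0), (F q.1 q.2).IsSymm
  start : ∀ᶠ x in 𝓝 0, F 0 x = M x
  basis : ∀ V : (Fin s → ℂ) → Matrix (Fin n) (Fin n) ℂ,
    (∀ i j, AnalyticAt ℂ (fun x => V x i j) 0) → (∀ᶠ x in 𝓝 0, (V x).IsSymm) →
    ∃! c : Fin τ → ℂ, InTangentSL M (fun x => Matrix.of fun i j =>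
      V x i j - ∑ l, c l * deriv (fun t : ℂ => F (Pi.single l t) x i j) 0)

/-! ### Miniversal deformations of odd functions -/

/-- The function germ `g` at `0 ∈ ℂᵖ` lies in the tangent space to the orbit of the odd function
germ `f` under diffeomorphism germs commuting with `x ↦ -x`: it is the derivative of `f` along an
odd holomorphic vector field. -/
def InTangentROdd {p : ℕ} (f g : (Fin p → ℂ) → ℂ) : Prop :=
  ∃ ξ : (Fin p → ℂ) → (Fin p → ℂ),
    AnalyticAt ℂ ξ 0 ∧ (∀ᶠ x in 𝓝 0, ξ (-x) = -ξ x) ∧ ∀ᶠ x in 𝓝 0, g x = fderiv ℂ f x (ξ x)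

/-- `G` is a miniversal deformation, with base `(ℂ^τ, 0)`, of the odd function germ `f` at
`0 ∈ ℂᵖ` in the class of odd functions up to diffeomorphisms commuting with `x ↦ -x`. -/
structure IsROddMiniversal {p τ : ℕ} (f : (Fin p → ℂ) → ℂ)
    (G : (Fin τ → ℂ) → (Fin p → ℂ) → ℂ) : Prop where
  analytic : AnalyticAt ℂ (fun q : (Fin τ → ℂ) × (Fin p → ℂ) => G q.1 q.2) (0, 0)
  odd : ∀ᶠ q : (Fin τ → ℂ) × (Fin p → ℂ) in 𝓝 (0, 0), G q.1 (-q.2) = -G q.1 q.2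
  start : ∀ᶠ x in 𝓝 0, G 0 x = f x
  basis : ∀ g : (Fin p → ℂ) → ℂ, AnalyticAt ℂ g 0 → (∀ᶠ x in 𝓝 0, g (-x) = -g x) →
    ∃! c : Fin τ → ℂ, InTangentROdd f (fun x =>
      g x - ∑ l, c l * deriv (fun t : ℂ => G (Pi.single l t) x) 0)

/-! ### Critical points and Milnor numbers -/

/-- `p` is a critical point of `f`. -/
def IsCrit {s : ℕ} (f : (Fin s → ℂ) → ℂ) (p : Fin s → ℂ) : Prop :=
  fderiv ℂ f p = 0

/-- Functions holomorphic at `p` (representatives of holomorphic germs at `p`). -/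
def analyticFunctions {s : ℕ} (p : Fin s → ℂ) : Submodule ℂ ((Fin s → ℂ) → ℂ) where
  carrier := {g | AnalyticAt ℂ g p}
  add_mem' hf hg := AnalyticAt.add hf hg
  zero_mem' := analyticAt_const
  smul_mem' c _ hg := AnalyticAt.const_smul hg (c := c)

/-- Functions holomorphic at `p` whose germ at `p` lies in the ideal of the ring of holomorphic
germs generated by the partial derivatives of `f`. -/
def jacobianIdeal {s : ℕ} (f : (Fin s → ℂ) → ℂ) (p : Fin s → ℂ) :
    Submodule ℂ (analyticFunctions p) where
  carrier := {g | ∃ ξ : (Fin s → ℂ) → (Fin s → ℂ), AnalyticAt ℂ ξ p ∧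
    ∀ᶠ x in 𝓝 p, (g : (Fin s → ℂ) → ℂ) x = fderiv ℂ f x (ξ x)}
  add_mem' := by
    rintro g h ⟨ξ, hξ, hg⟩ ⟨η, hη, hh⟩
    refine ⟨ξ + η, hξ.add hη, ?_⟩
    filter_upwards [hg, hh] with x h1 h2
    simp [h1, h2]
  zero_mem' := ⟨0, analyticAt_const, by simp⟩
  smul_mem' := by
    rintro c g ⟨ξ, hξ, hg⟩
    refine ⟨c • ξ, hξ.const_smul, ?_⟩
    filter_upwards [hg] with x h1
    simp [h1]

/-- The Milnor number of `f` at `p`: the dimension of the local algebra, the quotient of the ring of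
holomorphic germs at `p` by the ideal generated by the partial derivatives of `f`. -/
def milnorNumber {s : ℕ} (f : (Fin s → ℂ) → ℂ) (p : Fin s → ℂ) : ℕ∞ :=
  Cardinal.toENat (Module.rank ℂ (analyticFunctions p ⧸ jacobianIdeal f p))

/-- The sum of the Milnor numbers of all critical points of `f` outside its zero level. -/
def offZeroMilnor {s : ℕ} (f : (Fin s → ℂ) → ℂ) : ℕ∞ :=
  ⨆ S : Finset {p : Fin s → ℂ // IsCrit f p ∧ f p ≠ 0}, ∑ p ∈ S, milnorNumber f p

/-- The set of non-zero critical values of `f`. -/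
def nonzeroCritValues {s : ℕ} (f : (Fin s → ℂ) → ℂ) : Set ℂ :=
  {v | v ≠ 0 ∧ ∃ p, IsCrit f p ∧ f p = v}

/-- `p` is a nondegenerate critical point of `f`: the Hessian matrix of `f` at `p` is invertible. -/
def IsNondegenerate {s : ℕ} (f : (Fin s → ℂ) → ℂ) (p : Fin s → ℂ) : Prop :=
  (Matrix.of fun i j : Fin s =>
    fderiv ℂ (fun y => fderiv ℂ f y (Pi.single i 1)) p (Pi.single j 1)).det ≠ 0

/-- `f` is a Morse function (in the strict sense usual in singularity theory): all its critical
points are nondegenerate, and the critical values at distinct critical points are distinct. -/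
def IsMorse {s : ℕ} (f : (Fin s → ℂ) → ℂ) : Prop :=
  (∀ p, IsCrit f p → IsNondegenerate f p) ∧
  ∀ p q, IsCrit f p → IsCrit f q → f p = f q → p = q

/-! ### Full bifurcation diagrams

The deformations considered below are quasi-homogeneous with positive weights of all variables and
all parameters, so that the diagrams are taken in the whole coordinate space `ℂ^τ`, and critical
points in the whole of `ℂˢ`. -/

/-- The determinantal function `det ∘ M` of a matrix family. -/
def detFun {s n : ℕ} (M : (Fin s → ℂ) → Matrix (Fin n) (Fin n) ℂ) : (Fin s → ℂ) → ℂ :=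
  fun x => (M x).det

/-- The singular Milnor number of the matrix family deformed by `F`: the maximum over the base of
the number of spheres in the bouquet `{det ∘ F_λ = 0}`, this number being the sum of the Milnor
numbers of the critical points of `det ∘ F_λ` outside the zero level. -/
def singularMilnorNumber {s n τ : ℕ}
    (F : (Fin τ → ℂ) → (Fin s → ℂ) → Matrix (Fin n) (Fin n) ℂ) : ℕ∞ :=
  ⨆ l : Fin τ → ℂ, offZeroMilnor (detFun (F l))

/-- The full bifurcation diagram of a matrix family with miniversal deformation `F`: the set of all
`λ` for which `det ∘ F_λ` has fewer distinct non-zero critical values than the singular Milnor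
number. -/
def matrixFullDiagram {s n τ : ℕ}
    (F : (Fin τ → ℂ) → (Fin s → ℂ) → Matrix (Fin n) (Fin n) ℂ) : Set (Fin τ → ℂ) :=
  {l | (nonzeroCritValues (detFun (F l))).encard < singularMilnorNumber F}

/-- The full bifurcation diagram of an odd function with odd miniversal deformation `G`: the set of
all `λ` for which `G_λ` is not Morse or has critical value zero. -/
def oddFullDiagram {p τ : ℕ} (G : (Fin τ → ℂ) → (Fin p → ℂ) → ℂ) : Set (Fin τ → ℂ) :=
  {l | ¬ IsMorse (G l) ∨ ∃ x, IsCrit (G l) x ∧ G l x = 0}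

/-! ### The corank 3 simple symmetric families in four variables and the simple odd functions

The coordinates on `ℂ⁴` are `x = u 0`, `y = u 1`, `z = u 2`, `w = u 3`. -/

/-- The types of the families; `I k` stands for the type `I_{k+1}`, `k ≥ 1`. -/
inductive Family where
  | I (k : ℕ) (hk : 1 ≤ k)
  | II4
  | II5
  | II6

/-- The number of parameters of the miniversal deformations. -/
def Family.tau : Family → ℕ
  | .I k _ => k + 1
  | .II4 => 4
  | .II5 => 5
  | .II6 => 6

/-- The normal forms of the matrix families. -/
def Family.matrix : Family → (Fin 4 → ℂ) → Matrix (Fin 3) (Fin 3) ℂ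
  | .I k _ => fun u =>
      !![u 0, 0, u 2;
         0, u 1 + u 0 ^ k, u 3;
         u 2, u 3, u 1]
  | .II4 => fun u =>
      !![u 0, u 3 ^ 2, u 1;
         u 3 ^ 2, u 1, u 2;
         u 1, u 2, u 3]
  | .II5 => fun u =>
      !![u 0, 0, u 1 + u 3 ^ 2;
         0, u 1, u 2;
         u 1 + u 3 ^ 2, u 2, u 3]
  | .II6 => fun u =>
      !![u 0, u 3 ^ 3, u 1;
         u 3 ^ 3, u 1, u 2;
         u 1, u 2, u 3]

def matrixDefI (k : ℕ) (l : Fin (k + 1) → ℂ) (u : Fin 4 → ℂ) : Matrix (Fin 3) (Fin 3) ℂ :=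
  !![u 0, l (Fin.last k), u 2;
     l (Fin.last k), u 1 + (u 0 ^ k + ∑ i : Fin k, l i.castSucc * u 0 ^ (i : ℕ)), u 3;
     u 2, u 3, u 1]

def matrixDefII4 (l : Fin 4 → ℂ) (u : Fin 4 → ℂ) : Matrix (Fin 3) (Fin 3) ℂ :=
  !![u 0, u 3 ^ 2 + l 1 * u 3 + l 0, u 1 + l 3 * u 3 + l 2;
     u 3 ^ 2 + l 1 * u 3 + l 0, u 1, u 2;
     u 1 + l 3 * u 3 + l 2, u 2, u 3]

def matrixDefII5 (l : Fin 5 → ℂ) (u : Fin 4 → ℂ) : Matrix (Fin 3) (Fin 3) ℂ :=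
  !![u 0, l 2 * u 3 ^ 2 + l 1 * u 3 + l 0, u 1 + u 3 ^ 2 + l 4 * u 3 + l 3;
     l 2 * u 3 ^ 2 + l 1 * u 3 + l 0, u 1, u 2;
     u 1 + u 3 ^ 2 + l 4 * u 3 + l 3, u 2, u 3]

def matrixDefII6 (l : Fin 6 → ℂ) (u : Fin 4 → ℂ) : Matrix (Fin 3) (Fin 3) ℂ :=
  !![u 0, u 3 ^ 3 + l 2 * u 3 ^ 2 + l 1 * u 3 + l 0, u 1 + l 5 * u 3 ^ 2 + l 4 * u 3 + l 3;
     u 3 ^ 3 + l 2 * u 3 ^ 2 + l 1 * u 3 + l 0, u 1, u 2;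
     u 1 + l 5 * u 3 ^ 2 + l 4 * u 3 + l 3, u 2, u 3]

/-- The deformations of the matrix families. -/
def Family.matrixDef : (S : Family) → (Fin S.tau → ℂ) → (Fin 4 → ℂ) → Matrix (Fin 3) (Fin 3) ℂ
  | .I k _ => matrixDefI k
  | .II4 => matrixDefII4
  | .II5 => matrixDefII5
  | .II6 => matrixDefII6

/-- The odd functions `D_{2k+2}/ℤ₂`, `E₈/ℤ₂`, `J₁₀/ℤ₂`, `E₁₂/ℤ₂` corresponding to the matrix
families. The coordinates on `ℂ²` are `a = v 0`, `c = v 1` for the first of them, and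
`b = v 0`, `c = v 1` for the others. -/
def Family.oddFun : Family → (Fin 2 → ℂ) → ℂ
  | .I k _ => fun v => v 0 * v 1 ^ 2 + v 0 ^ (2 * k + 1)
  | .II4 => fun v => v 0 ^ 3 + v 1 ^ 5
  | .II5 => fun v => v 0 ^ 3 - v 0 * v 1 ^ 4
  | .II6 => fun v => v 0 ^ 3 + v 1 ^ 7

def oddDefI (k : ℕ) (l : Fin (k + 1) → ℂ) (v : Fin 2 → ℂ) : ℂ :=
  v 0 * v 1 ^ 2 + v 0 ^ (2 * k + 1) + ∑ i : Fin k, l i.castSucc * v 0 ^ (2 * (i : ℕ) + 1)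
    + l (Fin.last k) * v 1

def oddDefII4 (l : Fin 4 → ℂ) (v : Fin 2 → ℂ) : ℂ :=
  v 0 ^ 3 + v 1 ^ 5 + l 0 * v 1 + l 1 * v 1 ^ 3 + l 2 * v 0 + l 3 * (v 0 * v 1 ^ 2)

def oddDefII5 (l : Fin 5 → ℂ) (v : Fin 2 → ℂ) : ℂ :=
  v 0 ^ 3 - v 0 * v 1 ^ 4 + l 0 * v 1 + l 1 * v 1 ^ 3 + l 2 * v 1 ^ 5
    + l 3 * v 0 + l 4 * (v 0 * v 1 ^ 2)

def oddDefII6 (l : Fin 6 → ℂ) (v : Fin 2 → ℂ) : ℂ :=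
  v 0 ^ 3 + v 1 ^ 7 + l 0 * v 1 + l 1 * v 1 ^ 3 + l 2 * v 1 ^ 5
    + l 3 * v 0 + l 4 * (v 0 * v 1 ^ 2) + l 5 * (v 0 * v 1 ^ 4)

/-- The deformations of the odd functions: all odd monomials of the monomial miniversal deformations
(for right equivalence) of the functions. -/
def Family.oddDef : (S : Family) → (Fin S.tau → ℂ) → (Fin 2 → ℂ) → ℂ
  | .I k _ => oddDefI k
  | .II4 => oddDefII4
  | .II5 => oddDefII5
  | .II6 => oddDefII6

end MatrixSing

end

/-! Both sides are compared through critical points. Let `N` be the cofactor matrix of `M_λ` at a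
critical point of `det ∘ M_λ` outside the zero level. Criticality says that `N` is trace-orthogonal
to all `∂M_λ/∂x_l`, which gives linear relations between its entries, and `adj N = det M · M`
recovers the matrix from `N`. For type `II` these relations leave two free entries, and after
normalisation by a square root of `-det` they become `(b, c)`, defined up to a common sign, with `y
= b²`, `z = -bc`, `w = c²`. The remaining equations say exactly that `(b, c)` is a critical point of
the odd function `b³ + b q(c²) + c p(c²)`, and then `det = -(odd function)²`. Type `I` works in the
same way with `x = a²`, `z = w = 0`, `μ = -ac`, where the odd function is `ac² + aP(a²) + 2μc` and
`det` is minus a quarter of its square. After a diagonal linear change of the parameters these odd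
functions are the given `M'_λ`, up to a linear change of variables for `II₅`
(`nonzeroCritValues_matII`, `nonzeroCritValues_matI`).

The squaring map is two-to-one on the non-zero critical values of an odd function, so the number of
non-zero critical values of the determinant is half of that of the odd function. An elimination
shows that every `M'_λ` has at most `2τ` critical points, with equality exactly when all are
nondegenerate: the eliminant has degree `2τ` for every `λ` (`commonZeros_count`). Hence `det ∘ M_λ`
has `τ` distinct non-zero critical values if and only if `M'_λ` is Morse without critical value zero
(`morse_iff_le_ncard`).

It remains to see that the singular Milnor number is `τ`. It is at least `τ` because an explicit
parameter value makes `M'_λ` Morse without critical value zero. For the upper bound, the relations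
between critical coordinates are proved as identities modulo Jacobian ideals, where the determinant
is locally a unit; they present a quotient of the polynomial ring spanned by `τ` elements, which by
the Chinese remainder theorem surjects onto the product of the local algebras
(`sum_milnorNumber_le`, `offZeroMilnor_matII_le`, `offZeroMilnor_matI_le`).

Miniversality is proved by generators and relations. Hadamard's lemma reduces spanning to monomials.
Linear independence for odd functions follows by restriction to curves along which the tangent space
vanishes to high order. For type `II` matrices independence is inherited from the odd functions:
pairing with the normalised `N` along the map `(b, c) ↦ (x, b², -bc, c²)` sends the `SL`-tangent
space into the odd tangent space (`InTangentSL.inTangentROdd`). For type `I` the `x`-axis and the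
origin suffice. -/

noncomputable section

namespace MatrixSing

/-! ### Hadamard's lemma and ideals of holomorphic germs -/

/-- Every homogeneous term of positive degree in the Taylor series has one argument `x - p` split
off; the shifted series has the same radius of convergence and sums to `h`. -/
theorem exists_analyticAt_clm_eq_add {E F : Type*} [NormedAddCommGroup E] [NormedSpace ℂ E]
    [NormedAddCommGroup F] [NormedSpace ℂ F] [CompleteSpace F] {g : E → F} {p : E}
    (hg : AnalyticAt ℂ g p) :
    ∃ h : E → E →L[ℂ] F, AnalyticAt ℂ h p ∧ ∀ᶠ x in 𝓝 p, g x = g p + h x (x - p) := by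
  obtain ⟨P, r, hP⟩ := hg
  have hr : 0 < P.shift.radius := by
    rw [FormalMultilinearSeries.radius_shift]; exact hP.r_pos.trans_le hP.r_le
  have hQ := (P.shift.hasFPowerSeriesOnBall hr).comp_sub p
  rw [zero_add] at hQ
  refine ⟨_, hQ.analyticAt, ?_⟩
  have hU := hQ.unshift (z := g p)
  have hrad : 0 < min r P.shift.radius := lt_min hP.r_pos hr
  filter_upwards [Metric.eball_mem_nhds p hrad] with x hx
  have h1 := (hP.mono hrad (min_le_left _ _)).hasSum_sub hx
  have h2 := (hU.mono hrad (min_le_right _ _)).hasSum_sub hx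
  refine h1.unique ?_
  convert h2 using 2 with n
  cases n with
  | zero =>
    simp only [FormalMultilinearSeries.unshift]
    rw [← hP.coeff_zero (fun _ : Fin 0 => x - p)]
    simp
  | succ n => simp [FormalMultilinearSeries.unshift, FormalMultilinearSeries.shift]

theorem exists_hadamard {s : ℕ} {g : (Fin s → ℂ) → ℂ} {p : Fin s → ℂ} (hg : AnalyticAt ℂ g p) :
    ∃ h : Fin s → (Fin s → ℂ) → ℂ, (∀ i, AnalyticAt ℂ (h i) p) ∧
      ∀ᶠ x in 𝓝 p, g x = g p + ∑ i, (x i - p i) * h i x := by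
  obtain ⟨h, hh, he⟩ := exists_analyticAt_clm_eq_add hg
  refine ⟨fun i x => h x (Pi.single i 1), fun i => ?_, ?_⟩
  · exact ((ContinuousLinearMap.apply ℂ ℂ (Pi.single i (1 : ℂ) : Fin s → ℂ)).analyticAt _).comp hh
  · filter_upwards [he] with x hx
    rw [hx]
    congr 1
    conv_lhs => rw [pi_eq_sum_univ' (x - p)]
    simp [map_sum]

theorem analyticAt_coord {s : ℕ} (i : Fin s) (p : Fin s → ℂ) :
    AnalyticAt ℂ (fun x : Fin s → ℂ => x i) p :=
  (ContinuousLinearMap.proj (R := ℂ) (φ := fun _ : Fin s => ℂ) i).analyticAt p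

theorem analyticAt_monomial {s : ℕ} (t : Finset (Fin s)) (α : Fin s → ℕ) (q p : Fin s → ℂ) :
    AnalyticAt ℂ (fun x : Fin s → ℂ => ∏ i ∈ t, (x i - q i) ^ α i) p :=
  Finset.analyticAt_fun_prod t fun i _ => ((analyticAt_coord i p).sub analyticAt_const).pow (α i)

theorem prod_pow_add_single {s : ℕ} (a : Fin s → ℂ) (α : Fin s → ℕ) (j : Fin s) :
    ∏ i, a i ^ (α + Pi.single j 1 : Fin s → ℕ) i = (∏ i, a i ^ α i) * a j := by
  simp only [Pi.add_apply, pow_add, Finset.prod_mul_distrib]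
  congr 1
  rw [Finset.prod_eq_single j] <;> simp +contextual

/-- If a vector space `U` of function germs contains all monomials in `x - p` and all holomorphic
multiples of some power of each coordinate, then it contains all holomorphic germs. -/
theorem mem_of_monomials_mem {s : ℕ} {p : Fin s → ℂ} (U : Submodule ℂ ((Fin s → ℂ) → ℂ))
    (hU : ∀ g g' : (Fin s → ℂ) → ℂ, (∀ᶠ x in 𝓝 p, g x = g' x) → g' ∈ U → g ∈ U)
    (hmon : ∀ α : Fin s → ℕ, (fun x => ∏ i, (x i - p i) ^ α i) ∈ U) (m : ℕ)
    (hpow : ∀ i, ∀ g : (Fin s → ℂ) → ℂ, AnalyticAt ℂ g p → (fun x => (x i - p i) ^ m * g x) ∈ U)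
    {g : (Fin s → ℂ) → ℂ} (hg : AnalyticAt ℂ g p) : g ∈ U := by
  -- Here `n` bounds the distance from `∑ α i` to `s * m`. Once the degree reaches `s * m`, some
  -- exponent is at least `m` by the pigeonhole principle and `hpow` applies; below that degree
  -- Hadamard's lemma splits off a constant and raises the degree by one.
  have key : ∀ n : ℕ, ∀ α : Fin s → ℕ, s * m ≤ n + ∑ i, α i → ∀ g : (Fin s → ℂ) → ℂ,
      AnalyticAt ℂ g p → (fun x => (∏ i, (x i - p i) ^ α i) * g x) ∈ U := by
    intro n
    induction n with
    | zero =>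
      intro α hα g hg
      -- Without coordinates the pigeonhole principle gives nothing, but all germs are constant.
      rcases Nat.eq_zero_or_pos s with rfl | hs
      · have : (fun x : Fin 0 → ℂ => (∏ i, (x i - p i) ^ α i) * g x)
            = g p • fun x : Fin 0 → ℂ => ∏ i, (x i - p i) ^ α i := by
          funext x
          simp [Subsingleton.elim x p]
        rw [this]
        exact U.smul_mem _ (hmon α)
      obtain ⟨i, hi⟩ : ∃ i, m ≤ α i := by
        by_contra! h
        have : ∑ i, α i < ∑ _i : Fin s, m :=
          Finset.sum_lt_sum_of_nonempty ⟨⟨0, hs⟩, Finset.mem_univ _⟩ fun i _ => h i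
        simp at this
        omega
      have := hpow i (fun x => (x i - p i) ^ (α i - m) *
        ((∏ j ∈ Finset.univ.erase i, (x j - p j) ^ α j) * g x))
        ((((analyticAt_coord i p).sub analyticAt_const).pow _).mul
          ((analyticAt_monomial _ α p p).mul hg))
      refine hU _ _ (Filter.Eventually.of_forall fun x => ?_) this
      rw [← Finset.mul_prod_erase Finset.univ _ (Finset.mem_univ i)]
      conv_lhs => rw [← Nat.add_sub_cancel' hi, pow_add]
      ring
    | succ n ih =>
      intro α hα g hg
      obtain ⟨h, hh, he⟩ := exists_hadamard hg
      have hj : ∀ j : Fin s,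
          (fun x => (∏ i, (x i - p i) ^ (α + Pi.single j 1 : Fin s → ℕ) i) * h j x) ∈ U := by
        intro j
        refine ih (α + Pi.single j 1) ?_ (h j) (hh j)
        have : ∑ i, (Pi.single j 1 : Fin s → ℕ) i = 1 := by simp
        simp only [Pi.add_apply, Finset.sum_add_distrib, this]
        omega
      refine hU _ _ ?_ (U.add_mem (U.smul_mem (g p) (hmon α))
        (U.sum_mem (t := Finset.univ) fun j _ => hj j))
      filter_upwards [he] with x hx
      simp only [Pi.add_apply, Pi.smul_apply, smul_eq_mul, Finset.sum_apply]
      have : ∀ j : Fin s, (∏ i, (x i - p i) ^ (α + Pi.single j 1 : Fin s → ℕ) i)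
          = (∏ i, (x i - p i) ^ α i) * (x j - p j) :=
        fun j => prod_pow_add_single (fun i => x i - p i) α j
      simp only [Pi.add_apply] at this
      simp only [this]
      rw [hx, mul_add, Finset.mul_sum, mul_comm (g p)]
      simp only [mul_assoc]
  simpa using key (s * m) 0 (by simp) g hg

/-- The germ of `g` at `p` lies in the ideal generated by the partial derivatives of `f`. -/
def InJacobian {s : ℕ} (f : (Fin s → ℂ) → ℂ) (p : Fin s → ℂ) (g : (Fin s → ℂ) → ℂ) : Prop :=
  ∃ ξ : (Fin s → ℂ) → (Fin s → ℂ), AnalyticAt ℂ ξ p ∧ ∀ᶠ x in 𝓝 p, g x = fderiv ℂ f x (ξ x)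

namespace InJacobian

variable {s : ℕ} {f : (Fin s → ℂ) → ℂ} {p : Fin s → ℂ} {g h : (Fin s → ℂ) → ℂ}

theorem congr (hg : InJacobian f p g) (he : ∀ᶠ x in 𝓝 p, h x = g x) : InJacobian f p h := by
  obtain ⟨ξ, hξ, hg⟩ := hg
  refine ⟨ξ, hξ, ?_⟩
  filter_upwards [hg, he] with x h1 h2
  rw [h2, h1]

theorem zero : InJacobian f p 0 := ⟨0, analyticAt_const, by simp⟩

theorem add (hg : InJacobian f p g) (hh : InJacobian f p h) :
    InJacobian f p (fun x => g x + h x) := by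
  obtain ⟨ξ, hξ, hg⟩ := hg
  obtain ⟨η, hη, hh⟩ := hh
  refine ⟨ξ + η, hξ.add hη, ?_⟩
  filter_upwards [hg, hh] with x h1 h2
  simp [h1, h2]

theorem mul_left {a : (Fin s → ℂ) → ℂ} (ha : AnalyticAt ℂ a p) (hg : InJacobian f p g) :
    InJacobian f p (fun x => a x * g x) := by
  obtain ⟨ξ, hξ, hg⟩ := hg
  refine ⟨fun x => a x • ξ x, ha.smul hξ, ?_⟩
  filter_upwards [hg] with x h1
  simp [h1]

theorem of_mul {a : (Fin s → ℂ) → ℂ} (ha : AnalyticAt ℂ a p) (ha0 : a p ≠ 0)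
    (hg : InJacobian f p (fun x => a x * g x)) : InJacobian f p g := by
  refine (hg.mul_left (ha.inv ha0)).congr ?_
  filter_upwards [ha.continuousAt.eventually_ne ha0] with x hx
  simp [hx]

theorem partial_mem (f : (Fin s → ℂ) → ℂ) (p : Fin s → ℂ) (i : Fin s) :
    InJacobian f p (fun x => fderiv ℂ f x (Pi.single i 1)) :=
  ⟨fun _ => Pi.single i 1, analyticAt_const, by simp⟩

end InJacobian

/-! ### Lower and upper bounds for Milnor numbers. -/

/-- At a critical point every element of the Jacobian ideal vanishes, so `1` survives in the local
algebra. -/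
theorem one_le_milnorNumber {s : ℕ} {f : (Fin s → ℂ) → ℂ} {p : Fin s → ℂ} (hp : IsCrit f p) :
    1 ≤ milnorNumber f p := by
  have : Nontrivial (analyticFunctions p ⧸ jacobianIdeal f p) := by
    rw [Submodule.Quotient.nontrivial_iff]
    intro h
    have h1 : (⟨fun _ => 1, analyticAt_const⟩ : analyticFunctions p) ∈ jacobianIdeal f p := by
      rw [h]; trivial
    obtain ⟨ξ, -, he⟩ := h1
    have := he.self_of_nhds
    rw [hp] at this
    simp at this
  rw [milnorNumber]
  have h2 : (1 : Cardinal) ≤ Module.rank ℂ (analyticFunctions p ⧸ jacobianIdeal f p) :=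
    Cardinal.one_le_iff_ne_zero.2 (rank_pos (R := ℂ)).ne'
  simpa using OrderHomClass.mono Cardinal.toENat h2

theorem encard_nonzeroCritValues_le {s : ℕ} (f : (Fin s → ℂ) → ℂ) :
    (nonzeroCritValues f).encard ≤ offZeroMilnor f := by
  classical
  refine ENat.forall_natCast_le_iff_le.1 fun n hn => ?_
  obtain ⟨V, hV, hVn⟩ := Set.exists_subset_encard_eq hn
  have hfin : V.Finite := Set.finite_of_encard_eq_coe hVn
  choose! P hP using fun v (hv : v ∈ V) => (hV hv).2
  have hmem : ∀ v ∈ V, IsCrit f (P v) ∧ f (P v) ≠ 0 := fun v hv =>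
    ⟨(hP v hv).1, by rw [(hP v hv).2]; exact (hV hv).1⟩
  let Q : hfin.toFinset → {p : Fin s → ℂ // IsCrit f p ∧ f p ≠ 0} :=
    fun v => ⟨P v, hmem v (hfin.mem_toFinset.1 v.2)⟩
  have hQ : Function.Injective Q := by
    intro v w h
    have h1 : P v = P w := congrArg Subtype.val h
    apply Subtype.ext
    rw [← (hP v (hfin.mem_toFinset.1 v.2)).2, h1, (hP w (hfin.mem_toFinset.1 w.2)).2]
  refine le_trans ?_ (le_iSup _ (Finset.univ.map ⟨Q, hQ⟩))
  rw [Finset.sum_map]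
  calc (n : ℕ∞) = ∑ _v : hfin.toFinset, 1 := by
        rw [← hVn, hfin.encard_eq_coe_toFinset_card]; simp
    _ ≤ _ := Finset.sum_le_sum fun v _ => one_le_milnorNumber (Q v).2.1

/-- The Jacobian ideal of `f` at `p`, restricted to polynomials. -/
def polynomialJacobian {s : ℕ} (f : (Fin s → ℂ) → ℂ) (p : Fin s → ℂ) :
    Ideal (MvPolynomial (Fin s) ℂ) where
  carrier := {g | InJacobian f p fun x => MvPolynomial.eval x g}
  add_mem' := by
    intro a b ha hb
    simpa using InJacobian.add ha hb
  zero_mem' := InJacobian.zero.congr (by simp)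
  smul_mem' := by
    intro c g hg
    simpa using InJacobian.mul_left (AnalyticOnNhd.eval_mvPolynomial c p trivial) hg

theorem mem_polynomialJacobian {s : ℕ} {f : (Fin s → ℂ) → ℂ} {p : Fin s → ℂ}
    {g : MvPolynomial (Fin s) ℂ} :
    g ∈ polynomialJacobian f p ↔ InJacobian f p fun x => MvPolynomial.eval x g := Iff.rfl

/-- Each coordinate is integral over `ℂ` in the finite-dimensional quotient, hence a root of a
nonzero polynomial `χ`. Near `p` the factor of `χ` prime to `X - p i` is a unit, which leaves a
power of `x i - p i` in the Jacobian ideal. -/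
theorem exists_coord_pow_mem {s : ℕ} {f : (Fin s → ℂ) → ℂ} {S : Finset (Fin s → ℂ)}
    {K : Ideal (MvPolynomial (Fin s) ℂ)} [Module.Finite ℂ (MvPolynomial (Fin s) ℂ ⧸ K)]
    (hK : ∀ p ∈ S, K ≤ polynomialJacobian f p) :
    ∃ m : ℕ, ∀ p ∈ S, ∀ i, InJacobian f p fun x => (x i - p i) ^ m := by
  have hint : ∀ i, ∃ χ : Polynomial ℂ, χ ≠ 0 ∧ Polynomial.aeval (MvPolynomial.X i) χ ∈ K := by
    intro i
    obtain ⟨χ, hm, h0⟩ := Algebra.IsIntegral.isIntegral (R := ℂ)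
      (Ideal.Quotient.mk K (MvPolynomial.X i))
    refine ⟨χ, hm.ne_zero, ?_⟩
    rw [← Ideal.Quotient.eq_zero_iff_mem]
    rw [← h0, ← Ideal.Quotient.mkₐ_eq_mk ℂ, ← Polynomial.aeval_algHom_apply]
    rfl
  choose χ hχ0 hχ using hint
  -- A root multiplicity is at most the degree, so the sum of the degrees serves all points and all
  -- coordinates at once.
  refine ⟨∑ i, (χ i).natDegree, fun p hp i => ?_⟩
  have h1 := mem_polynomialJacobian.1 (hK p hp (hχ i))
  obtain ⟨u, hu, hu0⟩ := Polynomial.exists_eq_pow_rootMultiplicity_mul_and_not_dvd (χ i)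
    (hχ0 i) (p i)
  set r := (χ i).rootMultiplicity (p i)
  have hr : r ≤ ∑ i, (χ i).natDegree :=
    ((by rw [show r = _ from (Polynomial.count_roots (χ i)).symm]
         exact (Multiset.count_le_card _ _).trans (Polynomial.card_roots' _) :
         r ≤ (χ i).natDegree).trans
      (Finset.single_le_sum (f := fun i => (χ i).natDegree) (fun _ _ => Nat.zero_le _)
        (Finset.mem_univ i)))
  have h2 : InJacobian f p fun x => u.eval (x i) * (x i - p i) ^ r := by
    refine h1.congr (Filter.Eventually.of_forall fun x => ?_)
    have : MvPolynomial.eval x (Polynomial.aeval (MvPolynomial.X i) (χ i))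
        = (χ i).eval (x i) := by
      have := Polynomial.aeval_algHom_apply (MvPolynomial.aeval x : MvPolynomial (Fin s) ℂ →ₐ[ℂ] ℂ)
        (MvPolynomial.X i) (χ i)
      simpa [MvPolynomial.aeval_eq_eval] using this.symm
    rw [this, hu]
    simp [mul_comm, r]
  have ha : AnalyticAt ℂ (fun x : Fin s → ℂ => u.eval (x i)) p :=
    (AnalyticOnNhd.eval_polynomial u (p i) trivial).comp_of_eq (analyticAt_coord i p) rfl
  have h3 := h2.of_mul ha (by
    rwa [Ne, ← Polynomial.IsRoot.def, ← Polynomial.dvd_iff_isRoot])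
  refine (h3.mul_left (a := fun x => (x i - p i) ^ (∑ i, (χ i).natDegree - r))
    (((analyticAt_coord i p).sub analyticAt_const).pow _)).congr
    (Filter.Eventually.of_forall fun x => ?_)
  rw [← pow_add, Nat.sub_add_cancel hr]

/-- Powers of the coordinates in the Jacobian ideal absorb the tails of Taylor expansions, so
polynomials already fill the local algebra. -/
theorem exists_polynomial_sub_mem_jacobian {s m : ℕ} {f : (Fin s → ℂ) → ℂ} {p : Fin s → ℂ}
    (hm : ∀ i, InJacobian f p fun x => (x i - p i) ^ m) {g : (Fin s → ℂ) → ℂ}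
    (hg : AnalyticAt ℂ g p) :
    ∃ h : MvPolynomial (Fin s) ℂ, InJacobian f p fun x => g x - MvPolynomial.eval x h := by
  let U : Submodule ℂ ((Fin s → ℂ) → ℂ) :=
    { carrier := {g | ∃ h : MvPolynomial (Fin s) ℂ,
        InJacobian f p fun x => g x - MvPolynomial.eval x h}
      add_mem' := by
        rintro a b ⟨c, hc⟩ ⟨d, hd⟩
        refine ⟨c + d, (hc.add hd).congr (Filter.Eventually.of_forall fun x => ?_)⟩
        simp; ring
      zero_mem' := ⟨0, InJacobian.zero.congr (by simp)⟩
      smul_mem' := by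
        rintro c a ⟨b, hb⟩
        refine ⟨MvPolynomial.C c * b, (hb.mul_left (analyticAt_const (v := c))).congr
          (Filter.Eventually.of_forall fun x => ?_)⟩
        simp; ring }
  refine mem_of_monomials_mem (p := p) U ?_ ?_ m ?_ hg
  · rintro a b he ⟨h, hh⟩
    refine ⟨h, hh.congr ?_⟩
    filter_upwards [he] with x hx
    rw [hx]
  · intro α
    exact ⟨∏ i, (MvPolynomial.X i - MvPolynomial.C (p i)) ^ α i, InJacobian.zero.congr (by simp)⟩
  · intro i a ha
    exact ⟨0, ((hm i).mul_left ha).congr (Filter.Eventually.of_forall fun x => by simp [mul_comm])⟩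

/-- Two distinct points differ in a coordinate, and `X i - p i`, `X i - q i` differ by a nonzero
constant; coprimality passes to their `m`-th powers, which lie in the two ideals. -/
theorem isCoprime_polynomialJacobian {s m : ℕ} {f : (Fin s → ℂ) → ℂ} {p q : Fin s → ℂ}
    (hp : ∀ i, InJacobian f p fun x => (x i - p i) ^ m)
    (hq : ∀ i, InJacobian f q fun x => (x i - q i) ^ m) (hpq : p ≠ q) :
    IsCoprime (polynomialJacobian f p) (polynomialJacobian f q) := by
  obtain ⟨i, hi⟩ := Function.ne_iff.1 hpq
  have h1 : (MvPolynomial.X i - MvPolynomial.C (p i)) ^ m ∈ polynomialJacobian f p := by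
    simpa [mem_polynomialJacobian] using hp i
  have h2 : (MvPolynomial.X i - MvPolynomial.C (q i)) ^ m ∈ polynomialJacobian f q := by
    simpa [mem_polynomialJacobian] using hq i
  have hc : IsCoprime (MvPolynomial.X i - MvPolynomial.C (p i) : MvPolynomial (Fin s) ℂ)
      (MvPolynomial.X i - MvPolynomial.C (q i)) := by
    refine ⟨MvPolynomial.C (q i - p i)⁻¹, -MvPolynomial.C (q i - p i)⁻¹, ?_⟩
    have : (MvPolynomial.C (q i - p i)⁻¹ : MvPolynomial (Fin s) ℂ)
        * MvPolynomial.C (q i - p i) = 1 := by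
      rw [← map_mul, inv_mul_cancel₀ (sub_ne_zero.2 (Ne.symm hi)), map_one]
    rw [map_sub] at this
    linear_combination this
  rw [Ideal.isCoprime_iff_exists]
  obtain ⟨a, b, hab⟩ := hc.pow (m := m) (n := m)
  exact ⟨_, Ideal.mul_mem_left _ a h1, _, Ideal.mul_mem_left _ b h2, hab⟩

/-- The surjection factors through `V ⧸ K`, so the product and then each factor are
finite-dimensional; only after that can the cardinal ranks be replaced by natural numbers and added.
-/
theorem sum_toENat_rank_le {ι V : Type*} [Fintype ι] {T : ι → Type*} [∀ i, AddCommGroup (T i)]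
    [∀ i, Module ℂ (T i)] [AddCommGroup V] [Module ℂ V] {τ : ℕ} {Ψ : V →ₗ[ℂ] ∀ i, T i}
    (hΨ : Function.Surjective Ψ) {K : Submodule ℂ V} (hfin : Module.Finite ℂ (V ⧸ K))
    (hτ : Module.finrank ℂ (V ⧸ K) ≤ τ) (hK : K ≤ LinearMap.ker Ψ) :
    ∑ i, Cardinal.toENat (Module.rank ℂ (T i)) ≤ τ := by
  let Ψ' := K.liftQ Ψ hK
  have hΨ' : Function.Surjective Ψ' := by
    intro t
    obtain ⟨g, hg⟩ := hΨ t
    exact ⟨Submodule.Quotient.mk g, hg⟩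
  have hfinp : Module.Finite ℂ (∀ i, T i) := Module.Finite.of_surjective Ψ' hΨ'
  have hfini : ∀ i, Module.Finite ℂ (T i) := fun i =>
    Module.Finite.of_surjective (LinearMap.proj (R := ℂ) (φ := T) i) (Function.surjective_eval i)
  have hle : Module.finrank ℂ (∀ i, T i) ≤ τ :=
    (LinearMap.finrank_le_finrank_of_surjective (f := Ψ') hΨ').trans hτ
  rw [Module.finrank_pi_fintype] at hle
  calc ∑ i, Cardinal.toENat (Module.rank ℂ (T i)) = ∑ i, ((Module.finrank ℂ (T i) : ℕ) : ℕ∞) := by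
        refine Finset.sum_congr rfl fun i _ => ?_
        rw [← Module.finrank_eq_rank, Cardinal.toENat_nat]
    _ ≤ τ := by exact_mod_cast hle

/-- Evaluation of polynomials, as functions holomorphic at `p`. -/
def polynomialFunction {s : ℕ} (p : Fin s → ℂ) :
    MvPolynomial (Fin s) ℂ →ₗ[ℂ] analyticFunctions p where
  toFun g := ⟨fun x => MvPolynomial.eval x g, AnalyticOnNhd.eval_mvPolynomial g p trivial⟩
  map_add' a b := by ext x; simp
  map_smul' a b := by ext x; simp

/-- The class of a polynomial in the local algebra of `f` at `p`. -/
def polynomialClass {s : ℕ} (f : (Fin s → ℂ) → ℂ) (p : Fin s → ℂ) :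
    MvPolynomial (Fin s) ℂ →ₗ[ℂ] analyticFunctions p ⧸ jacobianIdeal f p :=
  (Submodule.mkQ _).comp (polynomialFunction p)

theorem polynomialClass_eq_zero {s : ℕ} {f : (Fin s → ℂ) → ℂ} {p : Fin s → ℂ}
    {g : MvPolynomial (Fin s) ℂ} (hg : g ∈ polynomialJacobian f p) : polynomialClass f p g = 0 :=
  (Submodule.Quotient.mk_eq_zero _).2 hg

theorem polynomialClass_surjective {s m : ℕ} {f : (Fin s → ℂ) → ℂ} {p : Fin s → ℂ}
    (hm : ∀ i, InJacobian f p fun x => (x i - p i) ^ m) :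
    Function.Surjective (polynomialClass f p) := by
  intro t
  obtain ⟨⟨g, hg⟩, hgt⟩ := Submodule.mkQ_surjective _ t
  obtain ⟨h, hh⟩ := exists_polynomial_sub_mem_jacobian hm hg
  refine ⟨h, ?_⟩
  rw [← hgt]
  symm
  exact (Submodule.Quotient.eq _).2 hh

/-- The sum of the Milnor numbers of `f` at finitely many points is at most the dimension of any
finite-dimensional quotient of the polynomial ring by an ideal that is locally contained in the
Jacobian ideal at each of the points. -/
theorem sum_milnorNumber_le {s τ : ℕ} {f : (Fin s → ℂ) → ℂ} {S : Finset (Fin s → ℂ)}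
    {K : Ideal (MvPolynomial (Fin s) ℂ)} [Module.Finite ℂ (MvPolynomial (Fin s) ℂ ⧸ K)]
    (hτ : Module.finrank ℂ (MvPolynomial (Fin s) ℂ ⧸ K) ≤ τ)
    (hK : ∀ p ∈ S, K ≤ polynomialJacobian f p) :
    ∑ p ∈ S, milnorNumber f p ≤ τ := by
  obtain ⟨m, hm⟩ := exists_coord_pow_mem hK
  rw [← Finset.sum_coe_sort]
  refine sum_toENat_rank_le (T := fun p : S => analyticFunctions p.1 ⧸ jacobianIdeal f p.1)
    (Ψ := LinearMap.pi fun p : S => polynomialClass f p.1) ?_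
    (K := K.restrictScalars ℂ) (inferInstanceAs (Module.Finite ℂ (MvPolynomial (Fin s) ℂ ⧸ K)))
    hτ ?_
  · intro t
    choose h hh using fun p : S => polynomialClass_surjective (hm p.1 p.2) (t p)
    -- Chinese remainder theorem: one polynomial realises prescribed classes at all points of `S`
    -- simultaneously.
    obtain ⟨a, ha⟩ := Ideal.exists_forall_sub_mem_ideal
      (I := fun p : S => polynomialJacobian f p.1)
      (fun p q hpq => isCoprime_polynomialJacobian (hm p.1 p.2) (hm q.1 q.2)
        (fun h => hpq (Subtype.ext h))) h
    refine ⟨a, funext fun p => ?_⟩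
    rw [LinearMap.pi_apply, ← hh p, ← sub_eq_zero, ← map_sub]
    exact polynomialClass_eq_zero (ha p)
  · intro g hg
    rw [LinearMap.mem_ker]
    funext p
    exact polynomialClass_eq_zero (hK p.1 p.2 hg)

/-- The ideal may depend on `S`, because `offZeroMilnor` is a supremum over finite sets. Finiteness
of the critical set need not be known beforehand. -/
theorem offZeroMilnor_le {s τ : ℕ} {f : (Fin s → ℂ) → ℂ}
    (h : ∀ S : Finset (Fin s → ℂ), (∀ p ∈ S, IsCrit f p ∧ f p ≠ 0) →
      ∃ K : Ideal (MvPolynomial (Fin s) ℂ), Module.Finite ℂ (MvPolynomial (Fin s) ℂ ⧸ K) ∧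
        Module.finrank ℂ (MvPolynomial (Fin s) ℂ ⧸ K) ≤ τ ∧
        ∀ p ∈ S, K ≤ polynomialJacobian f p) :
    offZeroMilnor f ≤ τ := by
  refine iSup_le fun S => ?_
  obtain ⟨K, hK1, hK2, hK3⟩ := h (S.map (Function.Embedding.subtype _)) (by
    simp only [Finset.mem_map]
    rintro _ ⟨p, -, rfl⟩
    exact p.2)
  simpa using sum_milnorNumber_le hK2 hK3

/-! ### Counting the common zeros of `b² + g(c)` and `F₀(c) + b F₁(c)` -/

open Polynomial in
/-- The resultant of `b² + g` and `F₀ + b F₁` with respect to `b`. -/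
def normPoly (g F₀ F₁ : ℂ[X]) : ℂ[X] := F₀ ^ 2 + g * F₁ ^ 2

open Polynomial in
/-- The common zeros `(b, c)` of `b² + g(c)` and `F₀(c) + b F₁(c)`. -/
def commonZeros (g F₀ F₁ : ℂ[X]) : Set (ℂ × ℂ) :=
  {p | p.1 ^ 2 + g.eval p.2 = 0 ∧ F₀.eval p.2 + p.1 * F₁.eval p.2 = 0}

open Polynomial in
/-- The Jacobian determinant of `(b² + g(c), F₀(c) + b F₁(c))`. -/
def zerosJacobian (g F₀ F₁ : ℂ[X]) (p : ℂ × ℂ) : ℂ :=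
  2 * p.1 * (F₀.derivative.eval p.2 + p.1 * F₁.derivative.eval p.2)
    - g.derivative.eval p.2 * F₁.eval p.2

section
open Polynomial

variable {g F₀ F₁ : ℂ[X]}

/-- Modulo `b² + g` the norm factors as `(F₀ + b F₁)(F₀ - b F₁)`. -/
theorem isRoot_normPoly {p : ℂ × ℂ} (hp : p ∈ commonZeros g F₀ F₁) :
    (normPoly g F₀ F₁).IsRoot p.2 := by
  obtain ⟨h1, h2⟩ := hp
  simp only [normPoly, IsRoot, eval_add, eval_mul, eval_pow]
  linear_combination (F₀.eval p.2 - p.1 * F₁.eval p.2) * h2 + F₁.eval p.2 ^ 2 * h1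

/-- The values of `b` over `c`. -/
def zerosFiber (g F₀ F₁ : ℂ[X]) (c : ℂ) : Set ℂ := {b | (b, c) ∈ commonZeros g F₀ F₁}

theorem zerosFiber_of_ne {c : ℂ} (hc : (normPoly g F₀ F₁).IsRoot c) (h1 : F₁.eval c ≠ 0) :
    zerosFiber g F₀ F₁ c = {-F₀.eval c / F₁.eval c} := by
  simp only [normPoly, IsRoot, eval_add, eval_mul, eval_pow] at hc
  ext b
  simp only [zerosFiber, commonZeros, Set.mem_ofPred_eq, Set.mem_singleton_iff]
  constructor
  · rintro ⟨-, h⟩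
    field_simp
    linear_combination h
  · rintro rfl
    constructor
    · field_simp
      linear_combination hc
    · field_simp
      ring

/-- When `F₁(c) ≠ 0`, the value of `b` is determined by `c`, and at the corresponding point the
derivative of the norm is `-F₁(c)` times the Jacobian. So the root is simple exactly when the common
zero is nondegenerate. -/
theorem fiber_count_of_ne {c : ℂ} (hN : normPoly g F₀ F₁ ≠ 0) (hc : (normPoly g F₀ F₁).IsRoot c)
    (h1 : F₁.eval c ≠ 0) :
    (zerosFiber g F₀ F₁ c).ncard ≤ (normPoly g F₀ F₁).rootMultiplicity c ∧
    ((zerosFiber g F₀ F₁ c).ncard = (normPoly g F₀ F₁).rootMultiplicity c ↔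
      ∀ b ∈ zerosFiber g F₀ F₁ c, zerosJacobian g F₀ F₁ (b, c) ≠ 0) := by
  have hpos := (rootMultiplicity_pos hN).2 hc
  have hiff := one_lt_rootMultiplicity_iff_isRoot (t := c) hN
  have hb : -F₀.eval c / F₁.eval c ∈ zerosFiber g F₀ F₁ c := by
    rw [zerosFiber_of_ne hc h1]; rfl
  have hd : (normPoly g F₀ F₁).derivative.eval c
      = -F₁.eval c * zerosJacobian g F₀ F₁ (-F₀.eval c / F₁.eval c, c) := by
    obtain ⟨e1, e2⟩ := hb
    dsimp only at e1 e2
    generalize -F₀.eval c / F₁.eval c = b at e1 e2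
    simp only [normPoly, zerosJacobian, derivative_add, derivative_mul, derivative_pow, eval_add,
      eval_mul, eval_pow, Nat.cast_ofNat]
    simp
    linear_combination 2 * F₀.derivative.eval c * e2 + 2 * F₁.eval c * F₁.derivative.eval c * e1
  rw [zerosFiber_of_ne hc h1, Set.ncard_singleton]
  refine ⟨hpos, ?_⟩
  simp only [Set.mem_singleton_iff, forall_eq]
  rw [IsRoot.def, IsRoot.def, hd] at hiff
  constructor
  · intro h h0
    have := hiff.2 ⟨hc, by rw [h0, mul_zero]⟩
    omega
  · intro h
    by_contra hne
    have := (hiff.1 (by omega)).2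
    exact h ((mul_eq_zero.1 this).resolve_left (neg_ne_zero.2 h1))

/-- When `F₁(c) = 0`, also `F₀(c) = 0`, and the fibre consists of all square roots of `-g(c)`. The
norm is `(X - c)²` times the norm of the quotients `φ₀`, `φ₁`; the multiplicity is 2 exactly when
this second norm does not vanish at `c`, and its value there is the product of the factors `φ₀ + b
φ₁` over the two roots. -/
theorem fiber_count_of_eq {c : ℂ} (hN : normPoly g F₀ F₁ ≠ 0) (hc : (normPoly g F₀ F₁).IsRoot c)
    (h1 : F₁.eval c = 0) :
    (zerosFiber g F₀ F₁ c).ncard ≤ (normPoly g F₀ F₁).rootMultiplicity c ∧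
    ((zerosFiber g F₀ F₁ c).ncard = (normPoly g F₀ F₁).rootMultiplicity c ↔
      ∀ b ∈ zerosFiber g F₀ F₁ c, zerosJacobian g F₀ F₁ (b, c) ≠ 0) := by
  have h0 : F₀.eval c = 0 := by
    simpa [normPoly, IsRoot, h1] using hc
  obtain ⟨φ₀, hφ₀⟩ := dvd_iff_isRoot.2 (show F₀.IsRoot c from h0)
  obtain ⟨φ₁, hφ₁⟩ := dvd_iff_isRoot.2 (show F₁.IsRoot c from h1)
  have hfac : normPoly g F₀ F₁ = normPoly g φ₀ φ₁ * (X - C c) ^ 2 := by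
    rw [normPoly, normPoly, hφ₀, hφ₁]; ring
  have hN' : normPoly g φ₀ φ₁ ≠ 0 := by
    rintro h
    rw [hfac, h, zero_mul] at hN
    exact hN rfl
  have hmult : (normPoly g F₀ F₁).rootMultiplicity c
      = (normPoly g φ₀ φ₁).rootMultiplicity c + 2 := by
    rw [hfac, rootMultiplicity_mul_X_sub_C_pow hN']
  have hd0 : F₀.derivative.eval c = φ₀.eval c := by
    rw [hφ₀]; simp
  have hd1 : F₁.derivative.eval c = φ₁.eval c := by
    rw [hφ₁]; simp
  have hfib : zerosFiber g F₀ F₁ c = {b | b ^ 2 + g.eval c = 0} := by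
    ext b
    simp [zerosFiber, commonZeros, h0, h1]
  obtain ⟨β, hβ⟩ := IsAlgClosed.exists_pow_nat_eq (-g.eval c) (n := 2) two_pos
  have hfib' : zerosFiber g F₀ F₁ c = {β, -β} := by
    rw [hfib]
    ext b
    simp only [Set.mem_ofPred_eq, Set.mem_insert_iff, Set.mem_singleton_iff]
    rw [← sq_eq_sq_iff_eq_or_eq_neg, hβ, add_eq_zero_iff_eq_neg]
  have hJ : ∀ b, zerosJacobian g F₀ F₁ (b, c) = 2 * b * (φ₀.eval c + b * φ₁.eval c) := by
    intro b
    simp [zerosJacobian, hd0, hd1, h1]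
  have hroot : (normPoly g φ₀ φ₁).eval c
      = (φ₀.eval c + β * φ₁.eval c) * (φ₀.eval c + -β * φ₁.eval c) := by
    simp only [normPoly, eval_add, eval_mul, eval_pow]
    linear_combination (φ₁.eval c ^ 2) * hβ
  rw [hmult, hfib']
  -- For `β = 0` the two roots merge: the fibre has one point, the multiplicity is at least two and
  -- the Jacobian vanishes, so both sides of the equivalence fail.
  by_cases hβ0 : β = 0
  · subst hβ0
    simp [hJ]
  · have hcard : ({β, -β} : Set ℂ).ncard = 2 := by
      rw [Set.ncard_pair]
      intro h
      exact hβ0 (self_eq_neg.1 h)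
    rw [hcard]
    refine ⟨by omega, ?_⟩
    have h3 : (2 = (normPoly g φ₀ φ₁).rootMultiplicity c + 2) ↔
        ¬ (normPoly g φ₀ φ₁).IsRoot c := by
      rw [← rootMultiplicity_pos hN']; omega
    rw [h3, IsRoot.def, hroot]
    simp [hJ, hβ0]

theorem finite_zerosFiber (c : ℂ) : (zerosFiber g F₀ F₁ c).Finite := by
  have hne : (X ^ 2 + C (g.eval c) : ℂ[X]) ≠ 0 := (monic_X_pow_add_C _ two_ne_zero).ne_zero
  refine ((X ^ 2 + C (g.eval c) : ℂ[X]).roots.toFinset.finite_toSet).subset fun b hb => ?_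
  simp only [Finset.mem_coe, Multiset.mem_toFinset, mem_roots hne, IsRoot.def]
  simpa using hb.1

/-- The number of common zeros is at most the degree of the resultant, with equality exactly if
all of them are nondegenerate. -/
theorem commonZeros_count (hN : normPoly g F₀ F₁ ≠ 0) :
    (commonZeros g F₀ F₁).Finite ∧
    (commonZeros g F₀ F₁).ncard ≤ (normPoly g F₀ F₁).natDegree ∧
    ((commonZeros g F₀ F₁).ncard = (normPoly g F₀ F₁).natDegree ↔
      ∀ p ∈ commonZeros g F₀ F₁, zerosJacobian g F₀ F₁ p ≠ 0) := by
  classical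
  set N := normPoly g F₀ F₁ with hNdef
  let D : Finset (Σ _ : ℂ, ℂ) := N.roots.toFinset.sigma fun c => (finite_zerosFiber (g := g)
    (F₀ := F₀) (F₁ := F₁) c).toFinset
  let e : (Σ _ : ℂ, ℂ) ↪ ℂ × ℂ := ⟨fun x => (x.2, x.1), by
    rintro ⟨a, b⟩ ⟨c, d⟩ h
    simp only [Prod.mk.injEq] at h
    rw [h.1, h.2]⟩
  have hC : commonZeros g F₀ F₁ = (D.map e : Finset (ℂ × ℂ)) := by
    ext ⟨b, c⟩
    simp only [Finset.coe_map, Set.mem_image, Finset.mem_coe, D, Finset.mem_sigma,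
      Multiset.mem_toFinset, mem_roots hN, Set.Finite.mem_toFinset]
    constructor
    · intro h
      exact ⟨⟨c, b⟩, ⟨isRoot_normPoly h, h⟩, rfl⟩
    · rintro ⟨⟨c', b'⟩, ⟨-, h⟩, he⟩
      obtain ⟨rfl, rfl⟩ : b' = b ∧ c' = c := by
        simpa using Prod.ext_iff.1 (show (b', c') = (b, c) from he)
      exact h
  have hcard : (commonZeros g F₀ F₁).ncard
      = ∑ c ∈ N.roots.toFinset, (zerosFiber g F₀ F₁ c).ncard := by
    rw [hC, Set.ncard_coe_finset, Finset.card_map, Finset.card_sigma]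
    exact Finset.sum_congr rfl fun c _ => (Set.ncard_eq_toFinset_card _ _).symm
  have hdeg : N.natDegree = ∑ c ∈ N.roots.toFinset, N.rootMultiplicity c := by
    rw [(IsAlgClosed.splits N).natDegree_eq_card_roots, ← Multiset.toFinset_sum_count_eq]
    simp
  have hfib : ∀ c ∈ N.roots.toFinset, (zerosFiber g F₀ F₁ c).ncard ≤ N.rootMultiplicity c ∧
      ((zerosFiber g F₀ F₁ c).ncard = N.rootMultiplicity c ↔
        ∀ b ∈ zerosFiber g F₀ F₁ c, zerosJacobian g F₀ F₁ (b, c) ≠ 0) := by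
    intro c hc
    rw [Multiset.mem_toFinset, mem_roots hN] at hc
    by_cases h1 : F₁.eval c = 0
    · exact fiber_count_of_eq hN hc h1
    · exact fiber_count_of_ne hN hc h1
  refine ⟨by rw [hC]; exact Finset.finite_toSet _, ?_, ?_⟩
  · rw [hcard, hdeg]
    exact Finset.sum_le_sum fun c hc => (hfib c hc).1
  · rw [hcard, hdeg, Finset.sum_eq_sum_iff_of_le fun c hc => (hfib c hc).1]
    constructor
    · rintro h ⟨b, c⟩ hp
      have hc : c ∈ N.roots.toFinset := by
        rw [Multiset.mem_toFinset, mem_roots hN]; exact isRoot_normPoly hp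
      exact (hfib c hc).2.1 (h c hc) b hp
    · intro h c hc
      exact (hfib c hc).2.2 fun b hb => h _ hb

end

/-! ### Comparison of the full bifurcation diagrams -/

theorem isCrit_comp_iff {p : ℕ} {f : (Fin p → ℂ) → ℂ} (L : (Fin p → ℂ) ≃L[ℂ] (Fin p → ℂ))
    {v : Fin p → ℂ} : IsCrit (fun u => f (L u)) v ↔ IsCrit f (L v) := by
  have h : fderiv ℂ (fun u => f (L u)) v = (fderiv ℂ f (L v)).comp (L : (Fin p → ℂ) →L[ℂ] _) :=
    L.comp_right_fderiv
  rw [IsCrit, IsCrit, h]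
  constructor
  · intro h0
    ext1 u
    simpa using DFunLike.congr_fun h0 (L.symm u)
  · intro h0
    rw [h0, ContinuousLinearMap.zero_comp]

theorem nonzeroCritValues_comp {p : ℕ} {f : (Fin p → ℂ) → ℂ}
    (L : (Fin p → ℂ) ≃L[ℂ] (Fin p → ℂ)) :
    nonzeroCritValues (fun u => f (L u)) = nonzeroCritValues f := by
  ext v
  refine and_congr_right fun _ => ⟨?_, ?_⟩
  · rintro ⟨q, hq, rfl⟩
    exact ⟨L q, (isCrit_comp_iff L).1 hq, rfl⟩
  · rintro ⟨q, hq, rfl⟩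
    refine ⟨L.symm q, (isCrit_comp_iff L).2 ?_, ?_⟩ <;> simp [hq]

theorem IsCrit.neg_of_odd {p : ℕ} {f : (Fin p → ℂ) → ℂ} (hf : ∀ v, f (-v) = -f v)
    {v : Fin p → ℂ} (hv : IsCrit f v) : IsCrit f (-v) := by
  have h1 : f = fun v => -f (ContinuousLinearEquiv.neg ℂ v) := funext fun v => by simp [hf]
  have h2 : IsCrit (fun v => f (ContinuousLinearEquiv.neg ℂ v)) (-v) := by
    rw [isCrit_comp_iff]; simpa using hv
  rw [IsCrit, h1, fderiv_fun_neg, neg_eq_zero]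
  exact h2

/-- Each fibre of `u ↦ κ u²` on `V` is a pair `{u, -u}` of distinct points. -/
theorem ncard_eq_two_mul_ncard_image_sq {V : Set ℂ} (hV : V.Finite) (h0 : ∀ u ∈ V, u ≠ 0)
    (hneg : ∀ u ∈ V, -u ∈ V) {κ : ℂ} (hκ : κ ≠ 0) :
    V.ncard = 2 * ((fun u => κ * u ^ 2) '' V).ncard := by
  classical
  lift V to Finset ℂ using hV
  simp only [Finset.mem_coe] at h0 hneg
  have himg : ((fun u => κ * u ^ 2) '' (V : Set ℂ)).ncard
      = (V.image fun u => κ * u ^ 2).card := by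
    rw [← Finset.coe_image, Set.ncard_coe_finset]
  rw [himg, Set.ncard_coe_finset, Finset.card_eq_sum_card_image (fun u => κ * u ^ 2) V, mul_comm]
  refine Finset.sum_const_nat fun b hb => ?_
  obtain ⟨u, hu, rfl⟩ := Finset.mem_image.1 hb
  have : (V.filter fun a => κ * a ^ 2 = κ * u ^ 2) = {u, -u} := by
    ext a
    simp only [Finset.mem_filter, Finset.mem_insert, Finset.mem_singleton, mul_right_inj' hκ,
      sq_eq_sq_iff_eq_or_eq_neg]
    constructor
    · exact fun h => h.2
    · rintro (rfl | rfl)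
      · exact ⟨hu, Or.inl rfl⟩
      · exact ⟨hneg _ hu, Or.inr rfl⟩
  rw [this, Finset.card_pair]
  exact fun h => h0 u hu (self_eq_neg.1 h)

theorem oddFullDiagram_compl {τ : ℕ} {G : (Fin τ → ℂ) → (Fin 2 → ℂ) → ℂ} {m : Fin τ → ℂ} :
    m ∉ oddFullDiagram G ↔ IsMorse (G m) ∧ ∀ x, IsCrit (G m) x → G m x ≠ 0 := by
  simp [oddFullDiagram]

/-- With `C` the critical points and `C'` those of non-zero value, `2 |W| = |f(C')| ≤ |C'| ≤ |C| ≤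
2τ`. The bound `τ ≤ |W|` forces equality throughout, and the three equalities say in turn that the
values are distinct, that none is zero, and that all points are nondegenerate. -/
theorem morse_iff_le_ncard {τ : ℕ} {f : (Fin 2 → ℂ) → ℂ} (hodd : ∀ v, f (-v) = -f v)
    (hfin : {p | IsCrit f p}.Finite) (hle : {p | IsCrit f p}.ncard ≤ 2 * τ)
    (hiff : {p | IsCrit f p}.ncard = 2 * τ ↔ ∀ p, IsCrit f p → IsNondegenerate f p)
    {W : Set ℂ} {κ : ℂ} (hκ : κ ≠ 0)
    (hW : ∀ v, v ∈ W ↔ ∃ u ∈ nonzeroCritValues f, v = κ * u ^ 2) :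
    W.Finite ∧ (τ ≤ W.ncard ↔ IsMorse f ∧ ∀ x, IsCrit f x → f x ≠ 0) := by
  set C := {p | IsCrit f p} with hC
  set C' := {p | IsCrit f p ∧ f p ≠ 0} with hC'
  have hsub : C' ⊆ C := fun p hp => hp.1
  have hV : nonzeroCritValues f = f '' C' := by
    ext v
    constructor
    · rintro ⟨h0, p, hp, rfl⟩
      exact ⟨p, ⟨hp, h0⟩, rfl⟩
    · rintro ⟨p, ⟨hp, h0⟩, rfl⟩
      exact ⟨h0, p, hp, rfl⟩
  have hWV : W = (fun u => κ * u ^ 2) '' nonzeroCritValues f := by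
    ext v
    rw [hW]
    exact ⟨fun ⟨u, hu, h⟩ => ⟨u, hu, h.symm⟩, fun ⟨u, hu, h⟩ => ⟨u, hu, h.symm⟩⟩
  have hVfin : (nonzeroCritValues f).Finite := by
    rw [hV]; exact (hfin.subset hsub).image f
  have h2 : (nonzeroCritValues f).ncard = 2 * W.ncard := by
    rw [hWV]
    refine ncard_eq_two_mul_ncard_image_sq hVfin (fun u hu => hu.1) ?_ hκ
    rintro u ⟨hu, p, hp, rfl⟩
    exact ⟨neg_ne_zero.2 hu, -p, hp.neg_of_odd hodd, hodd p⟩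
  have hle1 : (f '' C').ncard ≤ C'.ncard := Set.ncard_image_le (hfin.subset hsub)
  have hle2 : C'.ncard ≤ C.ncard := Set.ncard_le_ncard hsub hfin
  refine ⟨by rw [hWV]; exact hVfin.image _, ?_⟩
  rw [hV] at h2
  constructor
  · intro h
    have e1 : C.ncard = 2 * τ := by omega
    have e2 : C' = C := Set.eq_of_subset_of_ncard_le hsub (by omega) hfin
    have hinj : Set.InjOn f C' := Set.injOn_of_ncard_image_eq (by omega) (hfin.subset hsub)
    refine ⟨⟨hiff.1 e1, fun p q hp hq hpq => hinj ?_ ?_ hpq⟩, fun p hp => ?_⟩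
    · rw [e2]; exact hp
    · rw [e2]; exact hq
    · have : p ∈ C' := by rw [e2]; exact hp
      exact this.2
  · rintro ⟨⟨hnd, hinj⟩, h0⟩
    have e2 : C' = C := Set.Subset.antisymm hsub fun p hp => ⟨hp, h0 p hp⟩
    have e3 : (f '' C').ncard = C'.ncard := Set.InjOn.ncard_image fun p hp q hq h =>
      hinj p q hp.1 hq.1 h
    have e4 := hiff.2 hnd
    rw [e2] at e3
    rw [e2] at h2
    omega

/-- The assumption `hmil` bounds the singular Milnor number by `τ`, and the member of the odd family
provided by `hex` shows that `τ` is attained. Both diagrams then consist of the parameters with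
fewer than `τ` distinct non-zero critical values of the determinant. -/
theorem image_matrixFullDiagram {τ : ℕ}
    {F : (Fin τ → ℂ) → (Fin 4 → ℂ) → Matrix (Fin 3) (Fin 3) ℂ}
    {G : (Fin τ → ℂ) → (Fin 2 → ℂ) → ℂ} (Φ : (Fin τ → ℂ) ≃ (Fin τ → ℂ)) {κ : ℂ} (hκ : κ ≠ 0)
    (hodd : ∀ m v, G m (-v) = -G m v)
    (hcount : ∀ m, {p | IsCrit (G m) p}.Finite ∧ {p | IsCrit (G m) p}.ncard ≤ 2 * τ ∧
      ({p | IsCrit (G m) p}.ncard = 2 * τ ↔ ∀ p, IsCrit (G m) p → IsNondegenerate (G m) p))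
    (hval : ∀ l v, v ∈ nonzeroCritValues (detFun (F l)) ↔
      ∃ u ∈ nonzeroCritValues (G (Φ l)), v = κ * u ^ 2)
    (hmil : ∀ l, offZeroMilnor (detFun (F l)) ≤ τ)
    (hex : ∃ m, IsMorse (G m) ∧ ∀ x, IsCrit (G m) x → G m x ≠ 0) :
    Φ '' matrixFullDiagram F = oddFullDiagram G := by
  have key : ∀ l, (nonzeroCritValues (detFun (F l))).Finite ∧
      (τ ≤ (nonzeroCritValues (detFun (F l))).ncard ↔ Φ l ∉ oddFullDiagram G) := by
    intro l
    rw [oddFullDiagram_compl]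
    exact morse_iff_le_ncard (hodd _) (hcount _).1 (hcount _).2.1 (hcount _).2.2 hκ (hval l)
  have key' : ∀ l, (τ : ℕ∞) ≤ (nonzeroCritValues (detFun (F l))).encard ↔
      Φ l ∉ oddFullDiagram G := by
    intro l
    rw [← (key l).2, ← (key l).1.cast_ncard_eq, Nat.cast_le]
  have hμ : singularMilnorNumber F = τ := by
    refine le_antisymm (iSup_le hmil) ?_
    obtain ⟨m, hm⟩ := hex
    refine le_trans ((key' (Φ.symm m)).2 ?_) ((encard_nonzeroCritValues_le _).trans
      (le_iSup (fun l => offZeroMilnor (detFun (F l))) (Φ.symm m)))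
    rw [Equiv.apply_symm_apply, oddFullDiagram_compl]
    exact hm
  have hmem : ∀ l, l ∈ matrixFullDiagram F ↔ Φ l ∈ oddFullDiagram G := by
    intro l
    rw [← not_iff_not, ← key' l, ← not_lt, ← hμ]
    rfl
  ext m
  constructor
  · rintro ⟨l, hl, rfl⟩
    exact (hmem l).1 hl
  · intro hm
    exact ⟨Φ.symm m, (hmem _).2 (by rwa [Equiv.apply_symm_apply]), Equiv.apply_symm_apply _ _⟩

/-! ### Critical points of the odd functions -/

theorem isCrit_iff {s : ℕ} {f : (Fin s → ℂ) → ℂ} {p : Fin s → ℂ} :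
    IsCrit f p ↔ ∀ i, fderiv ℂ f p (Pi.single i 1) = 0 := by
  constructor
  · intro h i
    rw [h]; rfl
  · intro h
    refine ContinuousLinearMap.ext fun v => ?_
    rw [pi_eq_sum_univ' v, map_sum]
    simp [h]

theorem isNondegenerate_iff {f D₀ D₁ : (Fin 2 → ℂ) → ℂ}
    (h0 : ∀ y, fderiv ℂ f y (Pi.single 0 1) = D₀ y) (h1 : ∀ y, fderiv ℂ f y (Pi.single 1 1) = D₁ y)
    (p : Fin 2 → ℂ) :
    IsNondegenerate f p ↔ fderiv ℂ D₀ p (Pi.single 0 1) * fderiv ℂ D₁ p (Pi.single 1 1)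
      - fderiv ℂ D₀ p (Pi.single 1 1) * fderiv ℂ D₁ p (Pi.single 0 1) ≠ 0 := by
  rw [IsNondegenerate, Matrix.det_fin_two]
  simp [h0, h1]

open Polynomial

theorem hasFDerivAt_coord {s : ℕ} (i : Fin s) (v : Fin s → ℂ) :
    HasFDerivAt (fun v : Fin s → ℂ => v i) (ContinuousLinearMap.proj i : (Fin s → ℂ) →L[ℂ] ℂ) v :=
  hasFDerivAt_apply i v

theorem hasFDerivAt_eval_coord {s : ℕ} (P : ℂ[X]) (i : Fin s) (v : Fin s → ℂ) :
    HasFDerivAt (fun v : Fin s → ℂ => P.eval (v i))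
      (P.derivative.eval (v i) • (ContinuousLinearMap.proj i : (Fin s → ℂ) →L[ℂ] ℂ)) v :=
  HasDerivAt.comp_hasFDerivAt (h₂ := fun t => P.eval t) v (P.hasDerivAt (v i)) (hasFDerivAt_coord i v)

/-- Functions on the plane that are monic cubic in the first coordinate, without quadratic term. -/
def cubicFun (Q R : ℂ[X]) (v : Fin 2 → ℂ) : ℂ := v 0 ^ 3 + v 0 * Q.eval (v 1) + R.eval (v 1)

section
variable (Q R : ℂ[X]) (v : Fin 2 → ℂ)

theorem hasFDerivAt_cubicFun :
    HasFDerivAt (cubicFun Q R) ((3 * v 0 ^ 2 + Q.eval (v 1)) •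
        (ContinuousLinearMap.proj 0 : (Fin 2 → ℂ) →L[ℂ] ℂ)
      + (R.derivative.eval (v 1) + v 0 * Q.derivative.eval (v 1)) •
        (ContinuousLinearMap.proj 1 : (Fin 2 → ℂ) →L[ℂ] ℂ)) v := by
  refine ((((hasFDerivAt_coord 0 v).pow 3).fun_add ((hasFDerivAt_coord 0 v).fun_mul
    (hasFDerivAt_eval_coord Q 1 v))).fun_add (hasFDerivAt_eval_coord R 1 v)).congr_fderiv ?_
  ext u
  simp
  ring

theorem fderiv_cubicFun_zero :
    fderiv ℂ (cubicFun Q R) v (Pi.single 0 1) = 3 * v 0 ^ 2 + Q.eval (v 1) := by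
  rw [(hasFDerivAt_cubicFun Q R v).fderiv]
  simp

theorem fderiv_cubicFun_one :
    fderiv ℂ (cubicFun Q R) v (Pi.single 1 1)
      = R.derivative.eval (v 1) + v 0 * Q.derivative.eval (v 1) := by
  rw [(hasFDerivAt_cubicFun Q R v).fderiv]
  simp

theorem isCrit_cubicFun : IsCrit (cubicFun Q R) v ↔
    3 * v 0 ^ 2 + Q.eval (v 1) = 0 ∧ R.derivative.eval (v 1) + v 0 * Q.derivative.eval (v 1) = 0 := by
  rw [isCrit_iff, Fin.forall_fin_two, fderiv_cubicFun_zero, fderiv_cubicFun_one]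

theorem isCrit_cubicFun_iff_mem : IsCrit (cubicFun Q R) v ↔
    (v 0, v 1) ∈ commonZeros (C (1 / 3) * Q) R.derivative Q.derivative := by
  rw [isCrit_cubicFun]
  refine and_congr_left fun _ => ?_
  rw [eval_mul, eval_C]
  constructor <;> intro h
  · linear_combination h / 3
  · linear_combination 3 * h

theorem isNondegenerate_cubicFun : IsNondegenerate (cubicFun Q R) v ↔
    zerosJacobian (C (1 / 3) * Q) R.derivative Q.derivative (v 0, v 1) ≠ 0 := by
  rw [isNondegenerate_iff (fderiv_cubicFun_zero Q R) (fderiv_cubicFun_one Q R),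
    ((((hasFDerivAt_coord 0 v).pow 2).const_mul 3).fun_add
      (hasFDerivAt_eval_coord Q 1 v)).fderiv,
    ((hasFDerivAt_eval_coord R.derivative 1 v).fun_add ((hasFDerivAt_coord 0 v).fun_mul
      (hasFDerivAt_eval_coord Q.derivative 1 v))).fderiv, not_iff_not]
  simp [zerosJacobian]
  constructor <;> intro h
  · linear_combination h / 3
  · linear_combination 3 * h

end

theorem cubicFun_count {Q R : ℂ[X]} {τ : ℕ} (hτ : τ ≠ 0)
    (hdeg : (normPoly (C (1 / 3) * Q) R.derivative Q.derivative).natDegree = 2 * τ) :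
    {p | IsCrit (cubicFun Q R) p}.Finite ∧ {p | IsCrit (cubicFun Q R) p}.ncard ≤ 2 * τ ∧
      ({p | IsCrit (cubicFun Q R) p}.ncard = 2 * τ ↔
        ∀ p, IsCrit (cubicFun Q R) p → IsNondegenerate (cubicFun Q R) p) := by
  have hN : normPoly (C (1 / 3) * Q) R.derivative Q.derivative ≠ 0 := by
    intro h
    rw [h, natDegree_zero] at hdeg
    omega
  obtain ⟨h1, h2, h3⟩ := commonZeros_count hN
  have hset : {p | IsCrit (cubicFun Q R) p} = (finTwoArrowEquiv ℂ) ⁻¹'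
      commonZeros (C (1 / 3) * Q) R.derivative Q.derivative := by
    ext p
    exact isCrit_cubicFun_iff_mem Q R p
  have hcard : {p | IsCrit (cubicFun Q R) p}.ncard
      = (commonZeros (C (1 / 3) * Q) R.derivative Q.derivative).ncard := by
    rw [hset, Set.ncard_preimage_of_injective_subset_range (finTwoArrowEquiv ℂ).injective
      (by rw [(finTwoArrowEquiv ℂ).surjective.range_eq]; exact Set.subset_univ _)]
  rw [hcard, ← hdeg]
  refine ⟨by rw [hset]; exact h1.preimage (finTwoArrowEquiv ℂ).injective.injOn, h2, h3.trans ?_⟩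
  constructor
  · intro h p hp
    rw [isNondegenerate_cubicFun]
    exact h _ ((isCrit_cubicFun_iff_mem Q R p).1 hp)
  · rintro h ⟨b, c⟩ hp
    have := h ![b, c] ((isCrit_cubicFun_iff_mem Q R _).2 hp)
    rwa [isNondegenerate_cubicFun] at this

/-- Functions on the plane of the form `v₀ v₁² + A(v₀) + κ v₁`. -/
def quadraticFun (A : ℂ[X]) (κ : ℂ) (v : Fin 2 → ℂ) : ℂ := v 0 * v 1 ^ 2 + A.eval (v 0) + κ * v 1

section
variable (A : ℂ[X]) (κ : ℂ) (v : Fin 2 → ℂ)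

theorem hasFDerivAt_quadraticFun :
    HasFDerivAt (quadraticFun A κ) ((v 1 ^ 2 + A.derivative.eval (v 0)) •
        (ContinuousLinearMap.proj 0 : (Fin 2 → ℂ) →L[ℂ] ℂ)
      + (2 * v 0 * v 1 + κ) • (ContinuousLinearMap.proj 1 : (Fin 2 → ℂ) →L[ℂ] ℂ)) v := by
  refine ((((hasFDerivAt_coord 0 v).fun_mul ((hasFDerivAt_coord 1 v).pow 2)).fun_add
    (hasFDerivAt_eval_coord A 0 v)).fun_add ((hasFDerivAt_coord 1 v).const_mul κ)).congr_fderiv ?_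
  ext u
  simp
  ring

theorem fderiv_quadraticFun_zero :
    fderiv ℂ (quadraticFun A κ) v (Pi.single 0 1) = v 1 ^ 2 + A.derivative.eval (v 0) := by
  rw [(hasFDerivAt_quadraticFun A κ v).fderiv]
  simp

theorem fderiv_quadraticFun_one :
    fderiv ℂ (quadraticFun A κ) v (Pi.single 1 1) = 2 * v 0 * v 1 + κ := by
  rw [(hasFDerivAt_quadraticFun A κ v).fderiv]
  simp

theorem isCrit_quadraticFun : IsCrit (quadraticFun A κ) v ↔
    v 1 ^ 2 + A.derivative.eval (v 0) = 0 ∧ 2 * v 0 * v 1 + κ = 0 := by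
  rw [isCrit_iff, Fin.forall_fin_two, fderiv_quadraticFun_zero, fderiv_quadraticFun_one]

/-- The coordinates are swapped because here `v 1` satisfies the quadratic equation and is the
variable to be eliminated. -/
theorem isCrit_quadraticFun_iff_mem : IsCrit (quadraticFun A κ) v ↔
    (v 1, v 0) ∈ commonZeros A.derivative (C κ) (C 2 * X) := by
  rw [isCrit_quadraticFun]
  refine and_congr_right fun _ => ?_
  simp only [eval_C, eval_mul, eval_X]
  rw [show κ + v 1 * (2 * v 0) = 2 * v 0 * v 1 + κ by ring]

theorem isNondegenerate_quadraticFun : IsNondegenerate (quadraticFun A κ) v ↔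
    zerosJacobian A.derivative (C κ) (C 2 * X) (v 1, v 0) ≠ 0 := by
  rw [isNondegenerate_iff (fderiv_quadraticFun_zero A κ) (fderiv_quadraticFun_one A κ),
    (((hasFDerivAt_coord 1 v).pow 2).fun_add
      (hasFDerivAt_eval_coord A.derivative 0 v)).fderiv,
    ((((hasFDerivAt_coord 0 v).const_mul 2).fun_mul (hasFDerivAt_coord 1 v)).add_const κ).fderiv,
    not_iff_not]
  simp [zerosJacobian]
  constructor <;> intro h
  · linear_combination -h
  · linear_combination -h

end

theorem quadraticFun_count {A : ℂ[X]} {κ : ℂ} {τ : ℕ} (hτ : τ ≠ 0)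
    (hdeg : (normPoly A.derivative (C κ) (C 2 * X)).natDegree = 2 * τ) :
    {p | IsCrit (quadraticFun A κ) p}.Finite ∧ {p | IsCrit (quadraticFun A κ) p}.ncard ≤ 2 * τ ∧
      ({p | IsCrit (quadraticFun A κ) p}.ncard = 2 * τ ↔
        ∀ p, IsCrit (quadraticFun A κ) p → IsNondegenerate (quadraticFun A κ) p) := by
  have hN : normPoly A.derivative (C κ) (C 2 * X) ≠ 0 := by
    intro h
    rw [h, natDegree_zero] at hdeg
    omega
  obtain ⟨h1, h2, h3⟩ := commonZeros_count hN
  let e : (Fin 2 → ℂ) ≃ ℂ × ℂ := (finTwoArrowEquiv ℂ).trans (Equiv.prodComm ℂ ℂ)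
  have hset : {p | IsCrit (quadraticFun A κ) p} = e ⁻¹'
      commonZeros A.derivative (C κ) (C 2 * X) := by
    ext p
    exact isCrit_quadraticFun_iff_mem A κ p
  have hcard : {p | IsCrit (quadraticFun A κ) p}.ncard
      = (commonZeros A.derivative (C κ) (C 2 * X)).ncard := by
    rw [hset, Set.ncard_preimage_of_injective_subset_range e.injective
      (by rw [e.surjective.range_eq]; exact Set.subset_univ _)]
  rw [hcard, ← hdeg]
  refine ⟨by rw [hset]; exact h1.preimage e.injective.injOn, h2, h3.trans ?_⟩
  constructor
  · intro h p hp
    rw [isNondegenerate_quadraticFun]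
    exact h _ ((isCrit_quadraticFun_iff_mem A κ p).1 hp)
  · rintro h ⟨c, a⟩ hp
    have := h ![a, c] ((isCrit_quadraticFun_iff_mem A κ _).2 hp)
    rwa [isNondegenerate_quadraticFun] at this

/-! ### The degrees of the resultants -/

theorem oddDefII4_eq (l : Fin 4 → ℂ) :
    oddDefII4 l = cubicFun (C (l 3) * X ^ 2 + C (l 2)) (X ^ 5 + C (l 1) * X ^ 3 + C (l 0) * X) := by
  funext v
  simp [oddDefII4, cubicFun]
  ring

theorem oddDefII5_eq (l : Fin 5 → ℂ) :
    oddDefII5 l = cubicFun (-X ^ 4 + C (l 4) * X ^ 2 + C (l 3))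
      (C (l 2) * X ^ 5 + C (l 1) * X ^ 3 + C (l 0) * X) := by
  funext v
  simp [oddDefII5, cubicFun]
  ring

theorem oddDefII6_eq (l : Fin 6 → ℂ) :
    oddDefII6 l = cubicFun (C (l 5) * X ^ 4 + C (l 4) * X ^ 2 + C (l 3))
      (X ^ 7 + C (l 2) * X ^ 5 + C (l 1) * X ^ 3 + C (l 0) * X) := by
  funext v
  simp [oddDefII6, cubicFun]
  ring

/-- The one-variable part of the deformation of the odd function of type `I`. -/
def oddPolyI (k : ℕ) (l : Fin (k + 1) → ℂ) : ℂ[X] :=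
  X ^ (2 * k + 1) + ∑ i : Fin k, C (l i.castSucc) * X ^ (2 * (i : ℕ) + 1)

theorem oddDefI_eq (k : ℕ) (l : Fin (k + 1) → ℂ) :
    oddDefI k l = quadraticFun (oddPolyI k l) (l (Fin.last k)) := by
  funext v
  simp [oddDefI, quadraticFun, oddPolyI, eval_finsetSum]
  ring

/-- The leading term `25 X⁸` comes from `F₀²` and contains no parameter, so no critical point
escapes to infinity. The same happens for `II₆` with `49 X¹²`. -/
theorem natDegree_normPoly_II4 (l : Fin 4 → ℂ) :
    (normPoly (C (1 / 3) * (C (l 3) * X ^ 2 + C (l 2)))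
      (X ^ 5 + C (l 1) * X ^ 3 + C (l 0) * X : ℂ[X]).derivative
      (C (l 3) * X ^ 2 + C (l 2) : ℂ[X]).derivative).natDegree = 2 * 4 := by
  simp only [normPoly, derivative_add, derivative_mul, derivative_X_pow, derivative_C, derivative_X]
  norm_num
  compute_degree!

/-- In contrast to `II₄` and `II₆`, the top term `-(16/3) X¹⁰` comes from `g F₁²`; the square of
`F₀` has degree at most 8. -/
theorem natDegree_normPoly_II5 (l : Fin 5 → ℂ) :
    (normPoly (C (1 / 3) * (-X ^ 4 + C (l 4) * X ^ 2 + C (l 3)))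
      (C (l 2) * X ^ 5 + C (l 1) * X ^ 3 + C (l 0) * X : ℂ[X]).derivative
      (-X ^ 4 + C (l 4) * X ^ 2 + C (l 3) : ℂ[X]).derivative).natDegree = 2 * 5 := by
  simp only [normPoly, derivative_add, derivative_mul, derivative_X_pow, derivative_C, derivative_X,
    derivative_neg]
  norm_num
  compute_degree!

theorem natDegree_normPoly_II6 (l : Fin 6 → ℂ) :
    (normPoly (C (1 / 3) * (C (l 5) * X ^ 4 + C (l 4) * X ^ 2 + C (l 3)))
      (X ^ 7 + C (l 2) * X ^ 5 + C (l 1) * X ^ 3 + C (l 0) * X : ℂ[X]).derivative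
      (C (l 5) * X ^ 4 + C (l 4) * X ^ 2 + C (l 3) : ℂ[X]).derivative).natDegree = 2 * 6 := by
  simp only [normPoly, derivative_add, derivative_mul, derivative_X_pow, derivative_C, derivative_X]
  norm_num
  compute_degree!

theorem natDegree_oddPolyI {k : ℕ} (l : Fin (k + 1) → ℂ) :
    (oddPolyI k l).natDegree = 2 * k + 1 := by
  rw [oddPolyI, natDegree_add_eq_left_of_natDegree_lt, natDegree_X_pow]
  rw [natDegree_X_pow]
  refine lt_of_le_of_lt (natDegree_sum_le_of_forall_le (n := 2 * k) _ _ fun i _ => ?_) (by omega)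
  refine (natDegree_C_mul_X_pow_le _ _).trans ?_
  have := i.2
  omega

/-- The top term is `4(2k+1) X^(2k+2)`, coming from `g F₁²`; `F₀` is constant. -/
theorem natDegree_normPoly_I {k : ℕ} (hk : 1 ≤ k) (l : Fin (k + 1) → ℂ) :
    (normPoly (oddPolyI k l).derivative (C (l (Fin.last k))) (C 2 * X)).natDegree
      = 2 * (k + 1) := by
  have h1 : (oddPolyI k l).derivative.natDegree = 2 * k := by
    rw [natDegree_derivative, natDegree_oddPolyI]; rfl
  have h0 : (oddPolyI k l).derivative ≠ 0 := by
    intro h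
    rw [h, natDegree_zero] at h1
    omega
  have h2 : ((oddPolyI k l).derivative * (C 2 * X) ^ 2).natDegree = 2 * (k + 1) := by
    rw [natDegree_mul h0 (by simp), h1, natDegree_pow, natDegree_C_mul_X _ two_ne_zero]
    omega
  rw [normPoly, ← C_pow, natDegree_add_eq_right_of_natDegree_lt, h2]
  rw [h2, natDegree_C]
  omega

/-! ### Morse members of the families of odd functions -/

/-- The variables separate: the critical points are `b = ±3`, `cⁿ = 1`, and the critical values are
`∓54 - n c`. The constant 27 is large enough to keep the clusters around `54` and `-54`, of radius
`n ≤ 6`, away from each other and from zero. -/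
theorem morse_cubicFun_of_pow {n : ℕ} (hn : n ≠ 0) (hn6 : n ≤ 6) :
    IsMorse (cubicFun (C (-27)) (X ^ (n + 1) - C (n + 1 : ℂ) * X)) ∧
    ∀ x, IsCrit (cubicFun (C (-27)) (X ^ (n + 1) - C (n + 1 : ℂ) * X)) x →
      cubicFun (C (-27)) (X ^ (n + 1) - C (n + 1 : ℂ) * X) x ≠ 0 := by
  set f := cubicFun (C (-27)) (X ^ (n + 1) - C (n + 1 : ℂ) * X) with hf
  have hn1 : (n + 1 : ℂ) ≠ 0 := by exact_mod_cast Nat.succ_ne_zero n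
  have hcrit : ∀ p, IsCrit f p → (p 0 = 3 ∨ p 0 = -3) ∧ p 1 ^ n = 1 := by
    intro p hp
    rw [hf, isCrit_cubicFun] at hp
    simp only [eval_C, derivative_sub, derivative_X_pow, derivative_C_mul, derivative_X, eval_sub,
      eval_mul, eval_pow, eval_X, derivative_C, eval_zero, mul_zero, add_zero, mul_one] at hp
    push_cast at hp
    refine ⟨sq_eq_sq_iff_eq_or_eq_neg.1 (by linear_combination hp.1 / 3), ?_⟩
    refine mul_left_cancel₀ hn1 ?_
    linear_combination hp.2
  have hval : ∀ p, IsCrit f p → f p = -18 * p 0 - n * p 1 := by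
    intro p hp
    obtain ⟨h1, h2⟩ := hcrit p hp
    have h3 : p 0 ^ 2 = 9 := by rcases h1 with h | h <;> rw [h] <;> norm_num
    simp only [hf, cubicFun, eval_C, eval_sub, eval_mul, eval_pow, eval_X]
    rw [pow_succ (p 1), h2]
    linear_combination p 0 * h3
  have hnorm : ∀ p, IsCrit f p → ‖p 1‖ = 1 := fun p hp =>
    Complex.norm_eq_one_of_pow_eq_one (hcrit p hp).2 hn
  have hnR : (n : ℝ) ≤ 6 := by exact_mod_cast hn6
  refine ⟨⟨fun p hp => ?_, fun p q hp hq hpq => ?_⟩, fun p hp h0 => ?_⟩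
  · obtain ⟨h1, h2⟩ := hcrit p hp
    rw [hf, isNondegenerate_cubicFun]
    have hp0 : p 0 ≠ 0 := by rcases h1 with h | h <;> rw [h] <;> norm_num
    have hp1 : p 1 ≠ 0 := by
      intro h
      rw [h, zero_pow hn] at h2
      exact zero_ne_one h2
    have hn0 : (n : ℂ) ≠ 0 := by exact_mod_cast hn
    simp [zerosJacobian, derivative_X_pow, hp0, hp1, hn1, hn0]
  · rw [hval p hp, hval q hq] at hpq
    have h01 : p 0 = q 0 := by
      by_contra hne
      have h4 : q 0 = -p 0 := by
        rcases (hcrit p hp).1 with h | h <;> rcases (hcrit q hq).1 with h' | h' <;>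
          simp_all
      have h5 : (36 : ℂ) * p 0 = n * (q 1 - p 1) := by
        rw [h4] at hpq; linear_combination -hpq
      have h6 : ‖p 0‖ = 3 := by rcases (hcrit p hp).1 with h | h <;> rw [h] <;> simp
      have h7 : ‖q 1 - p 1‖ ≤ 2 := (norm_sub_le _ _).trans (by rw [hnorm p hp, hnorm q hq]; norm_num)
      have h8 := congrArg norm h5
      rw [norm_mul, norm_mul, h6, Complex.norm_natCast] at h8
      norm_num at h8
      nlinarith [norm_nonneg (q 1 - p 1)]
    have h11 : p 1 = q 1 := by
      rw [h01] at hpq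
      refine mul_left_cancel₀ (show (n : ℂ) ≠ 0 by exact_mod_cast hn) ?_
      linear_combination -hpq
    funext i
    fin_cases i
    · exact h01
    · exact h11
  · rw [hval p hp] at h0
    have h5 : (18 : ℂ) * p 0 = -(n * p 1) := by linear_combination -h0
    have h6 : ‖p 0‖ = 3 := by rcases (hcrit p hp).1 with h | h <;> rw [h] <;> simp
    have h8 := congrArg norm h5
    rw [norm_neg, norm_mul, norm_mul, h6, Complex.norm_natCast, hnorm p hp] at h8
    norm_num at h8
    linarith

theorem morse_II4 : ∃ m, IsMorse (oddDefII4 m) ∧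
    ∀ x, IsCrit (oddDefII4 m) x → oddDefII4 m x ≠ 0 := by
  refine ⟨![-5, 0, -27, 0], ?_⟩
  have : oddDefII4 ![-5, 0, -27, 0]
      = cubicFun (C (-27)) (X ^ (4 + 1) - C (((4 : ℕ) : ℂ) + 1) * X) := by
    funext v
    simp [oddDefII4, cubicFun]
    ring
  rw [this]
  exact morse_cubicFun_of_pow (by norm_num) (by norm_num)

theorem morse_II6 : ∃ m, IsMorse (oddDefII6 m) ∧
    ∀ x, IsCrit (oddDefII6 m) x → oddDefII6 m x ≠ 0 := by
  refine ⟨![-7, 0, 0, -27, 0, 0], ?_⟩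
  have : oddDefII6 ![-7, 0, 0, -27, 0, 0]
      = cubicFun (C (-27)) (X ^ (6 + 1) - C (((6 : ℕ) : ℂ) + 1) * X) := by
    funext v
    simp [oddDefII6, cubicFun]
    ring
  rw [this]
  exact morse_cubicFun_of_pow (by norm_num) (by norm_num)

theorem morse_II5 : ∃ m, IsMorse (oddDefII5 m) ∧
    ∀ x, IsCrit (oddDefII5 m) x → oddDefII5 m x ≠ 0 := by
  refine ⟨![1, 0, 0, 0, 0], ?_⟩
  have : oddDefII5 ![1, 0, 0, 0, 0] = cubicFun (-X ^ 4) X := by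
    funext v
    simp [oddDefII5, cubicFun]
    ring
  rw [this]
  have hcrit : ∀ p, IsCrit (cubicFun (-X ^ 4) X) p →
      3 * p 0 ^ 2 = p 1 ^ 4 ∧ 4 * p 0 * p 1 ^ 3 = 1 := by
    intro p hp
    rw [isCrit_cubicFun] at hp
    simp at hp
    exact ⟨by linear_combination hp.1, by linear_combination -hp.2⟩
  -- Euler's formula with weights 2 and 1 for `b` and `c`: the undeformed part has degree 6, so at a
  -- critical point it equals `-c/6`, and adding `c` gives `5c/6`. Critical values thus determine
  -- `c`, and `4bc³ = 1` determines `b`.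
  have hval : ∀ p, IsCrit (cubicFun (-X ^ 4) X) p → cubicFun (-X ^ 4) X p = 5 / 6 * p 1 := by
    intro p hp
    obtain ⟨h1, h2⟩ := hcrit p hp
    simp only [cubicFun, eval_neg, eval_pow, eval_X]
    linear_combination p 0 / 3 * h1 - p 1 / 6 * h2
  have h0 : ∀ p, IsCrit (cubicFun (-X ^ 4) X) p → p 1 ≠ 0 := by
    intro p hp h
    have := (hcrit p hp).2
    rw [h] at this
    simp at this
  refine ⟨⟨fun p hp => ?_, fun p q hp hq hpq => ?_⟩, fun p hp => ?_⟩
  · rw [isNondegenerate_cubicFun]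
    have h1 := (hcrit p hp).1
    simp [zerosJacobian]
    intro h
    have : p 1 ^ 6 = 0 := by
      linear_combination -(3 / 40) * h - (3 / 5) * p 1 ^ 2 * h1
    exact h0 p hp (pow_eq_zero_iff (by norm_num) |>.1 this)
  · rw [hval p hp, hval q hq] at hpq
    have h1 : p 1 = q 1 := by linear_combination 6 / 5 * hpq
    have h2 : p 0 = q 0 := by
      have e1 := (hcrit p hp).2
      have e2 := (hcrit q hq).2
      rw [← h1] at e2
      exact mul_right_cancel₀ (pow_ne_zero 3 (h0 p hp)) (by linear_combination (e1 - e2) / 4)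
    funext i
    fin_cases i
    · exact h2
    · exact h1
  · rw [hval p hp]
    exact mul_ne_zero (by norm_num) (h0 p hp)

theorem morse_I {k : ℕ} (hk : 1 ≤ k) :
    ∃ m, IsMorse (oddDefI k m) ∧ ∀ x, IsCrit (oddDefI k m) x → oddDefI k m x ≠ 0 := by
  refine ⟨Pi.single (Fin.last k) 1, ?_⟩
  have : oddDefI k (Pi.single (Fin.last k) 1) = quadraticFun (X ^ (2 * k + 1)) 1 := by
    funext v
    simp [oddDefI, quadraticFun, Fin.castSucc_ne_last]
  rw [this]
  set f := quadraticFun (X ^ (2 * k + 1)) 1 with hf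
  have hk1 : (2 * k + 1 : ℂ) ≠ 0 := by exact_mod_cast Nat.succ_ne_zero (2 * k)
  have hk2 : (k + 1 : ℂ) ≠ 0 := by exact_mod_cast Nat.succ_ne_zero k
  have hcrit : ∀ p, IsCrit f p →
      p 1 ^ 2 + (2 * k + 1) * p 0 ^ (2 * k) = 0 ∧ 2 * p 0 * p 1 = -1 := by
    intro p hp
    rw [hf, isCrit_quadraticFun] at hp
    simp only [derivative_X_pow, eval_mul, eval_C, eval_pow, eval_X] at hp
    push_cast at hp
    exact ⟨hp.1, by linear_combination hp.2⟩
  -- Euler's formula with weights 1 and `k` for `a` and `c`. The critical value determines `c`, and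
  -- `2ac = -1` determines `a`.
  have hval : ∀ p, IsCrit f p → (2 * k + 1) * f p = (k + 1) * p 1 := by
    intro p hp
    obtain ⟨h1, h2⟩ := hcrit p hp
    simp only [hf, quadraticFun, eval_pow, eval_X]
    rw [pow_succ]
    linear_combination p 0 * h1 + k * p 1 * h2
  have h0 : ∀ p, IsCrit f p → p 0 ≠ 0 ∧ p 1 ≠ 0 := by
    intro p hp
    have := (hcrit p hp).2
    constructor <;> intro h <;> rw [h] at this <;> simp at this
  refine ⟨⟨fun p hp => ?_, fun p q hp hq hpq => ?_⟩, fun p hp h => ?_⟩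
  · rw [hf, isNondegenerate_quadraticFun]
    have h1 := (hcrit p hp).1
    obtain ⟨j, rfl⟩ : ∃ j, k = j + 1 := ⟨k - 1, by omega⟩
    simp only [zerosJacobian, derivative_X_pow, derivative_mul, derivative_C, derivative_X,
      eval_mul, eval_C, eval_pow, eval_X, eval_add, eval_zero, eval_one]
    intro h
    have h3 : (2 * ((j + 1 : ℕ) : ℂ) + 1) * (((j + 1 : ℕ) : ℂ) + 1) * p 0 ^ (2 * (j + 1)) = 0 := by
      rw [show 2 * (j + 1) + 1 - 1 = (2 * j + 1) + 1 by omega] at h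
      rw [show 2 * (j + 1) = (2 * j + 1) + 1 by ring, pow_succ] at h1 ⊢
      simp only [Nat.add_sub_cancel] at h
      push_cast at h h1 ⊢
      linear_combination h1 - h / 4
    rw [mul_eq_zero, mul_eq_zero] at h3
    exact h3.elim (fun h => h.elim hk1 hk2) (pow_ne_zero _ (h0 p hp).1)
  · have h1 : p 1 = q 1 := by
      refine mul_left_cancel₀ hk2 ?_
      rw [← hval p hp, ← hval q hq, hpq]
    have h2 : p 0 = q 0 := by
      have e1 := (hcrit p hp).2
      have e2 := (hcrit q hq).2
      rw [← h1] at e2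
      exact mul_right_cancel₀ (h0 p hp).2 (by linear_combination (e1 - e2) / 2)
    funext i
    fin_cases i
    · exact h2
    · exact h1
  · have := hval p hp
    rw [h, mul_zero] at this
    exact mul_ne_zero hk2 (h0 p hp).2 this.symm

/-! ### Bounding Milnor numbers by multiplication tables -/

section
variable {A : Type*} [CommRing A] [Algebra ℂ A]

/-- The elements of an algebra whose multiplication preserves the subspace `B`. -/
def stabilizerAlgebra (B : Submodule ℂ A) : Subalgebra ℂ A where
  carrier := {a | ∀ m ∈ B, a * m ∈ B}
  mul_mem' := by
    intro a b ha hb m hm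
    rw [mul_assoc]
    exact ha _ (hb m hm)
  add_mem' := by
    intro a b ha hb m hm
    rw [add_mul]
    exact B.add_mem (ha m hm) (hb m hm)
  algebraMap_mem' := by
    intro r m hm
    rw [← Algebra.smul_def]
    exact B.smul_mem r hm

theorem mem_stabilizerAlgebra_span {n : ℕ} {v : Fin n → A} {a : A}
    (h : ∀ j, a * v j ∈ Submodule.span ℂ (Set.range v)) :
    a ∈ stabilizerAlgebra (Submodule.span ℂ (Set.range v)) := by
  intro m hm
  induction hm using Submodule.span_induction with
  | mem x hx => obtain ⟨j, rfl⟩ := hx; exact h j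
  | zero => rw [mul_zero]; exact Submodule.zero_mem _
  | add x y _ _ hx hy => rw [mul_add]; exact Submodule.add_mem _ hx hy
  | smul c x _ hx => rw [mul_smul_comm]; exact Submodule.smul_mem _ c hx

/-- A subspace that contains `1` and is stable under multiplication by all the generators is the
whole algebra. -/
theorem finrank_le_of_stabilizer {s n : ℕ} {K : Ideal (MvPolynomial (Fin s) ℂ)}
    {v : Fin n → MvPolynomial (Fin s) ℂ ⧸ K}
    (h1 : 1 ∈ Submodule.span ℂ (Set.range v))
    (hX : ∀ i, Ideal.Quotient.mk K (MvPolynomial.X i) ∈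
      stabilizerAlgebra (Submodule.span ℂ (Set.range v))) :
    Module.Finite ℂ (MvPolynomial (Fin s) ℂ ⧸ K) ∧
      Module.finrank ℂ (MvPolynomial (Fin s) ℂ ⧸ K) ≤ n := by
  have htop : Submodule.span ℂ (Set.range v) = ⊤ := by
    rw [eq_top_iff]
    rintro a -
    obtain ⟨g, rfl⟩ := Ideal.Quotient.mk_surjective a
    have hg : Ideal.Quotient.mk K g ∈ stabilizerAlgebra (Submodule.span ℂ (Set.range v)) := by
      induction g using MvPolynomial.induction_on with
      | C c => exact Subalgebra.algebraMap_mem _ c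
      | add p q hp hq => rw [map_add]; exact add_mem hp hq
      | mul_X p i hp => rw [map_mul]; exact mul_mem hp (hX i)
    simpa using hg 1 h1
  refine ⟨Module.finite_def.2 ⟨(Set.finite_range v).toFinset, by simpa using htop⟩, ?_⟩
  rw [← finrank_top, ← htop]
  exact (finrank_range_le_card v).trans (by simp)

theorem smul_mem_span {B : Submodule ℂ A} (a : ℂ) {m : A} (hm : m ∈ B) :
    algebraMap ℂ A a * m ∈ B := by
  rw [← Algebra.smul_def]
  exact B.smul_mem a hm

theorem aeval_mem_subalgebra (T : Subalgebra ℂ A) {a : A} (ha : a ∈ T) (P : ℂ[X]) :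
    aeval a P ∈ T := by
  have := (aeval (⟨a, ha⟩ : T) P).2
  rwa [← Subalgebra.coe_val, ← Polynomial.aeval_algHom_apply] at this

end

/-- Where `f p ≠ 0` the function is a unit of the local ring. This is how the restriction to
critical points outside the zero level enters the bound for Milnor numbers. -/
theorem polynomialJacobian_cancel {s : ℕ} {f : (Fin s → ℂ) → ℂ} {p : Fin s → ℂ}
    {D g : MvPolynomial (Fin s) ℂ} (hD : ∀ x, MvPolynomial.eval x D = f x) (hp : f p ≠ 0)
    (h : D * g ∈ polynomialJacobian f p) : g ∈ polynomialJacobian f p := by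
  rw [mem_polynomialJacobian] at h
  simp only [map_mul] at h
  exact h.of_mul (AnalyticOnNhd.eval_mvPolynomial D p trivial) (by rwa [hD])

theorem partial_mem_polynomialJacobian {s : ℕ} {f : (Fin s → ℂ) → ℂ} {p : Fin s → ℂ}
    {d : MvPolynomial (Fin s) ℂ} (i : Fin s)
    (hd : ∀ x, MvPolynomial.eval x d = fderiv ℂ f x (Pi.single i 1)) :
    d ∈ polynomialJacobian f p :=
  (InJacobian.partial_mem f p i).congr (Filter.Eventually.of_forall hd)

theorem eval_aeval_X {s : ℕ} (i : Fin s) (P : ℂ[X]) (x : Fin s → ℂ) :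
    MvPolynomial.eval x (aeval (MvPolynomial.X i) P) = P.eval (x i) := by
  have := Polynomial.aeval_algHom_apply (MvPolynomial.aeval x : MvPolynomial (Fin s) ℂ →ₐ[ℂ] ℂ)
    (MvPolynomial.X i) P
  simpa [MvPolynomial.aeval_eq_eval] using this.symm

/-! ### The families of type `II` -/

/-- The symmetric matrix families of type `II`. -/
def matII (p q : ℂ[X]) (u : Fin 4 → ℂ) : Matrix (Fin 3) (Fin 3) ℂ :=
  !![u 0, p.eval (u 3), u 1 + q.eval (u 3);
     p.eval (u 3), u 1, u 2;
     u 1 + q.eval (u 3), u 2, u 3]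

/-- The odd functions of type `II`. -/
def oddII (p q : ℂ[X]) (v : Fin 2 → ℂ) : ℂ :=
  v 0 ^ 3 + v 0 * q.eval (v 1 ^ 2) + v 1 * p.eval (v 1 ^ 2)

section
variable (p q : ℂ[X])

theorem detFun_matII (u : Fin 4 → ℂ) : detFun (matII p q) u =
    u 0 * (u 1 * u 3 - u 2 ^ 2) - p.eval (u 3) ^ 2 * u 3
      + 2 * (p.eval (u 3) * u 2 * (u 1 + q.eval (u 3))) - u 1 * (u 1 + q.eval (u 3)) ^ 2 := by
  rw [detFun, matII, Matrix.det_fin_three]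
  simp
  ring

theorem hasFDerivAt_detFun_matII (u : Fin 4 → ℂ) :
    HasFDerivAt (detFun (matII p q))
      ((u 1 * u 3 - u 2 ^ 2) • (ContinuousLinearMap.proj 0 : (Fin 4 → ℂ) →L[ℂ] ℂ)
      + (u 0 * u 3 + 2 * (p.eval (u 3) * u 2) - (u 1 + q.eval (u 3)) ^ 2
          - 2 * (u 1 * (u 1 + q.eval (u 3)))) •
        (ContinuousLinearMap.proj 1 : (Fin 4 → ℂ) →L[ℂ] ℂ)
      + (2 * (p.eval (u 3) * (u 1 + q.eval (u 3)) - u 0 * u 2)) •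
        (ContinuousLinearMap.proj 2 : (Fin 4 → ℂ) →L[ℂ] ℂ)
      + (u 0 * u 1 - p.eval (u 3) ^ 2
          + 2 * p.derivative.eval (u 3) * (u 2 * (u 1 + q.eval (u 3)) - p.eval (u 3) * u 3)
          + 2 * q.derivative.eval (u 3) * (p.eval (u 3) * u 2 - u 1 * (u 1 + q.eval (u 3)))) •
        (ContinuousLinearMap.proj 3 : (Fin 4 → ℂ) →L[ℂ] ℂ)) u := by
  have h : detFun (matII p q) = _ := funext (detFun_matII p q)
  rw [h]
  have hx := hasFDerivAt_coord 0 u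
  have hy := hasFDerivAt_coord 1 u
  have hz := hasFDerivAt_coord 2 u
  have hw := hasFDerivAt_coord 3 u
  have hp := hasFDerivAt_eval_coord p 3 u
  have hq := hy.fun_add (hasFDerivAt_eval_coord q 3 u)
  refine ((((hx.fun_mul ((hy.fun_mul hw).fun_sub (hz.pow 2))).fun_sub ((hp.pow 2).fun_mul hw)).fun_add
    (((hp.fun_mul hz).fun_mul hq).const_mul 2)).fun_sub (hy.fun_mul (hq.pow 2))).congr_fderiv ?_
  ext t
  simp
  ring

theorem isCrit_detFun_matII (u : Fin 4 → ℂ) : IsCrit (detFun (matII p q)) u ↔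
    u 1 * u 3 - u 2 ^ 2 = 0 ∧
    u 0 * u 3 + 2 * (p.eval (u 3) * u 2) - (u 1 + q.eval (u 3)) ^ 2
      - 2 * (u 1 * (u 1 + q.eval (u 3))) = 0 ∧
    p.eval (u 3) * (u 1 + q.eval (u 3)) - u 0 * u 2 = 0 ∧
    u 0 * u 1 - p.eval (u 3) ^ 2
      + 2 * p.derivative.eval (u 3) * (u 2 * (u 1 + q.eval (u 3)) - p.eval (u 3) * u 3)
      + 2 * q.derivative.eval (u 3) * (p.eval (u 3) * u 2 - u 1 * (u 1 + q.eval (u 3))) = 0 := by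
  rw [isCrit_iff]
  simp [Fin.forall_fin_succ, (hasFDerivAt_detFun_matII p q u).fderiv]

end

/-- The algebraic consequences of the equations for the critical points of a determinant of type
`II` outside its zero level. -/
theorem relations_of_crit_II {A : Type*} [CommRing A] {x y z w P Q P' Q' D : A}
    (hD : D = x * (y * w - z ^ 2) - P ^ 2 * w + 2 * (P * z * (y + Q)) - y * (y + Q) ^ 2)
    (hcancel : ∀ g, D * g = 0 → g = 0)
    (h0 : y * w - z ^ 2 = 0)
    (h1 : x * w + 2 * (P * z) - (y + Q) ^ 2 - 2 * (y * (y + Q)) = 0)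
    (h2 : P * (y + Q) - x * z = 0)
    (h3 : x * y - P ^ 2 + 2 * P' * (z * (y + Q) - P * w) + 2 * Q' * (P * z - y * (y + Q)) = 0) :
    3 * y + Q = 0 ∧ P + 2 * w * P' - 2 * z * Q' = 0 ∧ x = 4 * z * P' - 4 * y * Q' := by
  -- Let `nᵢⱼ` be the cofactors. The hypotheses read `n₀₀ = 0`, `n₁₁ = -2n₀₂`, `n₁₂ = 0`, `n₂₂ =
  -- -2P'n₀₁ - 2Q'n₀₂`. Substitution into `adj(adj M) = D·M` gives `Dy = -n₀₂²`, `Dz = n₀₁n₀₂`, `Dw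
  -- = -n₀₁²`, `D(y + Q) = 2n₀₂²`, and similarly for `P` and `x`; the three relations follow after
  -- multiplication by `D`. The explicit combinations below encode this.
  refine ⟨hcancel _ ?_, hcancel _ ?_, ?_⟩
  · rw [hD]
    linear_combination (z * (y + Q) - P * w) * h2 + 2 * (x * y - P ^ 2) * h0
      - (P * z - y * (y + Q)) * h1
  · rw [hD]
    linear_combination (-(z * (y + Q) - P * w)) * h3 + (P * z - y * (y + Q) + 2 * Q' * (y * w - z ^ 2))
      * h2 + 2 * P' * (x * w - (y + Q) ^ 2) * h0
  · rw [← sub_eq_zero]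
    refine hcancel _ ?_
    rw [hD]
    linear_combination (x * w - (y + Q) ^ 2) * h3
      - 2 * P' * (z * (y + Q) - P * w) * h1 - 2 * Q' * (P * z - y * (y + Q)) * h1
      + (4 * P' * (P * (y + Q) - x * z) + 4 * Q' * (x * y - P ^ 2)) * h0
      - (P * (y + Q) - x * z) * h2

theorem oddII_eq (p q : ℂ[X]) :
    oddII p q = cubicFun (q.comp (X ^ 2)) (X * p.comp (X ^ 2)) := by
  funext v
  simp [oddII, cubicFun]

theorem isCrit_oddII (p q : ℂ[X]) (v : Fin 2 → ℂ) : IsCrit (oddII p q) v ↔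
    3 * v 0 ^ 2 + q.eval (v 1 ^ 2) = 0 ∧
    p.eval (v 1 ^ 2) + 2 * v 1 ^ 2 * p.derivative.eval (v 1 ^ 2)
      + 2 * v 0 * v 1 * q.derivative.eval (v 1 ^ 2) = 0 := by
  rw [oddII_eq, isCrit_cubicFun]
  simp [derivative_comp]
  refine fun _ => ?_
  constructor <;> intro h <;> linear_combination h

/-- The points `±(b, c)` correspond to the single critical point with `y = b²`, `z = -bc`, `w = c²`
and `x` given by the third relation of `relations_of_crit_II`. The other two relations become the
vanishing of the partial derivatives of the odd function. -/
theorem nonzeroCritValues_matII (p q : ℂ[X]) (v : ℂ) :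
    v ∈ nonzeroCritValues (detFun (matII p q)) ↔
      ∃ t ∈ nonzeroCritValues (oddII p q), v = -1 * t ^ 2 := by
  constructor
  · rintro ⟨hv, u, hu, rfl⟩
    rw [isCrit_detFun_matII] at hu
    obtain ⟨h0, h1, h2, h3⟩ := hu
    obtain ⟨e1, e2, e3⟩ := relations_of_crit_II (detFun_matII p q u)
      (fun g hg => (mul_eq_zero.1 hg).resolve_left hv) h0 h1 h2 h3
    -- Parametrisation of the cone `yw = z²`; when `w = 0` the equation forces `z = 0` and any
    -- square root of `y` serves as `b`.
    obtain ⟨b, c, hb, hz, hc⟩ : ∃ b c : ℂ, u 1 = b ^ 2 ∧ u 2 = -(b * c) ∧ u 3 = c ^ 2 := by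
      obtain ⟨c, hc⟩ := IsAlgClosed.exists_pow_nat_eq (u 3) (n := 2) two_pos
      by_cases hc0 : c = 0
      · obtain ⟨b, hb⟩ := IsAlgClosed.exists_pow_nat_eq (u 1) (n := 2) two_pos
        refine ⟨b, c, hb.symm, ?_, hc.symm⟩
        rw [← hc, hc0] at h0
        rw [hc0]
        simpa using h0
      · refine ⟨-u 2 / c, c, ?_, ?_, hc.symm⟩
        · rw [← hc] at h0
          field_simp
          linear_combination h0
        · field_simp
    have hdet := detFun_matII p q u
    have hP : p.eval (c ^ 2) = -2 * c * (c * p.derivative.eval (c ^ 2) + b * q.derivative.eval (c ^ 2)) := by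
      rw [hz, hc] at e2; linear_combination e2
    have hQ : q.eval (c ^ 2) = -3 * b ^ 2 := by
      rw [hb, hc] at e1; linear_combination e1
    have hval : detFun (matII p q) u = -1 * oddII p q ![b, c] ^ 2 := by
      rw [hdet, e3, hb, hz, hc]
      simp [oddII, hP, hQ]
      ring
    refine ⟨oddII p q ![b, c], ⟨?_, ![b, c], ?_, rfl⟩, hval⟩
    · intro h
      rw [h] at hval
      exact hv (by rw [hval]; ring)
    · rw [isCrit_oddII]
      simp [hP, hQ]
      ring
  · rintro ⟨t, ⟨ht, r, hr, rfl⟩, rfl⟩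
    rw [isCrit_oddII] at hr
    have hP : p.eval (r 1 ^ 2) = -2 * r 1 * (r 1 * p.derivative.eval (r 1 ^ 2)
        + r 0 * q.derivative.eval (r 1 ^ 2)) := by
      linear_combination hr.2
    have hQ : q.eval (r 1 ^ 2) = -3 * r 0 ^ 2 := by
      linear_combination hr.1
    refine ⟨mul_ne_zero (by norm_num) (pow_ne_zero 2 ht),
      ![-4 * r 0 * (r 1 * p.derivative.eval (r 1 ^ 2) + r 0 * q.derivative.eval (r 1 ^ 2)),
        r 0 ^ 2, -(r 0 * r 1), r 1 ^ 2], ?_, ?_⟩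
    · rw [isCrit_detFun_matII]
      simp only [Matrix.cons_val]
      rw [hP, hQ]
      refine ⟨?_, ?_, ?_, ?_⟩ <;> ring
    · rw [detFun_matII, oddII]
      simp only [Matrix.cons_val]
      rw [hP, hQ]
      ring

/-- In the quotient by the intersection of the Jacobian ideals over `S` the determinant is not a
zero divisor, so `relations_of_crit_II` applies there. It expresses `x` and `y` through `z` and `w`,
which leaves a multiplication table in two variables. -/
theorem offZeroMilnor_matII_le {p q : ℂ[X]} {n : ℕ}
    (h : ∀ (K : Ideal (MvPolynomial (Fin 4) ℂ)) (z w : MvPolynomial (Fin 4) ℂ ⧸ K),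
      3 * z ^ 2 + w * aeval w q = 0 →
      aeval w p + 2 * w * aeval w p.derivative - 2 * z * aeval w q.derivative = 0 →
      ∃ v : Fin n → MvPolynomial (Fin 4) ℂ ⧸ K, 1 ∈ Submodule.span ℂ (Set.range v) ∧
        z ∈ stabilizerAlgebra (Submodule.span ℂ (Set.range v)) ∧
        w ∈ stabilizerAlgebra (Submodule.span ℂ (Set.range v))) :
    offZeroMilnor (detFun (matII p q)) ≤ n := by
  refine offZeroMilnor_le fun S hS => ?_
  set f := detFun (matII p q) with hf
  let K : Ideal (MvPolynomial (Fin 4) ℂ) := ⨅ r ∈ S, polynomialJacobian f r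
  have hK : ∀ g, g ∈ K ↔ ∀ r ∈ S, g ∈ polynomialJacobian f r := by
    intro g
    simp [K, Submodule.mem_iInf]
  let x : MvPolynomial (Fin 4) ℂ := MvPolynomial.X 0
  let y : MvPolynomial (Fin 4) ℂ := MvPolynomial.X 1
  let z : MvPolynomial (Fin 4) ℂ := MvPolynomial.X 2
  let w : MvPolynomial (Fin 4) ℂ := MvPolynomial.X 3
  let D := x * (y * w - z ^ 2) - aeval w p ^ 2 * w + 2 * (aeval w p * z * (y + aeval w q))
    - y * (y + aeval w q) ^ 2
  have hD : ∀ u, MvPolynomial.eval u D = f u := by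
    intro u
    simp [D, x, y, z, w, hf, detFun_matII, eval_aeval_X]
  have hcancel : ∀ g : MvPolynomial (Fin 4) ℂ ⧸ K, Ideal.Quotient.mk K D * g = 0 → g = 0 := by
    intro g hg
    obtain ⟨g, rfl⟩ := Ideal.Quotient.mk_surjective g
    rw [← map_mul, Ideal.Quotient.eq_zero_iff_mem, hK] at hg
    rw [Ideal.Quotient.eq_zero_iff_mem, hK]
    exact fun r hr => polynomialJacobian_cancel hD (hS r hr).2 (hg r hr)
  have hpartial : ∀ (d : MvPolynomial (Fin 4) ℂ) (i : Fin 4),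
      (∀ u, MvPolynomial.eval u d = fderiv ℂ f u (Pi.single i 1)) →
      Ideal.Quotient.mk K d = 0 := by
    intro d i hd
    rw [Ideal.Quotient.eq_zero_iff_mem, hK]
    exact fun r _ => partial_mem_polynomialJacobian i hd
  have hae : ∀ P : ℂ[X], Ideal.Quotient.mk K (aeval w P) = aeval (Ideal.Quotient.mk K w) P :=
    fun P => (Polynomial.aeval_algHom_apply (Ideal.Quotient.mkₐ ℂ K) w P).symm
  have h0 := hpartial (y * w - z ^ 2) 0 fun u => by
    simp [y, z, w, hf, (hasFDerivAt_detFun_matII p q u).fderiv]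
  have h1 := hpartial (x * w + 2 * (aeval w p * z) - (y + aeval w q) ^ 2
      - 2 * (y * (y + aeval w q))) 1 fun u => by
    simp [x, y, z, w, hf, (hasFDerivAt_detFun_matII p q u).fderiv, eval_aeval_X]
  have h2 := hpartial (2 * (aeval w p * (y + aeval w q) - x * z)) 2 fun u => by
    simp [x, y, z, w, hf, (hasFDerivAt_detFun_matII p q u).fderiv, eval_aeval_X]
  have h3 := hpartial (x * y - aeval w p ^ 2
      + 2 * aeval w p.derivative * (z * (y + aeval w q) - aeval w p * w)
      + 2 * aeval w q.derivative * (aeval w p * z - y * (y + aeval w q))) 3 fun u => by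
    simp [x, y, z, w, hf, (hasFDerivAt_detFun_matII p q u).fderiv, eval_aeval_X]
  have h2' : Ideal.Quotient.mk K (aeval w p * (y + aeval w q) - x * z) = 0 := by
    have h22 : algebraMap ℂ (MvPolynomial (Fin 4) ℂ ⧸ K) (1 / 2) * 2 = 1 := by
      rw [← map_ofNat (algebraMap ℂ (MvPolynomial (Fin 4) ℂ ⧸ K)) 2, ← map_mul]
      norm_num
    rw [map_mul, map_ofNat] at h2
    linear_combination (algebraMap ℂ (MvPolynomial (Fin 4) ℂ ⧸ K) (1 / 2)) * h2
      - Ideal.Quotient.mk K (aeval w p * (y + aeval w q) - x * z) * h22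
  simp only [map_add, map_sub, map_mul, map_pow, map_ofNat, hae] at h0 h1 h2' h3
  obtain ⟨e1, e2, e3⟩ := relations_of_crit_II (D := Ideal.Quotient.mk K D)
    (by simp only [D, map_add, map_sub, map_mul, map_pow, map_ofNat, hae]) hcancel h0 h1 h2' h3
  -- The first relation is `w(3y + q) = 0` with `yw` replaced by `z²`.
  obtain ⟨v, hv1, hvz, hvw⟩ := h K (Ideal.Quotient.mk K z) (Ideal.Quotient.mk K w)
    (by linear_combination Ideal.Quotient.mk K w * e1 - 3 * h0) e2
  have h33 : algebraMap ℂ (MvPolynomial (Fin 4) ℂ ⧸ K) (1 / 3) * 3 = 1 := by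
    rw [← map_ofNat (algebraMap ℂ (MvPolynomial (Fin 4) ℂ ⧸ K)) 3, ← map_mul]
    norm_num
  set T := stabilizerAlgebra (Submodule.span ℂ (Set.range v))
  have hvy : Ideal.Quotient.mk K y ∈ T := by
    have : Ideal.Quotient.mk K y = algebraMap ℂ (MvPolynomial (Fin 4) ℂ ⧸ K) (1 / 3)
        * (-aeval (Ideal.Quotient.mk K w) q) := by
      linear_combination (algebraMap ℂ (MvPolynomial (Fin 4) ℂ ⧸ K) (1 / 3)) * e1
        - Ideal.Quotient.mk K y * h33
    rw [this]
    exact mul_mem (T.algebraMap_mem _) (neg_mem (aeval_mem_subalgebra T hvw q))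
  have h4 : (4 : MvPolynomial (Fin 4) ℂ ⧸ K) ∈ T := by
    rw [← map_ofNat (algebraMap ℂ (MvPolynomial (Fin 4) ℂ ⧸ K)) 4]
    exact T.algebraMap_mem _
  have hvx : Ideal.Quotient.mk K x ∈ T := by
    rw [e3]
    exact sub_mem (mul_mem (mul_mem h4 hvz) (aeval_mem_subalgebra T hvw _))
      (mul_mem (mul_mem h4 hvy) (aeval_mem_subalgebra T hvw _))
  obtain ⟨hfin, hrank⟩ := finrank_le_of_stabilizer hv1 (by
    intro i
    fin_cases i
    exacts [hvx, hvy, hvz, hvw])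
  exact ⟨K, hfin, hrank, fun r hr => iInf₂_le r hr⟩

/-! ### Multiplication tables for type `II` -/

section
variable {A : Type*} [CommRing A] [Algebra ℂ A]

local notation "κ" => algebraMap ℂ A

/-- The leading monomials of the two relations are `z²` and `w²`, which leaves `1, z, w, zw`. Each
product is reduced with the help of those already reduced. -/
theorem stabilizer_table_II4 {z w : A} {a b d e f : ℂ}
    (hz : z ^ 2 = κ a * w + κ b * w ^ 2) (hw : w ^ 2 = κ d * 1 + κ e * w + κ f * z) :
    z ∈ stabilizerAlgebra (Submodule.span ℂ (Set.range ![1, z, w, z * w])) ∧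
    w ∈ stabilizerAlgebra (Submodule.span ℂ (Set.range ![1, z, w, z * w])) := by
  set B := Submodule.span ℂ (Set.range ![1, z, w, z * w])
  have m0 : 1 ∈ B := Submodule.subset_span ⟨0, rfl⟩
  have m1 : z ∈ B := Submodule.subset_span ⟨1, rfl⟩
  have m2 : w ∈ B := Submodule.subset_span ⟨2, rfl⟩
  have m3 : z * w ∈ B := Submodule.subset_span ⟨3, rfl⟩
  have hs : ∀ (a : ℂ) {m : A}, m ∈ B → κ a * m ∈ B := fun a _ hm => smul_mem_span a hm
  have hww : w ^ 2 ∈ B := by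
    rw [hw]; exact add_mem (add_mem (hs _ m0) (hs _ m2)) (hs _ m1)
  have hzz : z ^ 2 ∈ B := by
    rw [hz]; exact add_mem (hs _ m2) (hs _ hww)
  have hzww : z * w ^ 2 ∈ B := by
    rw [show z * w ^ 2 = κ d * z + κ e * (z * w) + κ f * z ^ 2 by rw [hw]; ring]
    exact add_mem (add_mem (hs _ m1) (hs _ m3)) (hs _ hzz)
  have hwww : w ^ 3 ∈ B := by
    rw [show w ^ 3 = κ d * w + κ e * w ^ 2 + κ f * (z * w) by
      linear_combination w * hw]
    exact add_mem (add_mem (hs _ m2) (hs _ hww)) (hs _ m3)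
  have hzzw : z ^ 2 * w ∈ B := by
    rw [show z ^ 2 * w = κ a * w ^ 2 + κ b * w ^ 3 by rw [hz]; ring]
    exact add_mem (hs _ hww) (hs _ hwww)
  constructor <;> refine mem_stabilizerAlgebra_span fun j => ?_ <;> fin_cases j <;> dsimp
  · rw [mul_one]; exact m1
  · rw [← pow_two]; exact hzz
  · exact m3
  · rw [show z * (z * w) = z ^ 2 * w by ring]; exact hzzw
  · rw [mul_one]; exact m2
  · exact mul_comm _ w ▸ m3
  · rw [← pow_two]; exact hww
  · rw [show w * (z * w) = z * w ^ 2 by ring]; exact hzww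

/-- The leading monomials are `z²` and `w³`. The lower terms `z` and `zw` in the relation for `w³`
fix the order of the reductions: `z w³` needs `z²w`, which needs `w⁴`, and `z²w²` needs `w⁵`, which
needs `z w³`. -/
theorem stabilizer_table_II6 {z w : A} {a b c d e f g h : ℂ}
    (hz : z ^ 2 = κ a * w + κ b * w ^ 2 + κ c * w ^ 3)
    (hw : w ^ 3 = κ d * 1 + κ e * w + κ f * w ^ 2 + κ g * z + κ h * (z * w)) :
    z ∈ stabilizerAlgebra
      (Submodule.span ℂ (Set.range ![1, w, w ^ 2, z, z * w, z * w ^ 2])) ∧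
    w ∈ stabilizerAlgebra
      (Submodule.span ℂ (Set.range ![1, w, w ^ 2, z, z * w, z * w ^ 2])) := by
  set B := Submodule.span ℂ (Set.range ![1, w, w ^ 2, z, z * w, z * w ^ 2])
  have m0 : 1 ∈ B := Submodule.subset_span ⟨0, rfl⟩
  have m1 : w ∈ B := Submodule.subset_span ⟨1, rfl⟩
  have m2 : w ^ 2 ∈ B := Submodule.subset_span ⟨2, rfl⟩
  have m3 : z ∈ B := Submodule.subset_span ⟨3, rfl⟩
  have m4 : z * w ∈ B := Submodule.subset_span ⟨4, rfl⟩
  have m5 : z * w ^ 2 ∈ B := Submodule.subset_span ⟨5, rfl⟩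
  have hs : ∀ (a : ℂ) {m : A}, m ∈ B → κ a * m ∈ B := fun a _ hm => smul_mem_span a hm
  have hw3 : w ^ 3 ∈ B := by
    rw [hw]
    exact add_mem (add_mem (add_mem (add_mem (hs _ m0) (hs _ m1)) (hs _ m2)) (hs _ m3)) (hs _ m4)
  have hw4 : w ^ 4 ∈ B := by
    rw [show w ^ 4 = κ d * w + κ e * w ^ 2 + κ f * w ^ 3 + κ g * (z * w) + κ h * (z * w ^ 2) by
      rw [pow_succ, hw]; linear_combination κ f * hw]
    exact add_mem (add_mem (add_mem (add_mem (hs _ m1) (hs _ m2)) (hs _ hw3)) (hs _ m4)) (hs _ m5)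
  have hw5 : w ^ 5 = κ d * w ^ 2 + κ e * w ^ 3 + κ f * w ^ 4 + κ g * (z * w ^ 2)
      + κ h * (z * w ^ 3) := by
    linear_combination w ^ 2 * hw
  have hzz : z ^ 2 ∈ B := by
    rw [hz]; exact add_mem (add_mem (hs _ m1) (hs _ m2)) (hs _ hw3)
  have hzzw : z ^ 2 * w ∈ B := by
    rw [show z ^ 2 * w = κ a * w ^ 2 + κ b * w ^ 3 + κ c * w ^ 4 by rw [hz]; ring]
    exact add_mem (add_mem (hs _ m2) (hs _ hw3)) (hs _ hw4)
  have hzw3 : z * w ^ 3 ∈ B := by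
    rw [show z * w ^ 3 = κ d * z + κ e * (z * w) + κ f * (z * w ^ 2) + κ g * z ^ 2
      + κ h * (z ^ 2 * w) by rw [hw]; ring]
    exact add_mem (add_mem (add_mem (add_mem (hs _ m3) (hs _ m4)) (hs _ m5)) (hs _ hzz))
      (hs _ hzzw)
  have hw5' : w ^ 5 ∈ B := by
    rw [hw5]
    exact add_mem (add_mem (add_mem (add_mem (hs _ m2) (hs _ hw3)) (hs _ hw4)) (hs _ m5))
      (hs _ hzw3)
  have hzzw2 : z ^ 2 * w ^ 2 ∈ B := by
    rw [show z ^ 2 * w ^ 2 = κ a * w ^ 3 + κ b * w ^ 4 + κ c * w ^ 5 by rw [hz]; ring]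
    exact add_mem (add_mem (hs _ hw3) (hs _ hw4)) (hs _ hw5')
  constructor <;> refine mem_stabilizerAlgebra_span fun j => ?_ <;> fin_cases j <;> dsimp
  · rw [mul_one]; exact m3
  · exact m4
  · exact m5
  · rw [← pow_two]; exact hzz
  · rw [show z * (z * w) = z ^ 2 * w by ring]; exact hzzw
  · rw [show z * (z * w ^ 2) = z ^ 2 * w ^ 2 by ring]; exact hzzw2
  · rw [mul_one]; exact m1
  · rw [← pow_two]; exact m2
  · rw [← pow_succ']; exact hw3
  · exact mul_comm _ w ▸ m4
  · rw [show w * (z * w) = z * w ^ 2 by ring]; exact m5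
  · rw [show w * (z * w ^ 2) = z * w ^ 3 by ring]; exact hzw3

/-- Here `w³` and `zw` are eliminated. Computing `z w³` both from `z` times the first relation and
from `w²` times the second brings `z³` into the span. -/
theorem stabilizer_table_II5 {z w : A} {a b d e f g : ℂ}
    (hz : w ^ 3 = κ a * w + κ b * w ^ 2 - 3 * z ^ 2)
    (hw : z * w = κ d * 1 + κ e * w + κ f * w ^ 2 + κ g * z) :
    z ∈ stabilizerAlgebra (Submodule.span ℂ (Set.range ![1, w, w ^ 2, z, z ^ 2])) ∧
    w ∈ stabilizerAlgebra (Submodule.span ℂ (Set.range ![1, w, w ^ 2, z, z ^ 2])) := by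
  set B := Submodule.span ℂ (Set.range ![1, w, w ^ 2, z, z ^ 2])
  have m0 : 1 ∈ B := Submodule.subset_span ⟨0, rfl⟩
  have m1 : w ∈ B := Submodule.subset_span ⟨1, rfl⟩
  have m2 : w ^ 2 ∈ B := Submodule.subset_span ⟨2, rfl⟩
  have m3 : z ∈ B := Submodule.subset_span ⟨3, rfl⟩
  have m4 : z ^ 2 ∈ B := Submodule.subset_span ⟨4, rfl⟩
  have hs : ∀ (a : ℂ) {m : A}, m ∈ B → κ a * m ∈ B := fun a _ hm => smul_mem_span a hm
  have h3 : ∀ {m : A}, m ∈ B → 3 * m ∈ B := fun {m} hm => by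
    rw [← map_ofNat κ 3]; exact hs _ hm
  have hw3 : w ^ 3 ∈ B := by
    rw [hz]; exact sub_mem (add_mem (hs _ m1) (hs _ m2)) (h3 m4)
  have hzw : z * w ∈ B := by
    rw [hw]; exact add_mem (add_mem (add_mem (hs _ m0) (hs _ m1)) (hs _ m2)) (hs _ m3)
  have hzw2 : z * w ^ 2 ∈ B := by
    rw [show z * w ^ 2 = κ d * w + κ e * w ^ 2 + κ f * w ^ 3 + κ g * (z * w) by
      linear_combination w * hw]
    exact add_mem (add_mem (add_mem (hs _ m1) (hs _ m2)) (hs _ hw3)) (hs _ hzw)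
  have hz2w : z ^ 2 * w ∈ B := by
    rw [show z ^ 2 * w = κ d * z + κ e * (z * w) + κ f * (z * w ^ 2) + κ g * z ^ 2 by
      linear_combination z * hw]
    exact add_mem (add_mem (add_mem (hs _ m3) (hs _ hzw)) (hs _ hzw2)) (hs _ m4)
  have hw4 : w ^ 4 ∈ B := by
    rw [show w ^ 4 = κ a * w ^ 2 + κ b * w ^ 3 - 3 * (z ^ 2 * w) by linear_combination w * hz]
    exact sub_mem (add_mem (hs _ m2) (hs _ hw3)) (h3 hz2w)
  have hzw3 : z * w ^ 3 ∈ B := by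
    rw [show z * w ^ 3 = κ d * w ^ 2 + κ e * w ^ 3 + κ f * w ^ 4 + κ g * (z * w ^ 2) by
      linear_combination w ^ 2 * hw]
    exact add_mem (add_mem (add_mem (hs _ m2) (hs _ hw3)) (hs _ hw4)) (hs _ hzw2)
  have hz3 : z ^ 3 ∈ B := by
    have h33 : κ (1 / 3) * 3 = 1 := by
      rw [← map_ofNat κ 3, ← map_mul]; norm_num
    rw [show z ^ 3 = κ (1 / 3) * (κ a * (z * w) + κ b * (z * w ^ 2) - z * w ^ 3) by
      linear_combination κ (1 / 3) * z * hz - z ^ 3 * h33]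
    exact hs _ (sub_mem (add_mem (hs _ hzw) (hs _ hzw2)) hzw3)
  constructor <;> refine mem_stabilizerAlgebra_span fun j => ?_ <;> fin_cases j <;> dsimp
  · rw [mul_one]; exact m3
  · exact hzw
  · exact hzw2
  · rw [← pow_two]; exact m4
  · rw [← pow_succ']; exact hz3
  · rw [mul_one]; exact m1
  · rw [← pow_two]; exact m2
  · rw [← pow_succ']; exact hw3
  · exact mul_comm _ w ▸ hzw
  · exact mul_comm _ w ▸ hz2w

end

section
variable {A : Type*} [CommRing A] [Algebra ℂ A]

theorem algebraMap_inv_mul_ofNat (n : ℕ) [n.AtLeastTwo] :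
    algebraMap ℂ A (1 / OfNat.ofNat n) * OfNat.ofNat n = 1 := by
  rw [← map_ofNat (algebraMap ℂ A) n, ← map_mul, one_div, inv_mul_cancel₀, map_one]
  exact OfNat.ofNat_ne_zero n

end

theorem offZeroMilnor_II4_le (l : Fin 4 → ℂ) : offZeroMilnor
    (detFun (matII (X ^ 2 + C (l 1) * X + C (l 0)) (C (l 3) * X + C (l 2)))) ≤ (4 : ℕ) := by
  refine offZeroMilnor_matII_le fun K z w h1 h2 => ⟨![1, z, w, z * w],
    Submodule.subset_span ⟨0, rfl⟩, ?_⟩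
  simp at h1 h2
  have h3 := algebraMap_inv_mul_ofNat (A := MvPolynomial (Fin 4) ℂ ⧸ K) 3
  have h5 := algebraMap_inv_mul_ofNat (A := MvPolynomial (Fin 4) ℂ ⧸ K) 5
  -- The operator `p ↦ p + 2wp'` multiplies `wⁱ` by `2i + 1`, hence the factors 1, 3, 5; the last
  -- coefficient comes from `-2zq'`. Division by the leading coefficient gives the table.
  refine stabilizer_table_II4 (a := -(1 / 3) * l 2) (b := -(1 / 3) * l 3) (d := -(1 / 5) * l 0)
    (e := -(1 / 5) * (3 * l 1)) (f := (1 / 5) * (2 * l 3)) ?_ ?_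
  · simp only [map_mul, map_neg]
    linear_combination algebraMap ℂ (MvPolynomial (Fin 4) ℂ ⧸ K) (1 / 3) * h1 - z ^ 2 * h3
  · simp only [map_mul, map_neg, map_ofNat]
    linear_combination algebraMap ℂ (MvPolynomial (Fin 4) ℂ ⧸ K) (1 / 5) * h2 - w ^ 2 * h5

theorem offZeroMilnor_II5_le (l : Fin 5 → ℂ) : offZeroMilnor
    (detFun (matII (C (l 2) * X ^ 2 + C (l 1) * X + C (l 0)) (X ^ 2 + C (l 4) * X + C (l 3))))
      ≤ (5 : ℕ) := by
  refine offZeroMilnor_matII_le fun K z w h1 h2 => ⟨![1, w, w ^ 2, z, z ^ 2],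
    Submodule.subset_span ⟨0, rfl⟩, ?_⟩
  simp at h1 h2
  have h4 := algebraMap_inv_mul_ofNat (A := MvPolynomial (Fin 4) ℂ ⧸ K) 4
  refine stabilizer_table_II5 (a := -l 3) (b := -l 4) (d := (1 / 4) * l 0)
    (e := (1 / 4) * (3 * l 1)) (f := (1 / 4) * (5 * l 2)) (g := -(1 / 4) * (2 * l 4)) ?_ ?_
  · simp only [map_neg]
    linear_combination h1
  · simp only [map_mul, map_neg, map_ofNat]
    linear_combination -algebraMap ℂ (MvPolynomial (Fin 4) ℂ ⧸ K) (1 / 4) * h2 - z * w * h4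

theorem offZeroMilnor_II6_le (l : Fin 6 → ℂ) : offZeroMilnor
    (detFun (matII (X ^ 3 + C (l 2) * X ^ 2 + C (l 1) * X + C (l 0))
      (C (l 5) * X ^ 2 + C (l 4) * X + C (l 3)))) ≤ (6 : ℕ) := by
  refine offZeroMilnor_matII_le fun K z w h1 h2 => ⟨![1, w, w ^ 2, z, z * w, z * w ^ 2],
    Submodule.subset_span ⟨0, rfl⟩, ?_⟩
  simp at h1 h2
  rw [map_ofNat] at h2
  have h3 := algebraMap_inv_mul_ofNat (A := MvPolynomial (Fin 4) ℂ ⧸ K) 3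
  have h7 := algebraMap_inv_mul_ofNat (A := MvPolynomial (Fin 4) ℂ ⧸ K) 7
  refine stabilizer_table_II6 (a := -(1 / 3) * l 3) (b := -(1 / 3) * l 4) (c := -(1 / 3) * l 5)
    (d := -(1 / 7) * l 0) (e := -(1 / 7) * (3 * l 1)) (f := -(1 / 7) * (5 * l 2))
    (g := (1 / 7) * (2 * l 4)) (h := (1 / 7) * (4 * l 5)) ?_ ?_
  · simp only [map_mul, map_neg]
    linear_combination algebraMap ℂ (MvPolynomial (Fin 4) ℂ ⧸ K) (1 / 3) * h1 - z ^ 2 * h3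
  · simp only [map_mul, map_neg, map_ofNat]
    linear_combination algebraMap ℂ (MvPolynomial (Fin 4) ℂ ⧸ K) (1 / 7) * h2 - w ^ 3 * h7

/-! ### The families of type `I` -/

/-- The symmetric matrix families of type `I`. -/
def matI (P : ℂ[X]) (μ : ℂ) (u : Fin 4 → ℂ) : Matrix (Fin 3) (Fin 3) ℂ :=
  !![u 0, μ, u 2;
     μ, u 1 + P.eval (u 0), u 3;
     u 2, u 3, u 1]

section
variable (P : ℂ[X]) (μ : ℂ)

theorem detFun_matI (u : Fin 4 → ℂ) : detFun (matI P μ) u =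
    u 0 * (u 1 * (u 1 + P.eval (u 0)) - u 3 ^ 2) - μ ^ 2 * u 1 + 2 * μ * (u 2 * u 3)
      - u 2 ^ 2 * (u 1 + P.eval (u 0)) := by
  rw [detFun, matI, Matrix.det_fin_three]
  simp
  ring

theorem hasFDerivAt_detFun_matI (u : Fin 4 → ℂ) :
    HasFDerivAt (detFun (matI P μ))
      ((u 1 * (u 1 + P.eval (u 0)) - u 3 ^ 2 + P.derivative.eval (u 0) * (u 0 * u 1 - u 2 ^ 2)) •
        (ContinuousLinearMap.proj 0 : (Fin 4 → ℂ) →L[ℂ] ℂ)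
      + (u 0 * (2 * u 1 + P.eval (u 0)) - μ ^ 2 - u 2 ^ 2) •
        (ContinuousLinearMap.proj 1 : (Fin 4 → ℂ) →L[ℂ] ℂ)
      + (2 * (μ * u 3 - u 2 * (u 1 + P.eval (u 0)))) •
        (ContinuousLinearMap.proj 2 : (Fin 4 → ℂ) →L[ℂ] ℂ)
      + (2 * (μ * u 2 - u 0 * u 3)) •
        (ContinuousLinearMap.proj 3 : (Fin 4 → ℂ) →L[ℂ] ℂ)) u := by
  have h : detFun (matI P μ) = _ := funext (detFun_matI P μ)
  rw [h]
  have hx := hasFDerivAt_coord 0 u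
  have hy := hasFDerivAt_coord 1 u
  have hz := hasFDerivAt_coord 2 u
  have hw := hasFDerivAt_coord 3 u
  have hp := hy.fun_add (hasFDerivAt_eval_coord P 0 u)
  refine ((((hx.fun_mul ((hy.fun_mul hp).fun_sub (hw.pow 2))).fun_sub (hy.const_mul (μ ^ 2))).fun_add
    ((hz.fun_mul hw).const_mul (2 * μ))).fun_sub ((hz.pow 2).fun_mul hp)).congr_fderiv ?_
  ext t
  simp
  ring

theorem isCrit_detFun_matI (u : Fin 4 → ℂ) : IsCrit (detFun (matI P μ)) u ↔
    u 1 * (u 1 + P.eval (u 0)) - u 3 ^ 2 + P.derivative.eval (u 0) * (u 0 * u 1 - u 2 ^ 2) = 0 ∧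
    u 0 * (2 * u 1 + P.eval (u 0)) - μ ^ 2 - u 2 ^ 2 = 0 ∧
    μ * u 3 - u 2 * (u 1 + P.eval (u 0)) = 0 ∧
    μ * u 2 - u 0 * u 3 = 0 := by
  rw [isCrit_iff]
  simp [Fin.forall_fin_succ, (hasFDerivAt_detFun_matI P μ u).fderiv]

end

/-- The algebraic consequences of the equations for the critical points of a determinant of type
`I` outside its zero level. -/
theorem relations_of_crit_I {A : Type*} [CommRing A] {x y z w P P' μ D : A}
    (hD : D = x * (y * (y + P) - w ^ 2) - μ ^ 2 * y + 2 * μ * (z * w) - z ^ 2 * (y + P))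
    (hcancel : ∀ g, D * g = 0 → g = 0)
    (h0 : y * (y + P) - w ^ 2 + P' * (x * y - z ^ 2) = 0)
    (h1 : x * (2 * y + P) - μ ^ 2 - z ^ 2 = 0)
    (h2 : μ * w - z * (y + P) = 0)
    (h3 : μ * z - x * w = 0) :
    z = 0 ∧ w = 0 ∧ y + P + x * P' = 0 ∧ x * (P + 2 * (x * P')) + μ ^ 2 = 0 := by
  -- Again `adj(adj M) = D·M`. The cofactors satisfy `n₀₂ = n₁₂ = 0`, `n₂₂ = -n₁₁`, `n₀₀ = -P'n₁₁`,
  -- whence `Dz = Dw = 0`, `Dx = -n₁₁²` and `D(y + P) = P'n₁₁² = -P'·Dx`.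
  have hz : z = 0 := hcancel _ (by
    rw [hD]; linear_combination (z * w - μ * y) * h3 - (x * y - z ^ 2) * h2)
  have hw : w = 0 := hcancel _ (by
    rw [hD]; linear_combination (z * w - μ * y) * h2 - (y * (y + P) - w ^ 2) * h3)
  subst hz hw
  have hy : y + P + x * P' = 0 := hcancel _ (by
    rw [hD]; linear_combination (x * (y + P) - μ ^ 2) * h0)
  exact ⟨rfl, rfl, hy, by linear_combination 2 * x * hy - h1⟩

/-- The odd one-variable polynomial `X P(X²)`. -/
def oddPart (P : ℂ[X]) : ℂ[X] := X * P.comp (X ^ 2)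

theorem eval_oddPart (P : ℂ[X]) (a : ℂ) : (oddPart P).eval a = a * P.eval (a ^ 2) := by
  simp [oddPart]

theorem eval_derivative_oddPart (P : ℂ[X]) (a : ℂ) :
    (oddPart P).derivative.eval a
      = P.eval (a ^ 2) + 2 * (a ^ 2 * P.derivative.eval (a ^ 2)) := by
  simp [oddPart, derivative_comp]
  ring

/-- The points `±(a, c)` correspond to `x = a²`, `y = -(P + xP')`, `z = w = 0`, with `μ = -ac`. The
odd function takes the value `-2ay` there, and the determinant is `-xy²`. -/
theorem nonzeroCritValues_matI (P : ℂ[X]) (μ v : ℂ) :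
    v ∈ nonzeroCritValues (detFun (matI P μ)) ↔
      ∃ t ∈ nonzeroCritValues (quadraticFun (oddPart P) (2 * μ)), v = -(1 / 4) * t ^ 2 := by
  constructor
  · rintro ⟨hv, u, hu, rfl⟩
    rw [isCrit_detFun_matI] at hu
    obtain ⟨h0, h1, h2, h3⟩ := hu
    obtain ⟨e1, e2, e3, e4⟩ := relations_of_crit_I (detFun_matI P μ u)
      (fun g hg => (mul_eq_zero.1 hg).resolve_left hv) h0 h1 h2 h3
    obtain ⟨a, ha⟩ := IsAlgClosed.exists_pow_nat_eq (u 0) (n := 2) two_pos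
    have hdet := detFun_matI P μ u
    have hdet' : detFun (matI P μ) u = -(u 0 * u 1 ^ 2) := by
      rw [hdet, e1, e2]
      linear_combination u 1 * h1 + u 1 * u 2 * e1
    -- The non-vanishing of the determinant `-xy²` allows `c = -μ/a`.
    have ha0 : a ≠ 0 := by
      rintro rfl
      apply hv
      rw [hdet', ← ha]
      ring
    have hμ : μ ^ 2 = -(a ^ 2 * (P.eval (a ^ 2) + 2 * (a ^ 2 * P.derivative.eval (a ^ 2)))) := by
      rw [ha]; linear_combination e4
    have hy : u 1 = -(P.eval (a ^ 2) + a ^ 2 * P.derivative.eval (a ^ 2)) := by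
      rw [ha]; linear_combination e3
    have hf : quadraticFun (oddPart P) (2 * μ) ![a, -μ / a] = -2 * a * u 1 := by
      simp only [quadraticFun, eval_oddPart, Matrix.cons_val]
      rw [hy]
      field_simp
      linear_combination -hμ
    have hval : detFun (matI P μ) u
        = -(1 / 4) * quadraticFun (oddPart P) (2 * μ) ![a, -μ / a] ^ 2 := by
      rw [hf, hdet', ← ha]
      ring
    refine ⟨_, ⟨?_, ![a, -μ / a], ?_, rfl⟩, hval⟩
    · intro h
      rw [h] at hval
      exact hv (by rw [hval]; ring)
    · rw [isCrit_quadraticFun, eval_derivative_oddPart]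
      simp only [Matrix.cons_val]
      constructor
      · field_simp
        linear_combination hμ
      · field_simp
        ring
  · rintro ⟨t, ⟨ht, r, hr, rfl⟩, rfl⟩
    rw [isCrit_quadraticFun, eval_derivative_oddPart] at hr
    have hμ : μ = -(r 0 * r 1) := by linear_combination hr.2 / 2
    have hP : P.eval (r 0 ^ 2) = -r 1 ^ 2 - 2 * (r 0 ^ 2 * P.derivative.eval (r 0 ^ 2)) := by
      linear_combination hr.1
    refine ⟨mul_ne_zero (by norm_num) (pow_ne_zero 2 ht),
      ![r 0 ^ 2, -(P.eval (r 0 ^ 2) + r 0 ^ 2 * P.derivative.eval (r 0 ^ 2)), 0, 0], ?_, ?_⟩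
    · rw [isCrit_detFun_matI]
      simp only [Matrix.cons_val]
      rw [hP, hμ]
      refine ⟨?_, ?_, ?_, ?_⟩ <;> ring
    · rw [detFun_matI, quadraticFun, eval_oddPart]
      simp only [Matrix.cons_val]
      rw [hP, hμ]
      ring

/-- Division with remainder by the monic multiple of `R` brings every power of `x` into the span of
the first `n` powers. -/
theorem stabilizer_of_aeval_eq_zero {A : Type*} [CommRing A] [Algebra ℂ A] {x : A} {R : ℂ[X]}
    {n : ℕ} (hR : R ≠ 0) (hn : R.natDegree ≤ n) (hx : aeval x R = 0) :
    x ∈ stabilizerAlgebra (Submodule.span ℂ (Set.range fun i : Fin n => x ^ (i : ℕ))) := by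
  have hpow : ∀ j, x ^ j ∈ Submodule.span ℂ (Set.range fun i : Fin n => x ^ (i : ℕ)) := by
    intro j
    have hmod : aeval x (X ^ j %ₘ (R * C R.leadingCoeff⁻¹)) = x ^ j := by
      have h := congrArg (aeval x) (modByMonic_add_div (X ^ j) (R * C R.leadingCoeff⁻¹))
      simpa [hx] using h
    by_cases hj : X ^ j %ₘ (R * C R.leadingCoeff⁻¹) = 0
    · rw [← hmod, hj, map_zero]
      exact Submodule.zero_mem _
    rw [← hmod, aeval_eq_sum_range' (n := n)]
    · refine Submodule.sum_mem _ fun i hi => Submodule.smul_mem _ _ (Submodule.subset_span ?_)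
      exact ⟨⟨i, Finset.mem_range.1 hi⟩, rfl⟩
    · have hdeg := degree_modByMonic_lt (X ^ j) (monic_mul_leadingCoeff_inv hR)
      rw [degree_mul_leadingCoeff_inv R hR] at hdeg
      exact (natDegree_lt_natDegree hj hdeg).trans_le hn
  refine mem_stabilizerAlgebra_span fun j => ?_
  rw [← pow_succ']
  exact hpow _

/-- By `relations_of_crit_I` the coordinates `z`, `w` vanish and `y` is a polynomial in `x`, so the
quotient is generated by `x`, which is a root of the displayed polynomial. -/
theorem offZeroMilnor_matI_le {P : ℂ[X]} {μ : ℂ} {n : ℕ} (hn0 : 0 < n)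
    (hR : X * (P + 2 * (X * P.derivative)) + C (μ ^ 2) ≠ 0)
    (hn : (X * (P + 2 * (X * P.derivative)) + C (μ ^ 2)).natDegree ≤ n) :
    offZeroMilnor (detFun (matI P μ)) ≤ n := by
  refine offZeroMilnor_le fun S hS => ?_
  set f := detFun (matI P μ) with hf
  let K : Ideal (MvPolynomial (Fin 4) ℂ) := ⨅ r ∈ S, polynomialJacobian f r
  have hK : ∀ g, g ∈ K ↔ ∀ r ∈ S, g ∈ polynomialJacobian f r := by
    intro g
    simp [K, Submodule.mem_iInf]
  let x : MvPolynomial (Fin 4) ℂ := MvPolynomial.X 0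
  let y : MvPolynomial (Fin 4) ℂ := MvPolynomial.X 1
  let z : MvPolynomial (Fin 4) ℂ := MvPolynomial.X 2
  let w : MvPolynomial (Fin 4) ℂ := MvPolynomial.X 3
  let m : MvPolynomial (Fin 4) ℂ := algebraMap ℂ _ μ
  let D := x * (y * (y + aeval x P) - w ^ 2) - m ^ 2 * y + 2 * m * (z * w)
    - z ^ 2 * (y + aeval x P)
  have hD : ∀ u, MvPolynomial.eval u D = f u := by
    intro u
    simp [D, x, y, z, w, m, hf, detFun_matI, eval_aeval_X]
  have hcancel : ∀ g : MvPolynomial (Fin 4) ℂ ⧸ K, Ideal.Quotient.mk K D * g = 0 → g = 0 := by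
    intro g hg
    obtain ⟨g, rfl⟩ := Ideal.Quotient.mk_surjective g
    rw [← map_mul, Ideal.Quotient.eq_zero_iff_mem, hK] at hg
    rw [Ideal.Quotient.eq_zero_iff_mem, hK]
    exact fun r hr => polynomialJacobian_cancel hD (hS r hr).2 (hg r hr)
  have hpartial : ∀ (d : MvPolynomial (Fin 4) ℂ) (i : Fin 4),
      (∀ u, MvPolynomial.eval u d = fderiv ℂ f u (Pi.single i 1)) →
      Ideal.Quotient.mk K d = 0 := by
    intro d i hd
    rw [Ideal.Quotient.eq_zero_iff_mem, hK]
    exact fun r _ => partial_mem_polynomialJacobian i hd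
  have hae : ∀ P : ℂ[X], Ideal.Quotient.mk K (aeval x P) = aeval (Ideal.Quotient.mk K x) P :=
    fun P => (Polynomial.aeval_algHom_apply (Ideal.Quotient.mkₐ ℂ K) x P).symm
  have h0 := hpartial (y * (y + aeval x P) - w ^ 2 + aeval x P.derivative * (x * y - z ^ 2)) 0
    fun u => by
      simp [x, y, z, w, hf, (hasFDerivAt_detFun_matI P μ u).fderiv, eval_aeval_X]
  have h1 := hpartial (x * (2 * y + aeval x P) - m ^ 2 - z ^ 2) 1 fun u => by
    simp [x, y, z, m, hf, (hasFDerivAt_detFun_matI P μ u).fderiv, eval_aeval_X]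
  have h2 := hpartial (2 * (m * w - z * (y + aeval x P))) 2 fun u => by
    simp [x, y, z, w, m, hf, (hasFDerivAt_detFun_matI P μ u).fderiv, eval_aeval_X]
  have h3 := hpartial (2 * (m * z - x * w)) 3 fun u => by
    simp [x, z, w, m, hf, (hasFDerivAt_detFun_matI P μ u).fderiv]
  have hhalf : ∀ g : MvPolynomial (Fin 4) ℂ, Ideal.Quotient.mk K (2 * g) = 0 →
      Ideal.Quotient.mk K g = 0 := by
    intro g hg
    have h22 := algebraMap_inv_mul_ofNat (A := MvPolynomial (Fin 4) ℂ ⧸ K) 2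
    rw [map_mul, map_ofNat] at hg
    linear_combination (algebraMap ℂ (MvPolynomial (Fin 4) ℂ ⧸ K) (1 / 2)) * hg
      - Ideal.Quotient.mk K g * h22
  replace h2 := hhalf _ h2
  replace h3 := hhalf _ h3
  simp only [map_add, map_sub, map_mul, map_pow, map_ofNat, hae] at h0 h1 h2 h3
  obtain ⟨e1, e2, e3, e4⟩ := relations_of_crit_I (D := Ideal.Quotient.mk K D)
    (by simp only [D, map_add, map_sub, map_mul, map_pow, map_ofNat, hae]) hcancel h0 h1 h2 h3
  have hxT := stabilizer_of_aeval_eq_zero (x := Ideal.Quotient.mk K x) hR hn (by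
    have hm : algebraMap ℂ (MvPolynomial (Fin 4) ℂ ⧸ K) μ = Ideal.Quotient.mk K m := rfl
    simp only [map_add, map_mul, aeval_X, aeval_C, map_pow, map_ofNat, hm]
    exact e4)
  have h1v : (1 : MvPolynomial (Fin 4) ℂ ⧸ K) ∈ Submodule.span ℂ
      (Set.range fun i : Fin n => Ideal.Quotient.mk K x ^ (i : ℕ)) :=
    Submodule.subset_span ⟨⟨0, hn0⟩, pow_zero _⟩
  set T := stabilizerAlgebra
    (Submodule.span ℂ (Set.range fun i : Fin n => Ideal.Quotient.mk K x ^ (i : ℕ)))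
  have hyT : Ideal.Quotient.mk K y ∈ T := by
    rw [show Ideal.Quotient.mk K y = -(aeval (Ideal.Quotient.mk K x) P
      + Ideal.Quotient.mk K x * aeval (Ideal.Quotient.mk K x) P.derivative) by
        linear_combination e3]
    exact neg_mem (add_mem (aeval_mem_subalgebra T hxT _)
      (mul_mem hxT (aeval_mem_subalgebra T hxT _)))
  obtain ⟨hfin, hrank⟩ := finrank_le_of_stabilizer h1v (by
    intro i
    fin_cases i
    · exact hxT
    · exact hyT
    · exact e1 ▸ zero_mem T
    · exact e2 ▸ zero_mem T)
  exact ⟨K, hfin, hrank, fun r hr => iInf₂_le r hr⟩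

/-- The polynomial `P_λ` of the deformations of type `I`. -/
def polyI (k : ℕ) (l : Fin (k + 1) → ℂ) : ℂ[X] :=
  X ^ k + ∑ i : Fin k, C (l i.castSucc) * X ^ (i : ℕ)

theorem natDegree_polyI_le (k : ℕ) (l : Fin (k + 1) → ℂ) : (polyI k l).natDegree ≤ k := by
  refine (natDegree_add_le _ _).trans (max_le (natDegree_X_pow_le k) ?_)
  exact natDegree_sum_le_of_forall_le _ _ fun i _ =>
    (natDegree_C_mul_X_pow_le _ _).trans i.2.le

theorem coeff_polyI (k : ℕ) (l : Fin (k + 1) → ℂ) : (polyI k l).coeff k = 1 := by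
  have : ∀ i : Fin k, k ≠ (i : ℕ) := fun i => i.2.ne'
  simp [polyI, coeff_X_pow, this]

theorem offZeroMilnor_I_le {k : ℕ} (l : Fin (k + 1) → ℂ) (μ : ℂ) :
    offZeroMilnor (detFun (matI (polyI k l) μ)) ≤ (k + 1 : ℕ) := by
  have hP := natDegree_polyI_le k l
  refine offZeroMilnor_matI_le k.succ_pos ?_ ?_
  -- The coefficient of `X^(k+1)` is `1 + 2k`.
  · intro h
    have h1 := congrArg (fun q : ℂ[X] => q.coeff (k + 1)) h
    have h2 : (X * (polyI k l).derivative).coeff k = (k : ℂ) := by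
      cases k with
      | zero => simp
      | succ j => rw [coeff_X_mul, coeff_derivative, coeff_polyI]; simp
    rw [show (2 : ℂ[X]) = C 2 from rfl] at h1
    simp only [coeff_add, coeff_X_mul, coeff_C_succ, coeff_C_mul, coeff_polyI, h2, coeff_zero] at h1
    have h3 : ((1 + 2 * k : ℕ) : ℂ) ≠ 0 := Nat.cast_ne_zero.2 (by omega)
    apply h3
    push_cast
    linear_combination h1
  · rw [natDegree_add_C]
    refine natDegree_mul_le.trans ?_
    rw [natDegree_X, add_comm]
    refine Nat.add_le_add_right ((natDegree_add_le _ _).trans (max_le hP ?_)) 1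
    rw [show (2 : ℂ[X]) = C 2 from rfl]
    refine (natDegree_C_mul_le _ _).trans ?_
    by_cases h0 : (polyI k l).natDegree = 0
    · rw [derivative_of_natDegree_zero h0]; simp
    · refine natDegree_mul_le.trans ?_
      have := natDegree_derivative_lt h0
      rw [natDegree_X]
      omega

theorem matrixDefI_eq (k : ℕ) (l : Fin (k + 1) → ℂ) :
    matrixDefI k l = matI (polyI k l) (l (Fin.last k)) := by
  funext u
  simp [matrixDefI, matI, polyI, eval_finsetSum]

theorem oddPart_polyI (k : ℕ) (l : Fin (k + 1) → ℂ) : oddPart (polyI k l) = oddPolyI k l := by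
  simp only [oddPart, polyI, oddPolyI, add_comp, X_pow_comp, mul_add, Polynomial.sum_comp, C_mul_comp,
    Finset.mul_sum]
  congr 1
  · ring
  · exact Finset.sum_congr rfl fun i _ => by ring

/-! ### The biholomorphisms of the bases -/

/-- The diagonal linear automorphism with the non-zero entries `d`. -/
def diagScale {n : ℕ} (d : Fin n → ℂ) (hd : ∀ i, d i ≠ 0) : (Fin n → ℂ) ≃L[ℂ] (Fin n → ℂ) :=
  ContinuousLinearEquiv.piCongrRight fun i =>
    ContinuousLinearEquiv.unitsEquivAut ℂ (Units.mk0 (d i) (hd i))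

@[simp] theorem diagScale_apply {n : ℕ} (d : Fin n → ℂ) (hd : ∀ i, d i ≠ 0) (l : Fin n → ℂ)
    (i : Fin n) : diagScale d hd l i = l i * d i := rfl

theorem exists_equiv_of_linear {n : ℕ} {Θ Θ' : Set (Fin n → ℂ)}
    (L : (Fin n → ℂ) ≃L[ℂ] (Fin n → ℂ)) (h : L.toEquiv '' Θ = Θ') :
    ∃ Φ : (Fin n → ℂ) ≃ (Fin n → ℂ),
      Differentiable ℂ Φ ∧ Differentiable ℂ Φ.symm ∧ Φ 0 = 0 ∧ Φ '' Θ = Θ' :=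
  ⟨L.toEquiv, L.differentiable, L.symm.differentiable, L.map_zero, h⟩

theorem matrixDefII4_eq (l : Fin 4 → ℂ) :
    matrixDefII4 l = matII (X ^ 2 + C (l 1) * X + C (l 0)) (C (l 3) * X + C (l 2)) := by
  funext u
  simp [matrixDefII4, matII, add_assoc]

theorem matrixDefII5_eq (l : Fin 5 → ℂ) :
    matrixDefII5 l
      = matII (C (l 2) * X ^ 2 + C (l 1) * X + C (l 0)) (X ^ 2 + C (l 4) * X + C (l 3)) := by
  funext u
  simp [matrixDefII5, matII, add_assoc]

theorem matrixDefII6_eq (l : Fin 6 → ℂ) :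
    matrixDefII6 l = matII (X ^ 3 + C (l 2) * X ^ 2 + C (l 1) * X + C (l 0))
      (C (l 5) * X ^ 2 + C (l 4) * X + C (l 3)) := by
  funext u
  simp [matrixDefII6, matII, add_assoc]

theorem exists_equiv_II4 : ∃ Φ : (Fin 4 → ℂ) ≃ (Fin 4 → ℂ),
    Differentiable ℂ Φ ∧ Differentiable ℂ Φ.symm ∧ Φ 0 = 0 ∧
      Φ '' matrixFullDiagram matrixDefII4 = oddFullDiagram oddDefII4 := by
  refine exists_equiv_of_linear (ContinuousLinearEquiv.refl ℂ _)
    (image_matrixFullDiagram _ (κ := -1) (by norm_num) ?_ ?_ ?_ ?_ morse_II4)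
  · intro m v
    simp only [oddDefII4, Pi.neg_apply]
    ring
  · intro m
    rw [oddDefII4_eq]
    exact cubicFun_count (by norm_num) (natDegree_normPoly_II4 m)
  · intro l v
    rw [matrixDefII4_eq, nonzeroCritValues_matII]
    have : oddDefII4 l
        = oddII (X ^ 2 + C (l 1) * X + C (l 0)) (C (l 3) * X + C (l 2)) := by
      funext v
      simp [oddDefII4, oddII]
      ring
    rw [← this]
    rfl
  · intro l
    rw [matrixDefII4_eq]
    exact offZeroMilnor_II4_le l

theorem exists_equiv_II6 : ∃ Φ : (Fin 6 → ℂ) ≃ (Fin 6 → ℂ),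
    Differentiable ℂ Φ ∧ Differentiable ℂ Φ.symm ∧ Φ 0 = 0 ∧
      Φ '' matrixFullDiagram matrixDefII6 = oddFullDiagram oddDefII6 := by
  refine exists_equiv_of_linear (ContinuousLinearEquiv.refl ℂ _)
    (image_matrixFullDiagram _ (κ := -1) (by norm_num) ?_ ?_ ?_ ?_ morse_II6)
  · intro m v
    simp only [oddDefII6, Pi.neg_apply]
    ring
  · intro m
    rw [oddDefII6_eq]
    exact cubicFun_count (by norm_num) (natDegree_normPoly_II6 m)
  · intro l v
    rw [matrixDefII6_eq, nonzeroCritValues_matII]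
    have : oddDefII6 l = oddII (X ^ 3 + C (l 2) * X ^ 2 + C (l 1) * X + C (l 0))
        (C (l 5) * X ^ 2 + C (l 4) * X + C (l 3)) := by
      funext v
      simp [oddDefII6, oddII]
      ring
    rw [← this]
    rfl
  · intro l
    rw [matrixDefII6_eq]
    exact offZeroMilnor_II6_le l

theorem exists_equiv_II5 : ∃ Φ : (Fin 5 → ℂ) ≃ (Fin 5 → ℂ),
    Differentiable ℂ Φ ∧ Differentiable ℂ Φ.symm ∧ Φ 0 = 0 ∧
      Φ '' matrixFullDiagram matrixDefII5 = oddFullDiagram oddDefII5 := by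
  -- The matrix family leads to `b³ + bc⁴`, the normal form is `b³ - bc⁴`. The substitution `c ↦ ζc`
  -- with `ζ⁴ = -1` changes the sign and multiplies the parameter at `bⁱcʲ` by `ζʲ`.
  obtain ⟨ζ, hζ⟩ := IsAlgClosed.exists_pow_nat_eq (-1 : ℂ) (n := 4) (by norm_num)
  have hζ0 : ζ ≠ 0 := by
    rintro rfl
    norm_num at hζ
  have hd : ∀ i, (![ζ, ζ ^ 3, ζ ^ 5, 1, ζ ^ 2] : Fin 5 → ℂ) i ≠ 0 := by
    intro i
    fin_cases i <;> simp [hζ0]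
  have hd2 : ∀ i, (![1, ζ] : Fin 2 → ℂ) i ≠ 0 := by
    intro i
    fin_cases i <;> simp [hζ0]
  refine exists_equiv_of_linear (diagScale _ hd)
    (image_matrixFullDiagram _ (κ := -1) (by norm_num) ?_ ?_ ?_ ?_ morse_II5)
  · intro m v
    simp only [oddDefII5, Pi.neg_apply]
    ring
  · intro m
    rw [oddDefII5_eq]
    exact cubicFun_count (by norm_num) (natDegree_normPoly_II5 m)
  · intro l v
    rw [matrixDefII5_eq, nonzeroCritValues_matII]
    have : oddDefII5 (diagScale _ hd l) = fun v => oddII (C (l 2) * X ^ 2 + C (l 1) * X + C (l 0))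
        (X ^ 2 + C (l 4) * X + C (l 3)) (diagScale _ hd2 v) := by
      funext v
      simp [oddDefII5, oddII]
      linear_combination -(v 0 * v 1 ^ 4) * hζ
    rw [← nonzeroCritValues_comp (diagScale _ hd2), ← this]
    rfl
  · intro l
    rw [matrixDefII5_eq]
    exact offZeroMilnor_II5_le l

theorem exists_equiv_I {k : ℕ} (hk : 1 ≤ k) : ∃ Φ : (Fin (k + 1) → ℂ) ≃ (Fin (k + 1) → ℂ),
    Differentiable ℂ Φ ∧ Differentiable ℂ Φ.symm ∧ Φ 0 = 0 ∧
      Φ '' matrixFullDiagram (matrixDefI k) = oddFullDiagram (oddDefI k) := by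
  -- The odd function attached to the matrix has linear term `2λ_k c`, so the last parameter is
  -- doubled.
  have hd : ∀ i, (fun i : Fin (k + 1) => if i = Fin.last k then (2 : ℂ) else 1) i ≠ 0 := by
    intro i
    dsimp only
    split_ifs <;> norm_num
  refine exists_equiv_of_linear (diagScale _ hd)
    (image_matrixFullDiagram _ (κ := -(1 / 4)) (by norm_num) ?_ ?_ ?_ ?_ (morse_I hk))
  · intro m v
    have h : ∀ i : ℕ, (-v 0) ^ (2 * i + 1) = -v 0 ^ (2 * i + 1) := fun i =>
      Odd.neg_pow ⟨i, rfl⟩ _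
    simp only [oddDefI, Pi.neg_apply, h, mul_neg, Finset.sum_neg_distrib]
    ring
  · intro m
    rw [oddDefI_eq]
    exact quadraticFun_count (by omega) (natDegree_normPoly_I hk m)
  · intro l v
    rw [matrixDefI_eq, nonzeroCritValues_matI]
    have : oddDefI k (diagScale _ hd l)
        = quadraticFun (oddPart (polyI k l)) (2 * l (Fin.last k)) := by
      rw [oddDefI_eq, oddPart_polyI, diagScale_apply, if_pos rfl, mul_comm]
      congr 1
      simp [oddPolyI, Fin.castSucc_ne_last]
    rw [← this]
    rfl
  · intro l
    rw [matrixDefI_eq]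
    exact offZeroMilnor_I_le l _

/-! ### Odd miniversal deformations -/

/-- A nonzero polynomial vanishes at `0` to an order at most its degree. All linear independence
statements end here, after restriction to a curve. -/
theorem eq_zero_of_isBigO_pow {A : ℂ[X]} {n : ℕ} (hA : A.natDegree < n)
    (h : (fun t => A.eval t) =O[𝓝 0] fun t : ℂ => t ^ n) : A = 0 := by
  by_contra hA0
  obtain ⟨u, hu, hu0⟩ := exists_eq_pow_rootMultiplicity_mul_and_not_dvd A hA0 0
  set r := A.rootMultiplicity 0
  have hr : r < n := by
    refine lt_of_le_of_lt ?_ hA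
    rw [show r = _ from (count_roots A).symm]
    exact (Multiset.count_le_card _ _).trans (card_roots' _)
  have hu1 : u.eval 0 ≠ 0 := by rwa [dvd_iff_isRoot] at hu0
  have h1 : (fun t => u.eval t) =O[𝓝[≠] 0] fun t : ℂ => t ^ (n - r) := by
    obtain ⟨K, hK⟩ := (h.mono (nhdsWithin_le_nhds (s := {0}ᶜ))).bound
    refine Asymptotics.IsBigO.of_bound K ?_
    filter_upwards [hK, self_mem_nhdsWithin] with t ht ht0
    have ht0 : t ≠ 0 := ht0
    have hpos : 0 < ‖t ^ r‖ := norm_pos_iff.2 (pow_ne_zero _ ht0)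
    rw [hu, eval_mul, eval_pow, eval_sub, eval_X, eval_C, sub_zero, norm_mul,
      ← Nat.sub_add_cancel hr.le, pow_add, norm_mul] at ht
    rw [← mul_le_mul_iff_right₀ hpos]
    linarith
  have h2 : Filter.Tendsto (fun t : ℂ => t ^ (n - r)) (𝓝[≠] 0) (𝓝 0) := by
    have : Continuous fun t : ℂ => t ^ (n - r) := by fun_prop
    have := this.tendsto 0
    rw [zero_pow (by omega)] at this
    exact this.mono_left nhdsWithin_le_nhds
  have h3 := h1.trans_tendsto h2
  have h4 : Filter.Tendsto (fun t => u.eval t) (𝓝[≠] 0) (𝓝 (u.eval 0)) :=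
    (u.continuous.tendsto 0).mono_left nhdsWithin_le_nhds
  exact hu1 (tendsto_nhds_unique h4 h3)

theorem fderiv_neg_of_odd {p : ℕ} {f : (Fin p → ℂ) → ℂ} (hf : ∀ v, f (-v) = -f v)
    (v : Fin p → ℂ) : fderiv ℂ f (-v) = fderiv ℂ f v := by
  have h1 : f = fun v => -f (ContinuousLinearEquiv.neg ℂ v) := funext fun v => by simp [hf]
  have h2 : fderiv ℂ (fun v => f (ContinuousLinearEquiv.neg ℂ v)) v
      = (fderiv ℂ f (-v)).comp ((ContinuousLinearEquiv.neg ℂ : (Fin p → ℂ) ≃L[ℂ] _) :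
        (Fin p → ℂ) →L[ℂ] _) :=
    (ContinuousLinearEquiv.neg ℂ : (Fin p → ℂ) ≃L[ℂ] _).comp_right_fderiv
  have h3 : fderiv ℂ f v = -fderiv ℂ (fun v => f (ContinuousLinearEquiv.neg ℂ v)) v := by
    conv_lhs => rw [h1]
    rw [fderiv_fun_neg]
  rw [h3, h2]
  ext u
  simp

/-- The differential of an odd function is even, so the odd part of the vector field produces the
odd part of the function. -/
theorem InJacobian.inTangentROdd {p : ℕ} {f k : (Fin p → ℂ) → ℂ} (hf : ∀ v, f (-v) = -f v)
    (hk : InJacobian f 0 k) : InTangentROdd f fun x => (1 / 2) * (k x - k (-x)) := by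
  obtain ⟨ξ, hξ, he⟩ := hk
  have hneg : Filter.Tendsto (fun x : Fin p → ℂ => -x) (𝓝 0) (𝓝 0) := by
    simpa using (continuous_neg (G := Fin p → ℂ)).tendsto 0
  have hξ' : AnalyticAt ℂ (fun x => ξ (-x)) 0 := by
    refine AnalyticAt.fun_comp_of_eq hξ ?_ neg_zero
    exact analyticAt_id.neg
  refine ⟨fun x => (1 / 2 : ℂ) • (ξ x - ξ (-x)), analyticAt_const.fun_smul (hξ.fun_sub hξ'), ?_, ?_⟩
  · refine Filter.Eventually.of_forall fun x => ?_
    dsimp only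
    rw [neg_neg, ← smul_neg, neg_sub]
  · filter_upwards [he, hneg.eventually he] with x h1 h2
    rw [h1, h2, fderiv_neg_of_odd hf, map_smul, map_sub, smul_eq_mul]

/-- All germs are treated at once, modulo the Jacobian ideal, the `m l` and even functions. For an
odd germ the even remainder disappears when the odd part is taken. -/
theorem exists_inTangentROdd {τ N : ℕ} {f : (Fin 2 → ℂ) → ℂ} (hf : ∀ v, f (-v) = -f v)
    {m : Fin τ → (Fin 2 → ℂ) → ℂ} (hm : ∀ l v, m l (-v) = -m l v)
    (hmon : ∀ i j, Odd (i + j) → ∃ c : Fin τ → ℂ,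
      InJacobian f 0 fun x => x 0 ^ i * x 1 ^ j - ∑ l, c l * m l x)
    (hN : ∀ i, InJacobian f 0 fun x => x i ^ N)
    {g : (Fin 2 → ℂ) → ℂ} (hg : AnalyticAt ℂ g 0) (hodd : ∀ᶠ x in 𝓝 0, g (-x) = -g x) :
    ∃ c : Fin τ → ℂ, InTangentROdd f fun x => g x - ∑ l, c l * m l x := by
  let U : Submodule ℂ ((Fin 2 → ℂ) → ℂ) :=
    { carrier := {k | ∃ (c : Fin τ → ℂ) (e : (Fin 2 → ℂ) → ℂ), (∀ x, e (-x) = e x) ∧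
        InJacobian f 0 fun x => k x - ∑ l, c l * m l x - e x}
      add_mem' := by
        rintro a b ⟨c, e, he, h⟩ ⟨c', e', he', h'⟩
        refine ⟨c + c', e + e', fun x => by simp [he, he'], (h.add h').congr
          (Filter.Eventually.of_forall fun x => ?_)⟩
        simp [add_mul, Finset.sum_add_distrib]; ring
      zero_mem' := ⟨0, 0, by simp, InJacobian.zero.congr (by simp)⟩
      smul_mem' := by
        rintro r a ⟨c, e, he, h⟩
        refine ⟨r • c, r • e, fun x => by simp [he],
          (h.mul_left (analyticAt_const (v := r))).congr
          (Filter.Eventually.of_forall fun x => ?_)⟩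
        simp [mul_assoc, ← Finset.mul_sum]; ring }
  have hmem : g ∈ U := by
    refine mem_of_monomials_mem (p := 0) U ?_ ?_ N ?_ hg
    · rintro a b he ⟨c, e, heven, h⟩
      refine ⟨c, e, heven, h.congr ?_⟩
      filter_upwards [he] with x hx
      rw [hx]
    · intro α
      rcases Nat.even_or_odd (α 0 + α 1) with h | h
      · refine ⟨0, fun x => x 0 ^ α 0 * x 1 ^ α 1, fun x => ?_, InJacobian.zero.congr (by simp)⟩
        simp only [Pi.neg_apply]
        rw [neg_pow (x 0), neg_pow (x 1), mul_mul_mul_comm, ← pow_add, h.neg_one_pow, one_mul]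
      · obtain ⟨c, hc⟩ := hmon _ _ h
        exact ⟨c, 0, by simp, hc.congr (by simp)⟩
    · intro i a ha
      refine ⟨0, 0, by simp, ((hN i).mul_left ha).congr
        (Filter.Eventually.of_forall fun x => ?_)⟩
      simp [mul_comm]
  obtain ⟨c, e, he, h⟩ := hmem
  refine ⟨c, ?_⟩
  obtain ⟨ξ, h1, h2, h3⟩ := h.inTangentROdd hf
  refine ⟨ξ, h1, h2, ?_⟩
  filter_upwards [h3, hodd] with x hx hgx
  rw [← hx, hgx, he]
  simp [hm]
  ring

theorem InTangentROdd.sub {p : ℕ} {f g h : (Fin p → ℂ) → ℂ} (hg : InTangentROdd f g)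
    (hh : InTangentROdd f h) : InTangentROdd f fun x => g x - h x := by
  obtain ⟨ξ, h1, h2, h3⟩ := hg
  obtain ⟨η, k1, k2, k3⟩ := hh
  refine ⟨ξ - η, h1.sub k1, ?_, ?_⟩
  · filter_upwards [h2, k2] with x e1 e2
    simp only [Pi.sub_apply, e1, e2]
    abel
  · filter_upwards [h3, k3] with x e1 e2
    simp [e1, e2]

theorem isROddMiniversal_of_affine {τ N : ℕ} {f : (Fin 2 → ℂ) → ℂ}
    {G : (Fin τ → ℂ) → (Fin 2 → ℂ) → ℂ} {m : Fin τ → (Fin 2 → ℂ) → ℂ}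
    (hf : ∀ v, f (-v) = -f v) (hm : ∀ l v, m l (-v) = -m l v)
    (hG : ∀ l v, G l v = f v + ∑ i, l i * m i v)
    (han : ContDiff ℂ ⊤ f) (ham : ∀ l, ContDiff ℂ ⊤ (m l))
    (hmon : ∀ i j, Odd (i + j) → ∃ c : Fin τ → ℂ,
      InJacobian f 0 fun x => x 0 ^ i * x 1 ^ j - ∑ l, c l * m l x)
    (hN : ∀ i, InJacobian f 0 fun x => x i ^ N)
    (hind : ∀ c : Fin τ → ℂ, (InTangentROdd f fun x => ∑ l, c l * m l x) → c = 0) :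
    IsROddMiniversal f G where
  analytic := by
    have : ContDiff ℂ ⊤ fun q : (Fin τ → ℂ) × (Fin 2 → ℂ) => G q.1 q.2 := by
      simp only [hG]
      refine (han.comp contDiff_snd).add (ContDiff.sum fun i _ => ContDiff.mul ?_
        ((ham i).comp contDiff_snd))
      fun_prop
    exact this.contDiffAt.analyticAt
  odd := Filter.Eventually.of_forall fun q => by
    simp only [hG, hf, hm, mul_neg, Finset.sum_neg_distrib]
    ring
  start := Filter.Eventually.of_forall fun x => by simp [hG]
  basis := by
    have hderiv : ∀ l x, deriv (fun t : ℂ => G (Pi.single l t) x) 0 = m l x := by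
      intro l x
      have : (fun t : ℂ => G (Pi.single l t) x) = fun t => f x + t * m l x := by
        funext t
        rw [hG]
        congr 1
        rw [Finset.sum_eq_single l] <;> simp +contextual
      rw [this]
      simp
    intro g hg hodd
    simp only [hderiv]
    obtain ⟨c, hc⟩ := exists_inTangentROdd hf hm hmon hN hg hodd
    refine ⟨c, hc, fun c' hc' => ?_⟩
    rw [← sub_eq_zero]
    refine hind _ ?_
    obtain ⟨ξ, h1, h2, h3⟩ := hc.sub hc'
    refine ⟨ξ, h1, h2, ?_⟩
    filter_upwards [h3] with x hx
    rw [← hx]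
    simp [sub_mul]

/-! ### The odd functions `E₈/ℤ₂`, `J₁₀/ℤ₂`, `E₁₂/ℤ₂` and `D_{2k+2}/ℤ₂` -/

theorem InJacobian.monomial {f : (Fin 2 → ℂ) → ℂ} {i j i' j' : ℕ} (hi : i ≤ i') (hj : j ≤ j')
    (h : InJacobian f 0 fun x => x 0 ^ i * x 1 ^ j) :
    InJacobian f 0 fun x => x 0 ^ i' * x 1 ^ j' := by
  refine (h.mul_left (a := fun x => x 0 ^ (i' - i) * x 1 ^ (j' - j))
    (((analyticAt_coord 0 0).pow _).mul ((analyticAt_coord 1 0).pow _))).congr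
    (Filter.Eventually.of_forall fun x => ?_)
  conv_lhs => rw [← Nat.sub_add_cancel hi, ← Nat.sub_add_cancel hj, pow_add, pow_add]
  ring

theorem continuousAt_isBigO_one {E F : Type*} [NormedAddCommGroup E] [NormedAddCommGroup F]
    {f : E → F} {p : E} (hf : ContinuousAt f p) {γ : ℂ → E} (hγ : Continuous γ) (h0 : γ 0 = p) :
    (fun t => f (γ t)) =O[𝓝 0] fun _ : ℂ => (1 : ℂ) := by
  have h1 : Filter.Tendsto γ (𝓝 0) (𝓝 p) := h0 ▸ hγ.tendsto 0
  exact (hf.tendsto.comp h1).isBigO_one ℂ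

/-- An analytic map is Lipschitz near `0`. This serves to compare one vector field along two
neighbouring curves. -/
theorem analyticAt_sub_isBigO {p : ℕ} {f : (Fin p → ℂ) → (Fin p → ℂ)} (hf : AnalyticAt ℂ f 0)
    {γ δ : ℂ → Fin p → ℂ} (hγ : Continuous γ) (hγ0 : γ 0 = 0) (hδ : Continuous δ) (hδ0 : δ 0 = 0)
    (i : Fin p) :
    (fun t => f (γ t) i - f (δ t) i) =O[𝓝 0] fun t => γ t - δ t := by
  have h1 : Filter.Tendsto (fun t => (γ t, δ t)) (𝓝 0) (𝓝 ((0 : Fin p → ℂ), (0 : Fin p → ℂ))) := by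
    have := (hγ.prodMk hδ).tendsto 0
    rwa [hγ0, hδ0] at this
  have h2 := hf.hasStrictFDerivAt.isBigO_sub.comp_tendsto h1
  refine Asymptotics.IsBigO.trans ?_ h2
  refine Asymptotics.IsBigO.of_bound 1 (Filter.Eventually.of_forall fun t => ?_)
  rw [one_mul]
  exact norm_le_pi_norm (f (γ t) - f (δ t)) i

theorem isBigO_pow_mul {n m : ℕ} {h : ℂ → ℂ} (hh : h =O[𝓝 0] fun t : ℂ => t ^ m) :
    (fun t => t ^ n * h t) =O[𝓝 0] fun t : ℂ => t ^ (n + m) := by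
  simp only [pow_add]
  exact (Asymptotics.isBigO_refl _ _).mul hh

theorem isBigO_pow_of_le {n m : ℕ} (h : n ≤ m) :
    (fun t : ℂ => t ^ m) =O[𝓝 0] fun t : ℂ => t ^ n := by
  rw [← Nat.add_sub_cancel' h]
  simp only [pow_add]
  suffices hs : (fun t : ℂ => t ^ n * t ^ (m - n)) =O[𝓝 0] fun t : ℂ => t ^ (n + 0) by
    simpa using hs
  refine isBigO_pow_mul ?_
  simp only [pow_zero]
  have : Continuous fun t : ℂ => t ^ (m - n) := by fun_prop
  exact (this.tendsto 0).isBigO_one ℂ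

theorem fderiv_cubicFun_apply (Q R : ℂ[X]) (v u : Fin 2 → ℂ) :
    fderiv ℂ (cubicFun Q R) v u = (3 * v 0 ^ 2 + Q.eval (v 1)) * u 0
      + (R.derivative.eval (v 1) + v 0 * Q.derivative.eval (v 1)) * u 1 := by
  rw [(hasFDerivAt_cubicFun Q R v).fderiv]
  simp

theorem fderiv_quadraticFun_apply (A : ℂ[X]) (κ : ℂ) (v u : Fin 2 → ℂ) :
    fderiv ℂ (quadraticFun A κ) v u = (v 1 ^ 2 + A.derivative.eval (v 0)) * u 0
      + (2 * v 0 * v 1 + κ) * u 1 := by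
  rw [(hasFDerivAt_quadraticFun A κ v).fderiv]
  simp

theorem continuous_pair {a b : ℂ → ℂ} (ha : Continuous a) (hb : Continuous b) :
    Continuous fun t => (![a t, b t] : Fin 2 → ℂ) := by
  refine continuous_pi fun i => ?_
  fin_cases i
  · exact ha
  · exact hb

/-- Linear independence, modulo the tangent space to the orbit of `b³ + cⁿ⁺¹`, of the functions
`A(c) + b B(c)` with `A` and `B` of degree less than `n`. -/
theorem eq_zero_of_inTangentROdd_cubic {n : ℕ} {A B : ℂ[X]} (hA : A.natDegree < n)
    (hB : B.natDegree < n)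
    (h : InTangentROdd (cubicFun 0 (X ^ (n + 1))) fun x => A.eval (x 1) + x 0 * B.eval (x 1)) :
    A = 0 ∧ B = 0 := by
  obtain ⟨ξ, hξ, -, he⟩ := h
  simp only [fderiv_cubicFun_apply, eval_zero, derivative_X_pow, eval_mul, eval_C, eval_pow,
    eval_X, derivative_zero, Nat.add_sub_cancel] at he
  -- Along `δ` the derivative in `b` vanishes, so `A(t) = O(tⁿ)` and `A = 0`. Along `γ` the
  -- `b`-derivative is `3t²ⁿ`; subtracting the identity on `δ` replaces the other component of the
  -- field by a difference of order `tⁿ`. Thus `tⁿB(t) = O(t²ⁿ)`.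
  let γ : ℂ → Fin 2 → ℂ := fun t => ![t ^ n, t]
  let δ : ℂ → Fin 2 → ℂ := fun t => ![0, t]
  have hγ : Continuous γ := continuous_pair (by fun_prop) continuous_id
  have hδ : Continuous δ := continuous_pair continuous_const continuous_id
  have hγ0 : γ 0 = 0 := by
    funext i; fin_cases i <;> simp [γ, show n ≠ 0 by omega]
  have hδ0 : δ 0 = 0 := by
    funext i; fin_cases i <;> simp [δ]
  have e1 := (hδ0 ▸ hδ.tendsto 0 : Filter.Tendsto δ (𝓝 0) (𝓝 0)).eventually he
  have e2 := (hγ0 ▸ hγ.tendsto 0 : Filter.Tendsto γ (𝓝 0) (𝓝 0)).eventually he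
  have hc : ∀ i, ContinuousAt (fun x => ξ x i) 0 := fun i =>
    (continuous_apply i).continuousAt.comp hξ.continuousAt
  have hA0 : A = 0 := by
    refine eq_zero_of_isBigO_pow hA ?_
    have h1 : (fun t => ((n + 1 : ℕ) : ℂ) * ξ (δ t) 1) =O[𝓝 0] fun t : ℂ => t ^ 0 := by
      simp only [pow_zero]
      exact (continuousAt_isBigO_one (hc 1) hδ hδ0).const_mul_left _
    refine (isBigO_pow_mul (n := n) h1).congr' ?_ Filter.EventuallyEq.rfl
    filter_upwards [e1] with t ht
    simp [δ] at ht
    rw [ht]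
    simp [δ]
    ring
  refine ⟨hA0, ?_⟩
  subst hA0
  refine (mul_eq_zero.1 (?_ : X ^ n * B = 0)).resolve_left (pow_ne_zero n X_ne_zero)
  refine eq_zero_of_isBigO_pow (n := n + n) ?_ ?_
  · refine natDegree_mul_le.trans_lt ?_
    rw [natDegree_X_pow]
    omega
  · have h0 : (fun t => 3 * ξ (γ t) 0) =O[𝓝 0] fun t : ℂ => t ^ 0 := by
      simp only [pow_zero]
      exact (continuousAt_isBigO_one (hc 0) hγ hγ0).const_mul_left _
    have h1 : (fun t => ((n + 1 : ℕ) : ℂ) * (ξ (γ t) 1 - ξ (δ t) 1)) =O[𝓝 0]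
        fun t : ℂ => t ^ n := by
      refine ((analyticAt_sub_isBigO hξ hγ hγ0 hδ hδ0 1).trans ?_).const_mul_left _
      refine Asymptotics.IsBigO.of_bound 1 (Filter.Eventually.of_forall fun t => ?_)
      rw [one_mul, pi_norm_le_iff_of_nonneg (norm_nonneg _)]
      intro i
      fin_cases i <;> simp [γ, δ]
    have h2 := (isBigO_pow_mul (n := n + n) h0).add (isBigO_pow_mul (n := n) h1)
    refine h2.congr' ?_ Filter.EventuallyEq.rfl
    filter_upwards [e1, e2] with t h3 h4
    simp only [γ, δ, Matrix.cons_val, eval_zero] at h3 h4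
    push_cast at h3 h4
    simp only [eval_mul, eval_pow, eval_X]
    simp only [γ, δ]
    push_cast
    linear_combination h3 - h4

theorem cubic_pow_mem {n : ℕ} :
    (InJacobian (cubicFun 0 (X ^ (n + 1))) 0 fun x => x 0 ^ 2 * x 1 ^ 0) ∧
    InJacobian (cubicFun 0 (X ^ (n + 1))) 0 fun x => x 0 ^ 0 * x 1 ^ n := by
  constructor
  · refine InJacobian.of_mul (a := fun _ => 3) analyticAt_const (by norm_num)
      ((InJacobian.partial_mem _ 0 0).congr (Filter.Eventually.of_forall fun x => ?_))
    rw [fderiv_cubicFun_zero]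
    simp
  · refine InJacobian.of_mul (a := fun _ => ((n + 1 : ℕ) : ℂ)) analyticAt_const
      (Nat.cast_ne_zero.2 n.succ_ne_zero)
      ((InJacobian.partial_mem _ 0 1).congr (Filter.Eventually.of_forall fun x => ?_))
    rw [fderiv_cubicFun_one]
    simp

theorem cubicFun_pow_neg {n : ℕ} (hn : Odd (n + 1)) (v : Fin 2 → ℂ) :
    cubicFun 0 (X ^ (n + 1)) (-v) = -cubicFun 0 (X ^ (n + 1)) v := by
  simp only [cubicFun, Pi.neg_apply, eval_zero, mul_zero, add_zero, eval_pow, eval_X, hn.neg_pow]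
  ring

theorem coord_pow_mem_cubic {n N : ℕ} (h2 : 2 ≤ N) (hn : n ≤ N) (i : Fin 2) :
    InJacobian (cubicFun 0 (X ^ (n + 1))) 0 fun x => x i ^ N := by
  fin_cases i
  · exact (cubic_pow_mem.1.monomial h2 le_rfl).congr (by simp)
  · exact (cubic_pow_mem.2.monomial le_rfl hn).congr (by simp)

/-- The odd monomials used for the deformations of type `II₄`. -/
def monomialsII4 : Fin 4 → (Fin 2 → ℂ) → ℂ :=
  ![fun v => v 1, fun v => v 1 ^ 3, fun v => v 0, fun v => v 0 * v 1 ^ 2]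

theorem eq_zero_of_inTangentROdd_II4 {c : Fin 4 → ℂ}
    (hc : InTangentROdd (cubicFun 0 (X ^ (4 + 1))) fun x => ∑ l, c l * monomialsII4 l x) :
    c = 0 := by
  obtain ⟨h1, h2⟩ := eq_zero_of_inTangentROdd_cubic (n := 4)
    (A := C (c 0) * X + C (c 1) * X ^ 3) (B := C (c 2) + C (c 3) * X ^ 2)
    (by compute_degree!) (by compute_degree!) (by
      convert hc using 2 with x
      simp [monomialsII4, Fin.sum_univ_succ]
      ring)
  have a1 := congrArg (fun q : ℂ[X] => q.coeff 1) h1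
  have a3 := congrArg (fun q : ℂ[X] => q.coeff 3) h1
  have b0 := congrArg (fun q : ℂ[X] => q.coeff 0) h2
  have b2 := congrArg (fun q : ℂ[X] => q.coeff 2) h2
  simp [coeff_X_pow, coeff_C] at a1 a3 b0 b2
  funext l
  fin_cases l <;> assumption

theorem isROddMiniversal_II4 : IsROddMiniversal Family.II4.oddFun oddDefII4 := by
  have hf : Family.II4.oddFun = cubicFun 0 (X ^ (4 + 1)) := by
    funext v
    simp [Family.oddFun, cubicFun]
  rw [hf]
  refine isROddMiniversal_of_affine (N := 4) (m := monomialsII4)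
    (cubicFun_pow_neg (by decide)) ?_ ?_ ?_ ?_ ?_
    (coord_pow_mem_cubic (by norm_num) le_rfl) ?_
  · intro l v
    fin_cases l
    · exact rfl
    · exact (show Odd 3 by decide).neg_pow (v 1)
    · exact rfl
    · exact show -v 0 * (-v 1) ^ 2 = -(v 0 * v 1 ^ 2) by ring
  · intro l v
    simp [oddDefII4, cubicFun, monomialsII4, Fin.sum_univ_succ]
    ring
  · rw [← hf]
    simp only [Family.oddFun]
    fun_prop
  · intro l
    fin_cases l <;> simp [monomialsII4] <;> fun_prop
  · intro i j hij
    by_cases hi : 2 ≤ i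
    · exact ⟨0, (cubic_pow_mem.1.monomial hi (Nat.zero_le j)).congr (by simp)⟩
    by_cases hj : 4 ≤ j
    · exact ⟨0, (cubic_pow_mem.2.monomial (Nat.zero_le i) hj).congr (by simp)⟩
    have key : ∃ l, ∀ x : Fin 2 → ℂ, x 0 ^ i * x 1 ^ j = monomialsII4 l x := by
      push Not at hi hj
      interval_cases i <;> interval_cases j <;> first | (exfalso; revert hij; decide) | skip
      · exact ⟨0, fun x => by simp [monomialsII4]⟩
      · exact ⟨1, fun x => by simp [monomialsII4]⟩
      · exact ⟨2, fun x => by simp [monomialsII4]⟩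
      · exact ⟨3, fun x => by simp [monomialsII4]⟩
    obtain ⟨l, hl⟩ := key
    exact ⟨Pi.single l 1, InJacobian.zero.congr (by simp [hl, Pi.single_apply])⟩
  · exact fun c hc => eq_zero_of_inTangentROdd_II4 hc

/-- The odd monomials used for the deformations of type `II₆`. -/
def monomialsII6 : Fin 6 → (Fin 2 → ℂ) → ℂ :=
  ![fun v => v 1, fun v => v 1 ^ 3, fun v => v 1 ^ 5, fun v => v 0, fun v => v 0 * v 1 ^ 2,
    fun v => v 0 * v 1 ^ 4]

theorem eq_zero_of_inTangentROdd_II6 {c : Fin 6 → ℂ}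
    (hc : InTangentROdd (cubicFun 0 (X ^ (6 + 1))) fun x => ∑ l, c l * monomialsII6 l x) :
    c = 0 := by
  obtain ⟨h1, h2⟩ := eq_zero_of_inTangentROdd_cubic (n := 6)
    (A := C (c 0) * X + C (c 1) * X ^ 3 + C (c 2) * X ^ 5)
    (B := C (c 3) + C (c 4) * X ^ 2 + C (c 5) * X ^ 4)
    (by compute_degree!) (by compute_degree!) (by
      convert hc using 2 with x
      simp [monomialsII6, Fin.sum_univ_succ]
      ring)
  have a1 := congrArg (fun q : ℂ[X] => q.coeff 1) h1
  have a3 := congrArg (fun q : ℂ[X] => q.coeff 3) h1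
  have a5 := congrArg (fun q : ℂ[X] => q.coeff 5) h1
  have b0 := congrArg (fun q : ℂ[X] => q.coeff 0) h2
  have b2 := congrArg (fun q : ℂ[X] => q.coeff 2) h2
  have b4 := congrArg (fun q : ℂ[X] => q.coeff 4) h2
  simp [coeff_X_pow, coeff_C] at a1 a3 a5 b0 b2 b4
  funext l
  fin_cases l <;> assumption

theorem isROddMiniversal_II6 : IsROddMiniversal Family.II6.oddFun oddDefII6 := by
  have hf : Family.II6.oddFun = cubicFun 0 (X ^ (6 + 1)) := by
    funext v
    simp [Family.oddFun, cubicFun]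
  rw [hf]
  refine isROddMiniversal_of_affine (N := 6) (m := monomialsII6)
    (cubicFun_pow_neg (by decide)) ?_ ?_ ?_ ?_ ?_
    (coord_pow_mem_cubic (by norm_num) le_rfl) ?_
  · intro l v
    fin_cases l
    · exact rfl
    · exact (show Odd 3 by decide).neg_pow (v 1)
    · exact (show Odd 5 by decide).neg_pow (v 1)
    · exact rfl
    · exact show -v 0 * (-v 1) ^ 2 = -(v 0 * v 1 ^ 2) by ring
    · exact show -v 0 * (-v 1) ^ 4 = -(v 0 * v 1 ^ 4) by ring
  · intro l v
    simp [oddDefII6, cubicFun, monomialsII6, Fin.sum_univ_succ]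
    ring
  · rw [← hf]
    simp only [Family.oddFun]
    fun_prop
  · intro l
    fin_cases l <;> simp [monomialsII6] <;> fun_prop
  · intro i j hij
    by_cases hi : 2 ≤ i
    · exact ⟨0, (cubic_pow_mem.1.monomial hi (Nat.zero_le j)).congr (by simp)⟩
    by_cases hj : 6 ≤ j
    · exact ⟨0, (cubic_pow_mem.2.monomial (Nat.zero_le i) hj).congr (by simp)⟩
    have key : ∃ l, ∀ x : Fin 2 → ℂ, x 0 ^ i * x 1 ^ j = monomialsII6 l x := by
      push Not at hi hj
      interval_cases i <;> interval_cases j <;> first | (exfalso; revert hij; decide) | skip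
      · exact ⟨0, fun x => by simp [monomialsII6]⟩
      · exact ⟨1, fun x => by simp [monomialsII6]⟩
      · exact ⟨2, fun x => by simp [monomialsII6]⟩
      · exact ⟨3, fun x => by simp [monomialsII6]⟩
      · exact ⟨4, fun x => by simp [monomialsII6]⟩
      · exact ⟨5, fun x => by simp [monomialsII6]⟩
    obtain ⟨l, hl⟩ := key
    exact ⟨Pi.single l 1, InJacobian.zero.congr (by simp [hl, Pi.single_apply])⟩
  · exact fun c hc => eq_zero_of_inTangentROdd_II6 hc

theorem apply_zero_of_odd {p : ℕ} {ξ : (Fin p → ℂ) → (Fin p → ℂ)}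
    (h : ∀ᶠ x in 𝓝 0, ξ (-x) = -ξ x) : ξ 0 = 0 := by
  have h0 := h.self_of_nhds
  rw [neg_zero] at h0
  funext i
  have := congrFun h0 i
  simp only [Pi.neg_apply] at this
  simp only [Pi.zero_apply]
  linear_combination this / 2

theorem eval_isBigO_curve {p : ℕ} {ξ : (Fin p → ℂ) → (Fin p → ℂ)} (hξ : AnalyticAt ℂ ξ 0)
    (h0 : ξ 0 = 0) {γ : ℂ → Fin p → ℂ} (hγ : Continuous γ) (hγ0 : γ 0 = 0)
    (hO : γ =O[𝓝 0] fun t : ℂ => t ^ 1) (i : Fin p) :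
    (fun t => ξ (γ t) i) =O[𝓝 0] fun t : ℂ => t ^ 1 := by
  have := (analyticAt_sub_isBigO hξ hγ hγ0 (δ := fun _ => 0) continuous_const rfl i)
  simp only [h0, Pi.zero_apply, sub_zero] at this
  exact this.trans hO

/-- The odd monomials used for the deformations of type `II₅`. -/
def monomialsII5 : Fin 5 → (Fin 2 → ℂ) → ℂ :=
  ![fun v => v 1, fun v => v 1 ^ 3, fun v => v 1 ^ 5, fun v => v 0, fun v => v 0 * v 1 ^ 2]

/-- The curve `b = κc²` is a branch of the zero set of the `b`-derivative. There the tangent vector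
is `4εκ t⁵` times a component of the field, which vanishes at `0` by oddness; the total order 6
exceeds the exponents 1, 3, 5, 2, 4 of the restricted monomials. The constant `ε` is kept free
because both signs occur: `-1` for the odd normal form and `1` for the function attached to the
matrix. -/
theorem eq_zero_of_inTangentROdd_II5 {ε : ℂ} {c : Fin 5 → ℂ} (hε : ε ≠ 0)
    (h : InTangentROdd (cubicFun (C ε * X ^ 4) 0) fun x => ∑ l, c l * monomialsII5 l x) :
    c = 0 := by
  obtain ⟨ξ, hξ, ho, he⟩ := h
  have hξ0 := apply_zero_of_odd ho
  obtain ⟨κ, hκ⟩ := IsAlgClosed.exists_pow_nat_eq (-ε / 3) (n := 2) (by norm_num)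
  have hκ0 : κ ≠ 0 := by
    rintro rfl
    apply hε
    linear_combination 3 * hκ
  let γ : ℂ → Fin 2 → ℂ := fun t => ![κ * t ^ 2, t]
  have hγ : Continuous γ := continuous_pair (by fun_prop) continuous_id
  have hγ0 : γ 0 = 0 := by
    funext i; fin_cases i <;> simp [γ]
  have hO : γ =O[𝓝 0] fun t : ℂ => t ^ 1 := by
    refine Asymptotics.isBigO_pi.2 fun i => ?_
    fin_cases i
    · exact (isBigO_pow_of_le one_le_two).const_mul_left κ
    · simpa [γ] using Asymptotics.isBigO_refl (fun t : ℂ => t) (𝓝 0)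
  have e1 := (hγ0 ▸ hγ.tendsto 0 : Filter.Tendsto γ (𝓝 0) (𝓝 0)).eventually he
  have hA : C (c 0) * X + C (κ * c 3) * X ^ 2 + C (c 1) * X ^ 3 + C (κ * c 4) * X ^ 4
      + C (c 2) * X ^ 5 = 0 := by
    refine eq_zero_of_isBigO_pow (n := 6) (by compute_degree!) ?_
    have h1 := isBigO_pow_mul (n := 5)
      ((eval_isBigO_curve hξ hξ0 hγ hγ0 hO 1).const_mul_left (4 * ε * κ))
    refine h1.congr' ?_ Filter.EventuallyEq.rfl
    filter_upwards [e1] with t ht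
    rw [fderiv_cubicFun_apply] at ht
    simp [γ, monomialsII5, Fin.sum_univ_succ] at ht ⊢
    linear_combination -ht - 3 * t ^ 4 * ξ ![κ * t ^ 2, t] 0 * hκ
  have a1 := congrArg (fun q : ℂ[X] => q.coeff 1) hA
  have a2 := congrArg (fun q : ℂ[X] => q.coeff 2) hA
  have a3 := congrArg (fun q : ℂ[X] => q.coeff 3) hA
  have a4 := congrArg (fun q : ℂ[X] => q.coeff 4) hA
  have a5 := congrArg (fun q : ℂ[X] => q.coeff 5) hA
  simp only [coeff_add, coeff_C_mul, coeff_X_pow, coeff_X, coeff_zero] at a1 a2 a3 a4 a5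
  norm_num [hκ0] at a1 a2 a3 a4 a5
  funext l
  fin_cases l <;> assumption

theorem isROddMiniversal_II5 : IsROddMiniversal Family.II5.oddFun oddDefII5 := by
  have hf : Family.II5.oddFun = cubicFun (C (-1) * X ^ 4) 0 := by
    funext v
    simp [Family.oddFun, cubicFun]
    ring
  -- The generators `3b² - c⁴` and `bc³` give `b³` and `c⁷`. Among the odd monomials not divisible
  -- by `b³`, `bc³` or `c⁷`, only `b²c` is missing from the list, and it reduces to `c⁵/3`.
  have hb : InJacobian (cubicFun (C (-1) * X ^ 4) 0) 0 fun x => 3 * x 0 ^ 2 - x 1 ^ 4 :=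
    (InJacobian.partial_mem _ 0 0).congr (Filter.Eventually.of_forall fun x => by
      rw [fderiv_cubicFun_zero]; simp; ring)
  have h13 : InJacobian (cubicFun (C (-1) * X ^ 4) 0) 0 fun x => x 0 ^ 1 * x 1 ^ 3 :=
    InJacobian.of_mul (a := fun _ => -4) analyticAt_const (by norm_num)
      ((InJacobian.partial_mem _ 0 1).congr (Filter.Eventually.of_forall fun x => by
        rw [fderiv_cubicFun_one]; simp; ring))
  have h30 : InJacobian (cubicFun (C (-1) * X ^ 4) 0) 0 fun x => x 0 ^ 3 * x 1 ^ 0 :=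
    InJacobian.of_mul (a := fun _ => 3) analyticAt_const (by norm_num)
      (((hb.mul_left (analyticAt_coord 0 0)).add (h13.mul_left (analyticAt_coord 1 0))).congr
        (Filter.Eventually.of_forall fun x => by simp; ring))
  have h07 : InJacobian (cubicFun (C (-1) * X ^ 4) 0) 0 fun x => x 0 ^ 0 * x 1 ^ 7 :=
    (((hb.mul_left ((analyticAt_coord 1 0).pow 3).neg).add
      (h13.mul_left ((analyticAt_coord 0 0).const_smul (c := (3 : ℂ))))).congr
        (Filter.Eventually.of_forall fun x => by simp; ring))
  have h21 : InJacobian (cubicFun (C (-1) * X ^ 4) 0) 0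
      fun x => x 0 ^ 2 * x 1 ^ 1 - 1 / 3 * x 1 ^ 5 :=
    (hb.mul_left ((analyticAt_coord 1 0).const_smul (c := (1 / 3 : ℂ)))).congr
        (Filter.Eventually.of_forall fun x => by simp; ring)
  have hodd : ∀ n, Odd n → ∀ v : Fin 2 → ℂ, (-v 1) ^ n = -v 1 ^ n := fun n hn v => hn.neg_pow _
  have hfs : ContDiff ℂ ⊤ Family.II5.oddFun := by
    simp only [Family.oddFun]
    fun_prop
  rw [hf] at hfs ⊢
  refine isROddMiniversal_of_affine (N := 7) (m := monomialsII5) ?_ ?_ ?_ hfs ?_ ?_ ?_ ?_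
  · intro v
    simp [cubicFun]
    ring
  · intro l v
    fin_cases l
    · rfl
    · exact hodd 3 (by decide) v
    · exact hodd 5 (by decide) v
    · rfl
    · exact show -v 0 * (-v 1) ^ 2 = -(v 0 * v 1 ^ 2) by ring
  · intro l v
    simp [oddDefII5, cubicFun, monomialsII5, Fin.sum_univ_succ]
    ring
  · intro l
    fin_cases l <;> simp [monomialsII5] <;> fun_prop
  · intro i j hij
    by_cases hi : 3 ≤ i
    · exact ⟨0, (h30.monomial hi (Nat.zero_le j)).congr (by simp)⟩
    by_cases hj : 7 ≤ j
    · exact ⟨0, (h07.monomial (Nat.zero_le i) hj).congr (by simp)⟩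
    by_cases hc : 1 ≤ i ∧ 3 ≤ j
    · exact ⟨0, (h13.monomial hc.1 hc.2).congr (by simp)⟩
    have key : (∃ l, ∀ x : Fin 2 → ℂ, x 0 ^ i * x 1 ^ j = monomialsII5 l x) ∨ i = 2 ∧ j = 1 := by
      push Not at hi hj
      interval_cases i <;> interval_cases j <;>
        first | (exfalso; revert hij; decide) | (exfalso; exact hc (by decide)) | skip
      · exact .inl ⟨0, fun x => by simp [monomialsII5]⟩
      · exact .inl ⟨1, fun x => by simp [monomialsII5]⟩
      · exact .inl ⟨2, fun x => by simp [monomialsII5]⟩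
      · exact .inl ⟨3, fun x => by simp [monomialsII5]⟩
      · exact .inl ⟨4, fun x => by simp [monomialsII5]⟩
      · exact .inr ⟨rfl, rfl⟩
    obtain ⟨l, hl⟩ | ⟨rfl, rfl⟩ := key
    · exact ⟨Pi.single l 1, InJacobian.zero.congr (by simp [hl, Pi.single_apply])⟩
    · exact ⟨Pi.single 2 (1 / 3), h21.congr (by simp [Pi.single_apply, monomialsII5])⟩
  · intro i
    fin_cases i
    · exact (h30.monomial (show 3 ≤ 7 by norm_num) le_rfl).congr (by simp)
    · exact h07.congr (by simp)
  · exact fun c hc => eq_zero_of_inTangentROdd_II5 (by norm_num) hc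

/-- The odd monomials used for the deformations of type `I_{k+1}`. -/
def monomialsI (k : ℕ) : Fin (k + 1) → (Fin 2 → ℂ) → ℂ :=
  Fin.snoc (α := fun _ => (Fin 2 → ℂ) → ℂ) (fun i : Fin k => fun v => v 0 ^ (2 * (i : ℕ) + 1))
    fun v => v 1

theorem monomialsI_castSucc {k : ℕ} (i : Fin k) (v : Fin 2 → ℂ) :
    monomialsI k i.castSucc v = v 0 ^ (2 * (i : ℕ) + 1) := by
  simp [monomialsI]

theorem monomialsI_last (k : ℕ) (v : Fin 2 → ℂ) : monomialsI k (Fin.last k) v = v 1 := by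
  simp [monomialsI]

/-- The polynomials `∑ c_i Xᵉ⁽ⁱ⁾` with distinct exponents vanish only for vanishing coefficients. -/
theorem coeff_eq_zero_of_sum_eq_zero {k : ℕ} {e : ℕ → ℕ} (he : Function.Injective e)
    {c : Fin k → ℂ} (h : ∑ i, C (c i) * X ^ e i = (0 : ℂ[X])) : c = 0 := by
  funext j
  have := congrArg (fun q : ℂ[X] => q.coeff (e j)) h
  simp only [finsetSum_coeff, coeff_C_mul, coeff_X_pow, coeff_zero, he.eq_iff, Fin.val_inj] at this
  simpa using this

theorem natDegree_sum_lt {k n : ℕ} {e : ℕ → ℕ} (he : ∀ i < k, e i < n) (hn : 0 < n)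
    (c : Fin k → ℂ) : (∑ i, C (c i) * X ^ e i : ℂ[X]).natDegree < n := by
  refine (natDegree_sum_le_of_forall_le (n := n - 1) _ _ fun i _ => ?_).trans_lt (by omega)
  refine (natDegree_C_mul_X_pow_le _ _).trans ?_
  have := he i i.2
  omega

/-- On the `c`-axis the tangent vectors are `O(t²)`, which kills the coefficient of `c`; on the
`a`-axis they are `O(t^(2k))`, beyond the degrees of all the monomials `a^(2i+1)`, `i < k`. -/
theorem eq_zero_of_inTangentROdd_I {k : ℕ} (hk : 1 ≤ k) {c : Fin (k + 1) → ℂ}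
    (h : InTangentROdd (quadraticFun (X ^ (2 * k + 1)) 0) fun x => ∑ l, c l * monomialsI k l x) :
    c = 0 := by
  obtain ⟨ξ, hξ, ho, he⟩ := h
  simp only [fderiv_quadraticFun_apply, Fin.sum_univ_castSucc, monomialsI_castSucc,
    monomialsI_last] at he
  have hc : ∀ i, ContinuousAt (fun x => ξ x i) 0 := fun i =>
    (continuous_apply i).continuousAt.comp hξ.continuousAt
  have hlast : c (Fin.last k) = 0 := by
    let γ : ℂ → Fin 2 → ℂ := fun t => ![0, t]
    have hγ : Continuous γ := continuous_pair continuous_const continuous_id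
    have hγ0 : γ 0 = 0 := by
      funext i; fin_cases i <;> simp [γ]
    have e1 := (hγ0 ▸ hγ.tendsto 0 : Filter.Tendsto γ (𝓝 0) (𝓝 0)).eventually he
    have hA : C (c (Fin.last k)) * X = 0 := by
      refine eq_zero_of_isBigO_pow (n := 2) (by compute_degree!) ?_
      have h1 : (fun t => ξ (γ t) 0) =O[𝓝 0] fun t : ℂ => t ^ 0 := by
        simp only [pow_zero]
        exact continuousAt_isBigO_one (hc 0) hγ hγ0
      refine (isBigO_pow_mul (n := 2) h1).congr' ?_ Filter.EventuallyEq.rfl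
      filter_upwards [e1] with t ht
      simp [γ, show k ≠ 0 by omega] at ht ⊢
      rw [ht]
    simpa using congrArg (fun q : ℂ[X] => q.coeff 1) hA
  let γ : ℂ → Fin 2 → ℂ := fun t => ![t, 0]
  have hγ : Continuous γ := continuous_pair continuous_id continuous_const
  have hγ0 : γ 0 = 0 := by
    funext i; fin_cases i <;> simp [γ]
  have e1 := (hγ0 ▸ hγ.tendsto 0 : Filter.Tendsto γ (𝓝 0) (𝓝 0)).eventually he
  have hA : ∑ i : Fin k, C (c i.castSucc) * X ^ (2 * (i : ℕ) + 1) = 0 := by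
    refine eq_zero_of_isBigO_pow (n := 2 * k)
      (natDegree_sum_lt (e := fun i => 2 * i + 1) (fun i hi => by omega) (by omega) _) ?_
    have h1 : (fun t => ((2 * k + 1 : ℕ) : ℂ) * ξ (γ t) 0) =O[𝓝 0] fun t : ℂ => t ^ 0 := by
      simp only [pow_zero]
      exact (continuousAt_isBigO_one (hc 0) hγ hγ0).const_mul_left _
    refine (isBigO_pow_mul (n := 2 * k) h1).congr' ?_ Filter.EventuallyEq.rfl
    filter_upwards [e1] with t ht
    simp only [γ, Matrix.cons_val, hlast, derivative_X_pow, Nat.add_sub_cancel, eval_mul,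
      eval_C, eval_pow, eval_X] at ht
    simp only [eval_finsetSum, eval_mul, eval_C, eval_pow, eval_X]
    linear_combination -ht
  have h0 := coeff_eq_zero_of_sum_eq_zero (e := fun i => 2 * i + 1)
    (fun i j h => by dsimp only at h; omega) hA
  funext l
  refine Fin.lastCases hlast (fun i => ?_) l
  exact congrFun h0 i

theorem isROddMiniversal_I {k : ℕ} (hk : 1 ≤ k) :
    IsROddMiniversal (Family.I k hk).oddFun (oddDefI k) := by
  have hf : (Family.I k hk).oddFun = quadraticFun (X ^ (2 * k + 1)) 0 := by
    funext v
    simp [Family.oddFun, quadraticFun]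
  have ha : InJacobian (quadraticFun (X ^ (2 * k + 1)) 0) 0
      fun x => x 1 ^ 2 + ((2 * k + 1 : ℕ) : ℂ) * x 0 ^ (2 * k) :=
    (InJacobian.partial_mem _ 0 0).congr (Filter.Eventually.of_forall fun x => by
      rw [fderiv_quadraticFun_zero]; simp)
  have h11 : InJacobian (quadraticFun (X ^ (2 * k + 1)) 0) 0 fun x => x 0 ^ 1 * x 1 ^ 1 :=
    InJacobian.of_mul (a := fun _ => 2) analyticAt_const (by norm_num)
      ((InJacobian.partial_mem _ 0 1).congr (Filter.Eventually.of_forall fun x => by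
        rw [fderiv_quadraticFun_one]; simp; ring))
  -- Since `ac` lies in the ideal, the `a`-derivative multiplied by `a` yields `a^(2k+1)`, and
  -- multiplied by `c` yields `c³`.
  have h0k : InJacobian (quadraticFun (X ^ (2 * k + 1)) 0) 0
      fun x => x 0 ^ (2 * k + 1) * x 1 ^ 0 := by
    refine InJacobian.of_mul (a := fun _ => ((2 * k + 1 : ℕ) : ℂ)) analyticAt_const
      (Nat.cast_ne_zero.2 (Nat.succ_ne_zero _))
      (((ha.mul_left (analyticAt_coord 0 0)).add (h11.mul_left (analyticAt_coord 1 0).neg)).congr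
        (Filter.Eventually.of_forall fun x => ?_))
    simp
    ring
  have h03 : InJacobian (quadraticFun (X ^ (2 * k + 1)) 0) 0 fun x => x 0 ^ 0 * x 1 ^ 3 := by
    refine ((ha.mul_left (analyticAt_coord 1 0)).add (h11.mul_left
      (((analyticAt_coord 0 0).pow (2 * k - 1)).const_smul (c := -((2 * k + 1 : ℕ) : ℂ))))).congr
        (Filter.Eventually.of_forall fun x => ?_)
    obtain ⟨j, rfl⟩ := Nat.exists_eq_add_of_le' hk
    simp [show 2 * (j + 1) - 1 = 2 * j + 1 by omega]
    ring
  have hfs : ContDiff ℂ ⊤ (Family.I k hk).oddFun := by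
    simp only [Family.oddFun]
    fun_prop
  rw [hf] at hfs ⊢
  refine isROddMiniversal_of_affine (N := 2 * k + 1) (m := monomialsI k) ?_ ?_ ?_ hfs ?_ ?_ ?_
    fun c hc => eq_zero_of_inTangentROdd_I hk hc
  · intro v
    simp [quadraticFun, (show Odd (2 * k + 1) from ⟨k, rfl⟩).neg_pow]
    ring
  · intro l v
    refine Fin.lastCases ?_ (fun i => ?_) l
    · simp [monomialsI_last]
    · simp only [monomialsI_castSucc, Pi.neg_apply]
      exact Odd.neg_pow ⟨i, rfl⟩ _
  · intro l v
    simp [oddDefI, quadraticFun, Fin.sum_univ_castSucc, monomialsI_castSucc, monomialsI_last]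
    ring
  · intro l
    refine Fin.lastCases ?_ (fun i => ?_) l
    · simp only [monomialsI, Fin.snoc_last]
      fun_prop
    · simp only [monomialsI, Fin.snoc_castSucc]
      fun_prop
  · intro i j hij
    by_cases hi : 2 * k + 1 ≤ i
    · exact ⟨0, (h0k.monomial hi (Nat.zero_le j)).congr (by simp)⟩
    by_cases hj : 3 ≤ j
    · exact ⟨0, (h03.monomial (Nat.zero_le i) hj).congr (by simp)⟩
    by_cases hc : 1 ≤ i ∧ 1 ≤ j
    · exact ⟨0, (h11.monomial hc.1 hc.2).congr (by simp)⟩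
    have key : ∃ l, ∀ x : Fin 2 → ℂ, x 0 ^ i * x 1 ^ j = monomialsI k l x := by
      rcases Nat.eq_zero_or_pos j with rfl | hj0
      · obtain ⟨m, hm⟩ := hij
        obtain rfl : i = 2 * m + 1 := by omega
        exact ⟨(⟨m, by omega⟩ : Fin k).castSucc, fun x => by rw [monomialsI_castSucc]; simp⟩
      · obtain ⟨m, hm⟩ := hij
        exact ⟨Fin.last k, fun x => by
          rw [monomialsI_last, show i = 0 by omega, show j = 1 by omega]; simp⟩
    obtain ⟨l, hl⟩ := key
    exact ⟨Pi.single l 1, InJacobian.zero.congr (by simp [hl, Pi.single_apply])⟩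
  · intro i
    fin_cases i
    · exact h0k.congr (by simp)
    · exact (h03.monomial le_rfl (show 3 ≤ 2 * k + 1 by omega)).congr (by simp)

/-! ### Tangent spaces of symmetric matrix families -/

namespace InTangentSL

variable {s n : ℕ} {M V W : (Fin s → ℂ) → Matrix (Fin n) (Fin n) ℂ}

theorem congr (hV : InTangentSL M V) (he : ∀ᶠ x in 𝓝 0, W x = V x) : InTangentSL M W := by
  obtain ⟨ξ, A, hξ, hA, htr, h⟩ := hV
  refine ⟨ξ, A, hξ, hA, htr, ?_⟩
  filter_upwards [h, he] with x h1 h2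
  rwa [h2]

theorem add (hV : InTangentSL M V) (hW : InTangentSL M W) :
    InTangentSL M fun x => V x + W x := by
  obtain ⟨ξ, A, hξ, hA, htr, h⟩ := hV
  obtain ⟨η, B, hη, hB, htr', h'⟩ := hW
  refine ⟨fun x => ξ x + η x, fun x => A x + B x, hξ.fun_add hη,
    fun i j => (hA i j).fun_add (hB i j), ?_, ?_⟩
  · filter_upwards [htr, htr'] with x h1 h2
    rw [Matrix.trace_add, h1, h2, add_zero]
  · filter_upwards [h, h'] with x h1 h2 i j
    rw [Matrix.add_apply, h1, h2, map_add, Matrix.transpose_add, Matrix.add_mul, Matrix.mul_add]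
    simp only [Matrix.add_apply]
    ring

theorem smul {a : (Fin s → ℂ) → ℂ} (ha : AnalyticAt ℂ a 0) (hV : InTangentSL M V) :
    InTangentSL M fun x => a x • V x := by
  obtain ⟨ξ, A, hξ, hA, htr, h⟩ := hV
  refine ⟨fun x => a x • ξ x, fun x => a x • A x, ha.fun_smul hξ,
    fun i j => ha.fun_smul (hA i j), ?_, ?_⟩
  · filter_upwards [htr] with x h1
    rw [Matrix.trace_smul, h1, smul_zero]
  · filter_upwards [h] with x h1 i j
    rw [Matrix.smul_apply, h1, map_smul, Matrix.transpose_smul, Matrix.smul_mul, Matrix.mul_smul]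
    simp only [Matrix.add_apply, Matrix.smul_apply, smul_eq_mul]
    ring

theorem sub (hV : InTangentSL M V) (hW : InTangentSL M W) :
    InTangentSL M fun x => V x - W x :=
  (hV.add (hW.smul (analyticAt_const (v := -1)))).congr
    (Filter.Eventually.of_forall fun x => by rw [neg_smul, one_smul, sub_eq_add_neg])

theorem zero : InTangentSL M fun _ => 0 :=
  ⟨fun _ => 0, fun _ => 0, analyticAt_const, fun _ _ => analyticAt_const, by simp, by simp⟩

end InTangentSL

/-- The germ `V` is, modulo the tangent space, a linear combination of the germs `N l`. -/
def InTangentSpanSL {s n τ : ℕ} (M : (Fin s → ℂ) → Matrix (Fin n) (Fin n) ℂ)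
    (N : Fin τ → (Fin s → ℂ) → Matrix (Fin n) (Fin n) ℂ)
    (V : (Fin s → ℂ) → Matrix (Fin n) (Fin n) ℂ) : Prop :=
  ∃ c : Fin τ → ℂ, InTangentSL M fun x => V x - ∑ l, c l • N l x

theorem isSLMiniversal_of_affine {s n τ : ℕ} {M : (Fin s → ℂ) → Matrix (Fin n) (Fin n) ℂ}
    {F : (Fin τ → ℂ) → (Fin s → ℂ) → Matrix (Fin n) (Fin n) ℂ}
    {N : Fin τ → (Fin s → ℂ) → Matrix (Fin n) (Fin n) ℂ}
    (hF : ∀ l x, F l x = M x + ∑ i, l i • N i x)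
    (hM : ∀ i j, ContDiff ℂ ⊤ fun x => M x i j) (hN : ∀ l i j, ContDiff ℂ ⊤ fun x => N l x i j)
    (hMs : ∀ x, (M x).IsSymm) (hNs : ∀ l x, (N l x).IsSymm)
    (hspan : ∀ V : (Fin s → ℂ) → Matrix (Fin n) (Fin n) ℂ,
      (∀ i j, AnalyticAt ℂ (fun x => V x i j) 0) → (∀ᶠ x in 𝓝 0, (V x).IsSymm) →
      InTangentSpanSL M N V)
    (hind : ∀ c : Fin τ → ℂ, (InTangentSL M fun x => ∑ l, c l • N l x) → c = 0) :
    IsSLMiniversal M F where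
  analytic i j := by
    have : ContDiff ℂ ⊤ fun q : (Fin τ → ℂ) × (Fin s → ℂ) => F q.1 q.2 i j := by
      simp only [hF, Matrix.add_apply, Matrix.sum_apply, Matrix.smul_apply, smul_eq_mul]
      refine ((hM i j).comp contDiff_snd).add (ContDiff.sum fun l _ => ContDiff.mul ?_
        ((hN l i j).comp contDiff_snd))
      fun_prop
    exact this.contDiffAt.analyticAt
  symm := Filter.Eventually.of_forall fun q => by
    rw [hF, Matrix.IsSymm, Matrix.transpose_add, Matrix.transpose_sum, (hMs _).eq]
    simp only [Matrix.transpose_smul, (hNs _ _).eq]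
  start := Filter.Eventually.of_forall fun x => by simp [hF]
  basis := by
    have hderiv : ∀ l x i j, deriv (fun t : ℂ => F (Pi.single l t) x i j) 0 = N l x i j := by
      intro l x i j
      have : (fun t : ℂ => F (Pi.single l t) x i j) = fun t => M x i j + t * N l x i j := by
        funext t
        rw [hF, Finset.sum_eq_single l] <;> simp +contextual
      rw [this]
      simp
    have hof : ∀ (V : (Fin s → ℂ) → Matrix (Fin n) (Fin n) ℂ) (c : Fin τ → ℂ),
        (fun x => Matrix.of fun i j => V x i j - ∑ l, c l * N l x i j)
          = fun x => V x - ∑ l, c l • N l x := by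
      intro V c
      funext x
      ext i j
      simp [Matrix.sum_apply]
    intro V hV hs
    simp only [hderiv, hof]
    obtain ⟨c, hc⟩ := hspan V hV hs
    refine ⟨c, hc, fun c' hc' => ?_⟩
    rw [← sub_eq_zero]
    refine hind _ ((hc.sub hc').congr (Filter.Eventually.of_forall fun x => ?_))
    simp [sub_smul]

namespace InTangentSpanSL

variable {s n τ : ℕ} {M V W : (Fin s → ℂ) → Matrix (Fin n) (Fin n) ℂ}
  {N : Fin τ → (Fin s → ℂ) → Matrix (Fin n) (Fin n) ℂ}

theorem congr (hV : InTangentSpanSL M N V) (he : ∀ᶠ x in 𝓝 0, W x = V x) :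
    InTangentSpanSL M N W := by
  obtain ⟨c, hc⟩ := hV
  refine ⟨c, hc.congr ?_⟩
  filter_upwards [he] with x hx
  rw [hx]

theorem add (hV : InTangentSpanSL M N V) (hW : InTangentSpanSL M N W) :
    InTangentSpanSL M N fun x => V x + W x := by
  obtain ⟨c, hc⟩ := hV
  obtain ⟨d, hd⟩ := hW
  refine ⟨c + d, (hc.add hd).congr (Filter.Eventually.of_forall fun x => ?_)⟩
  simp only [Pi.add_apply, add_smul, Finset.sum_add_distrib]
  abel

theorem const_smul (a : ℂ) (hV : InTangentSpanSL M N V) :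
    InTangentSpanSL M N fun x => a • V x := by
  obtain ⟨c, hc⟩ := hV
  refine ⟨a • c, (hc.smul (analyticAt_const (v := a))).congr
    (Filter.Eventually.of_forall fun x => ?_)⟩
  simp [smul_sub, Finset.smul_sum, mul_smul]

theorem of_inTangentSL (hV : InTangentSL M V) : InTangentSpanSL M N V :=
  ⟨0, hV.congr (Filter.Eventually.of_forall fun x => by simp)⟩

theorem mem (l : Fin τ) : InTangentSpanSL M N (N l) :=
  ⟨Pi.single l 1, InTangentSL.zero.congr (Filter.Eventually.of_forall fun x => by
    rw [Finset.sum_eq_single l] <;> simp +contextual)⟩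

theorem sum {ι : Type*} (t : Finset ι) {V : ι → (Fin s → ℂ) → Matrix (Fin n) (Fin n) ℂ}
    (h : ∀ i ∈ t, InTangentSpanSL M N (V i)) :
    InTangentSpanSL M N fun x => ∑ i ∈ t, V i x := by
  classical
  induction t using Finset.induction_on with
  | empty => exact (of_inTangentSL InTangentSL.zero).congr (by simp)
  | insert a t ha ih =>
    refine ((h a (Finset.mem_insert_self a t)).add
      (ih fun i hi => h i (Finset.mem_insert_of_mem hi))).congr
      (Filter.Eventually.of_forall fun x => ?_)
    rw [Finset.sum_insert ha]

/-- Hadamard's lemma reduces holomorphic multiples of `V` to the multiples of the `x_i V`. -/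
theorem hadamard (hV : InTangentSpanSL M N V)
    (hi : ∀ i (a : (Fin s → ℂ) → ℂ), AnalyticAt ℂ a 0 →
      InTangentSpanSL M N fun x => (a x * x i) • V x)
    {a : (Fin s → ℂ) → ℂ} (ha : AnalyticAt ℂ a 0) : InTangentSpanSL M N fun x => a x • V x := by
  obtain ⟨h, hh, he⟩ := exists_hadamard ha
  refine ((hV.const_smul (a 0)).add (sum Finset.univ fun i _ => hi i (h i) (hh i))).congr ?_
  filter_upwards [he] with x hx
  rw [hx, add_smul, Finset.sum_smul]
  simp [mul_comm]

end InTangentSpanSL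

/-! Germs with two independent entries. -/

section
variable {s n τ : ℕ} {M : (Fin s → ℂ) → Matrix (Fin n) (Fin n) ℂ}
  {N : Fin τ → (Fin s → ℂ) → Matrix (Fin n) (Fin n) ℂ}
  {J : ℂ × ℂ →ₗ[ℂ] Matrix (Fin n) (Fin n) ℂ} {g h g₁ h₁ g₂ h₂ a₁ a₂ : (Fin s → ℂ) → ℂ}

theorem InTangentSL.comb (r₁ : InTangentSL M fun u => J (g₁ u, h₁ u))
    (r₂ : InTangentSL M fun u => J (g₂ u, h₂ u)) (ha₁ : AnalyticAt ℂ a₁ 0)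
    (ha₂ : AnalyticAt ℂ a₂ 0) (hg : ∀ u, g u = a₁ u * g₁ u + a₂ u * g₂ u)
    (hh : ∀ u, h u = a₁ u * h₁ u + a₂ u * h₂ u) : InTangentSL M fun u => J (g u, h u) :=
  ((r₁.smul ha₁).add (r₂.smul ha₂)).congr (Filter.Eventually.of_forall fun u => by
    rw [hg, hh, ← map_smul, ← map_smul, ← map_add]
    rfl)

theorem InTangentSL.scale (r₁ : InTangentSL M fun u => J (g₁ u, h₁ u)) (ha₁ : AnalyticAt ℂ a₁ 0)
    (hg : ∀ u, g u = a₁ u * g₁ u) (hh : ∀ u, h u = a₁ u * h₁ u) :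
    InTangentSL M fun u => J (g u, h u) :=
  (r₁.smul ha₁).congr (Filter.Eventually.of_forall fun u => by
    rw [hg, hh, ← map_smul]
    rfl)

theorem InTangentSpanSL.add_rel (r₁ : InTangentSpanSL M N fun u => J (g₁ u, h₁ u))
    (r₂ : InTangentSL M fun u => J (g₂ u, h₂ u)) (hg : ∀ u, g u = g₁ u + g₂ u)
    (hh : ∀ u, h u = h₁ u + h₂ u) : InTangentSpanSL M N fun u => J (g u, h u) :=
  (r₁.add (of_inTangentSL r₂)).congr (Filter.Eventually.of_forall fun u => by
    rw [hg, hh, ← map_add]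
    rfl)

theorem InTangentSpanSL.hadamard_pair (hV : InTangentSpanSL M N fun u => J (g u, h u))
    (hi : ∀ i (a : (Fin s → ℂ) → ℂ), AnalyticAt ℂ a 0 →
      InTangentSpanSL M N fun u => J (a u * (u i * g u), a u * (u i * h u)))
    {a : (Fin s → ℂ) → ℂ} (ha : AnalyticAt ℂ a 0) :
    InTangentSpanSL M N fun u => J (a u * g u, a u * h u) :=
  (hV.hadamard (fun i a ha => (hi i a ha).congr (Filter.Eventually.of_forall fun u => by
    rw [← map_smul, ← mul_assoc, ← mul_assoc]
    rfl)) ha).congr (Filter.Eventually.of_forall fun u => by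
    rw [← map_smul]
    rfl)

end

/-! ### Tangent spaces of the families of type `II` -/

/-- Symmetric matrices with non-zero entries in the positions `12` and `13` only. -/
def symII : ℂ × ℂ →ₗ[ℂ] Matrix (Fin 3) (Fin 3) ℂ where
  toFun a := !![0, a.1, a.2; a.1, 0, 0; a.2, 0, 0]
  map_add' a b := by ext i j; fin_cases i <;> fin_cases j <;> simp
  map_smul' r a := by ext i j; fin_cases i <;> fin_cases j <;> simp

theorem symII_apply (a b : ℂ) : symII (a, b) = !![0, a, b; a, 0, 0; b, 0, 0] := rfl

theorem isSymm_symII (a : ℂ × ℂ) : (symII a).IsSymm := by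
  ext i j; fin_cases i <;> fin_cases j <;> rfl

theorem contDiff_eval_coord {s : ℕ} (r : ℂ[X]) (i : Fin s) :
    ContDiff ℂ ⊤ fun u : Fin s → ℂ => r.eval (u i) := by
  have h : ContDiff ℂ ⊤ fun t : ℂ => r.eval t := by
    simpa using r.contDiff_aeval (𝕜 := ℂ) ⊤
  exact h.comp (contDiff_apply _ _ _)

theorem analyticAt_eval_coord {s : ℕ} (r : ℂ[X]) (i : Fin s) (x : Fin s → ℂ) :
    AnalyticAt ℂ (fun u : Fin s → ℂ => r.eval (u i)) x :=
  (contDiff_eval_coord r i).contDiffAt.analyticAt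

section
variable (p q : ℂ[X])

theorem isSymm_matII (u : Fin 4 → ℂ) : (matII p q u).IsSymm := by
  ext i j; fin_cases i <;> fin_cases j <;> rfl

theorem contDiff_matII (i j : Fin 3) : ContDiff ℂ ⊤ fun u => matII p q u i j := by
  have hp := contDiff_eval_coord (s := 4) p 3
  have hq := contDiff_eval_coord (s := 4) q 3
  fin_cases i <;> fin_cases j <;> simp [matII] <;> fun_prop

theorem fderiv_matII_apply (u ξ : Fin 4 → ℂ) (i j : Fin 3) :
    fderiv ℂ (fun y => matII p q y i j) u ξ =
      !![ξ 0, p.derivative.eval (u 3) * ξ 3, ξ 1 + q.derivative.eval (u 3) * ξ 3;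
         p.derivative.eval (u 3) * ξ 3, ξ 1, ξ 2;
         ξ 1 + q.derivative.eval (u 3) * ξ 3, ξ 2, ξ 3] i j := by
  have hc : ∀ i : Fin 4, fderiv ℂ (fun y : Fin 4 → ℂ => y i) u ξ = ξ i := fun i => by
    rw [(hasFDerivAt_coord i u).fderiv]; rfl
  have hp : fderiv ℂ (fun y : Fin 4 → ℂ => p.eval (y 3)) u ξ = p.derivative.eval (u 3) * ξ 3 := by
    rw [(hasFDerivAt_eval_coord p 3 u).fderiv]; rfl
  have hq : fderiv ℂ (fun y : Fin 4 → ℂ => y 1 + q.eval (y 3)) u ξ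
      = ξ 1 + q.derivative.eval (u 3) * ξ 3 := by
    rw [((hasFDerivAt_coord 1 u).fun_add (hasFDerivAt_eval_coord q 3 u)).fderiv]; rfl
  fin_cases i <;> fin_cases j <;> first | exact hc _ | exact hp | exact hq

variable {p q}

/-- Modulo the velocities of coordinate changes every symmetric germ has non-zero entries in the
positions `12` and `13` only. -/
theorem inTangentSL_sub_symII {V : (Fin 4 → ℂ) → Matrix (Fin 3) (Fin 3) ℂ}
    (hV : ∀ i j, AnalyticAt ℂ (fun x => V x i j) 0) (hs : ∀ᶠ x in 𝓝 0, (V x).IsSymm) :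
    InTangentSL (matII p q) fun u => V u - symII
      (V u 0 1 - p.derivative.eval (u 3) * V u 2 2,
        V u 0 2 - V u 1 1 - q.derivative.eval (u 3) * V u 2 2) := by
  -- The field is chosen so that its velocity reproduces the entries `11`, `22`, `23`, `33`, each of
  -- which is a single coordinate.
  refine ⟨fun u => ![V u 0 0, V u 1 1, V u 1 2, V u 2 2], fun _ => 0, ?_, fun _ _ =>
    analyticAt_const, by simp, ?_⟩
  · refine AnalyticAt.pi fun i => ?_
    fin_cases i
    exacts [hV _ _, hV _ _, hV _ _, hV _ _]
  · filter_upwards [hs] with u hu i j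
    rw [fderiv_matII_apply, symII_apply]
    have h10 := hu.apply 0 1
    have h20 := hu.apply 0 2
    have h21 := hu.apply 1 2
    fin_cases i <;> fin_cases j <;> simp [h10, h20, h21] <;> ring

/-- Constant trace-free `A` generate the matrix part of the tangent space over the ring of germs, so
projecting their velocities to two entries gives the relations in the quotient module. -/
theorem inTangentSL_symII_of_trace {A : Matrix (Fin 3) (Fin 3) ℂ} (hA : A.trace = 0)
    {g h : (Fin 4 → ℂ) → ℂ}
    (hg : ∀ u, g u = (A * matII p q u + matII p q u * A.transpose) 0 1
      - p.derivative.eval (u 3) * (A * matII p q u + matII p q u * A.transpose) 2 2)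
    (hh : ∀ u, h u = (A * matII p q u + matII p q u * A.transpose) 0 2
      - (A * matII p q u + matII p q u * A.transpose) 1 1
      - q.derivative.eval (u 3) * (A * matII p q u + matII p q u * A.transpose) 2 2) :
    InTangentSL (matII p q) fun u => symII (g u, h u) := by
  have hM : ∀ i j, AnalyticAt ℂ (fun u => matII p q u i j) 0 := fun i j =>
    (contDiff_matII p q i j).contDiffAt.analyticAt
  have h1 : InTangentSL (matII p q) fun u => A * matII p q u + matII p q u * A.transpose :=
    ⟨fun _ => 0, fun _ => A, analyticAt_const, fun _ _ => analyticAt_const,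
      Filter.Eventually.of_forall fun _ => hA, Filter.Eventually.of_forall fun u i j => by simp⟩
  have h2 := inTangentSL_sub_symII (p := p) (q := q)
    (V := fun u => A * matII p q u + matII p q u * A.transpose) (fun i j => ?_)
    (Filter.Eventually.of_forall fun u => ?_)
  · refine (h1.sub h2).congr (Filter.Eventually.of_forall fun u => ?_)
    rw [sub_sub_cancel, hg, hh]
  · simp only [Matrix.add_apply, Matrix.mul_apply]
    refine AnalyticAt.fun_add ?_ ?_
    · exact Finset.analyticAt_fun_sum _ fun l _ => analyticAt_const.fun_mul (hM _ _)
    · exact Finset.analyticAt_fun_sum _ fun l _ => (hM _ _).fun_mul analyticAt_const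
  · rw [Matrix.IsSymm, Matrix.transpose_add, Matrix.transpose_mul, Matrix.transpose_mul,
      Matrix.transpose_transpose, (isSymm_matII p q u).eq, add_comm]

/-- The relations between the two generators of the quotient by the tangent space. -/
theorem inTangentSL_matII :
    (InTangentSL (matII p q) fun u => symII (u 1, u 2)) ∧
    (InTangentSL (matII p q) fun u => symII (u 2, u 3)) ∧
    (InTangentSL (matII p q) fun u => symII (u 0, -2 * p.eval (u 3))) ∧
    (InTangentSL (matII p q) fun u => symII (u 1 + q.eval (u 3), -2 * u 2)) ∧
    (InTangentSL (matII p q) fun u => symII (-2 * p.derivative.eval (u 3) * (u 1 + q.eval (u 3)),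
      u 0 - 2 * q.derivative.eval (u 3) * (u 1 + q.eval (u 3)))) ∧
    (InTangentSL (matII p q) fun u => symII (-2 * p.derivative.eval (u 3) * u 2,
      p.eval (u 3) - 2 * q.derivative.eval (u 3) * u 2)) ∧
    (InTangentSL (matII p q) fun u => symII (0, 3 * u 1 + q.eval (u 3))) ∧
    InTangentSL (matII p q) fun u => symII (p.eval (u 3) + 2 * u 3 * p.derivative.eval (u 3),
      2 * u 3 * q.derivative.eval (u 3)) := by
  -- The eight matrices form a basis of the trace-free matrices.
  refine ⟨inTangentSL_symII_of_trace (A := !![0, 1, 0; 0, 0, 0; 0, 0, 0]) ?_ ?_ ?_,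
    inTangentSL_symII_of_trace (A := !![0, 0, 1; 0, 0, 0; 0, 0, 0]) ?_ ?_ ?_,
    inTangentSL_symII_of_trace (A := !![0, 0, 0; 1, 0, 0; 0, 0, 0]) ?_ ?_ ?_,
    inTangentSL_symII_of_trace (A := !![0, 0, 0; 0, 0, 1; 0, 0, 0]) ?_ ?_ ?_,
    inTangentSL_symII_of_trace (A := !![0, 0, 0; 0, 0, 0; 1, 0, 0]) ?_ ?_ ?_,
    inTangentSL_symII_of_trace (A := !![0, 0, 0; 0, 0, 0; 0, 1, 0]) ?_ ?_ ?_,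
    inTangentSL_symII_of_trace (A := !![1, 0, 0; 0, -1, 0; 0, 0, 0]) ?_ ?_ ?_,
    inTangentSL_symII_of_trace (A := !![1, 0, 0; 0, 0, 0; 0, 0, -1]) ?_ ?_ ?_⟩
  all_goals first
    | (simp [Matrix.trace, Fin.sum_univ_three]; done)
    | (intro u
       simp only [Matrix.add_apply, Matrix.mul_apply, Matrix.transpose_apply, Fin.sum_univ_three,
         matII, Matrix.of_apply, Matrix.cons_val]
       ring)

end

section
variable (p q : ℂ[X])

theorem fderiv_oddII_apply (v η : Fin 2 → ℂ) :
    fderiv ℂ (oddII p q) v η = (3 * v 0 ^ 2 + q.eval (v 1 ^ 2)) * η 0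
      + (p.eval (v 1 ^ 2) + 2 * v 1 ^ 2 * p.derivative.eval (v 1 ^ 2)
        + 2 * v 0 * v 1 * q.derivative.eval (v 1 ^ 2)) * η 1 := by
  rw [oddII_eq, fderiv_cubicFun_apply]
  simp only [derivative_mul, derivative_comp, derivative_X_pow, derivative_X, eval_mul, eval_add,
    eval_comp, eval_pow, eval_X, eval_one, eval_C]
  push_cast
  ring

/-- The map of the plane to the space along which the tangent spaces to the families of type `II`
become tangent spaces to odd functions. -/
def planeMapII (v : Fin 2 → ℂ) : Fin 4 → ℂ :=
  ![-4 * v 0 * (p.derivative.eval (v 1 ^ 2) * v 1 + q.derivative.eval (v 1 ^ 2) * v 0),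
    v 0 ^ 2, -(v 0 * v 1), v 1 ^ 2]

theorem planeMapII_neg (v : Fin 2 → ℂ) : planeMapII p q (-v) = planeMapII p q v := by
  simp only [planeMapII, Pi.neg_apply, neg_sq]
  congr 1
  · ring
  · simp

theorem analyticAt_eval_sq (r : ℂ[X]) (v : Fin 2 → ℂ) :
    AnalyticAt ℂ (fun v : Fin 2 → ℂ => r.eval (v 1 ^ 2)) v := by
  have : (fun v : Fin 2 → ℂ => r.eval (v 1 ^ 2)) = fun v => (r.comp (X ^ 2)).eval (v 1) :=
    funext fun v => by simp
  rw [this]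
  exact analyticAt_eval_coord _ _ v

theorem analyticAt_planeMapII (v : Fin 2 → ℂ) : AnalyticAt ℂ (planeMapII p q) v := by
  have h0 := analyticAt_coord (0 : Fin 2) v
  have h1 := analyticAt_coord (1 : Fin 2) v
  refine AnalyticAt.pi fun i => ?_
  fin_cases i
  · exact (analyticAt_const.fun_mul h0).fun_mul (((analyticAt_eval_sq p.derivative v).fun_mul h1).fun_add
      ((analyticAt_eval_sq q.derivative v).fun_mul h0))
  · exact h0.fun_pow 2
  · exact (h0.fun_mul h1).fun_neg
  · exact h1.fun_pow 2

theorem planeMapII_zero : planeMapII p q 0 = 0 := by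
  funext i
  fin_cases i <;> simp [planeMapII]

variable {p q}

/-- The germ is paired with the symmetric `N` whose nonzero entries on and above the diagonal are
`N₀₁ = c`, `N₀₂ = b`, `N₁₁ = -2b`, `N₂₂ = -2(cp' + bq')`. Along `planeMapII` this `N` annihilates
all coordinate velocities, and `MN` is the scalar matrix `oddII` modulo the partial derivatives of
`oddII`. So `tr N(AM + MAᵀ) = 2 tr(AMN)` lies in their ideal when `A` is trace-free, while the
pairing with `symII (g, h)` is `2(cg + bh)`. -/
theorem InTangentSL.inTangentROdd {g h : (Fin 4 → ℂ) → ℂ}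
    (H : InTangentSL (matII p q) fun u => symII (g u, h u)) :
    InTangentROdd (oddII p q) fun v =>
      2 * (v 1 * g (planeMapII p q v) + v 0 * h (planeMapII p q v)) := by
  obtain ⟨ξ, A, -, hA, htr, he⟩ := H
  have hφ := analyticAt_planeMapII p q 0
  have hlim : Filter.Tendsto (planeMapII p q) (𝓝 0) (𝓝 0) := by
    simpa [planeMapII_zero] using hφ.continuousAt.tendsto
  have hA' : ∀ i j, AnalyticAt ℂ (fun v => A (planeMapII p q v) i j) 0 := fun i j =>
    AnalyticAt.fun_comp_of_eq (hA i j) hφ (planeMapII_zero p q)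
  have h0 := analyticAt_coord (0 : Fin 2) 0
  have h1 := analyticAt_coord (1 : Fin 2) 0
  -- The components collect the coefficients of the two partial derivatives in `2 tr(AMN)`. They are
  -- odd because `planeMapII` is even.
  refine ⟨fun v => ![2 * v 1 * A (planeMapII p q v) 1 2
      - 4 * (p.derivative.eval (v 1 ^ 2) * v 1 + q.derivative.eval (v 1 ^ 2) * v 0)
        * A (planeMapII p q v) 2 0 - 2 * v 0 * A (planeMapII p q v) 1 1,
    -4 * v 0 * A (planeMapII p q v) 1 0 + 2 * v 0 * A (planeMapII p q v) 2 1
      - 2 * v 1 * A (planeMapII p q v) 2 2], ?_, ?_, ?_⟩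
  · have hp := analyticAt_eval_sq p.derivative 0
    have hq := analyticAt_eval_sq q.derivative 0
    refine AnalyticAt.pi fun i => ?_
    fin_cases i
    · exact (((analyticAt_const.fun_mul h1).fun_mul (hA' _ _)).fun_sub ((analyticAt_const.fun_mul
        ((hp.fun_mul h1).fun_add (hq.fun_mul h0))).fun_mul (hA' _ _))).fun_sub
        ((analyticAt_const.fun_mul h0).fun_mul (hA' _ _))
    · exact (((analyticAt_const.fun_mul h0).fun_mul (hA' _ _)).fun_add
        ((analyticAt_const.fun_mul h0).fun_mul (hA' _ _))).fun_sub
        ((analyticAt_const.fun_mul h1).fun_mul (hA' _ _))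
  · refine Filter.Eventually.of_forall fun v => ?_
    simp only [planeMapII_neg, Pi.neg_apply, neg_sq]
    funext i
    fin_cases i <;> simp <;> ring
  · filter_upwards [hlim.eventually htr, hlim.eventually he] with v ht hE
    rw [fderiv_oddII_apply]
    have e01 := hE 0 1
    have e02 := hE 0 2
    have e11 := hE 1 1
    have e22 := hE 2 2
    rw [Matrix.trace_fin_three] at ht
    simp only [fderiv_matII_apply, symII_apply] at e01 e02 e11 e22
    generalize A (planeMapII p q v) = B at *
    generalize ξ (planeMapII p q v) = η at *
    generalize g (planeMapII p q v) = g₀ at *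
    generalize h (planeMapII p q v) = h₀ at *
    simp only [Matrix.add_apply, Matrix.mul_apply, Matrix.transpose_apply, Fin.sum_univ_three,
      matII, planeMapII, Matrix.of_apply, Matrix.cons_val] at e01 e02 e11 e22 ht ⊢
    -- The coefficients of `e01`, `e02`, `e11`, `e22` are the entries of `N`, doubled off the
    -- diagonal; the coefficient of `ht` is twice the scalar `oddII`.
    linear_combination 2 * v 1 * e01 + 2 * v 0 * e02 - 2 * v 0 * e11
      - 2 * (p.derivative.eval (v 1 ^ 2) * v 1 + q.derivative.eval (v 1 ^ 2) * v 0) * e22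
      + (2 * v 1 * p.eval (v 1 ^ 2) + 2 * v 0 * (v 0 ^ 2 + q.eval (v 1 ^ 2))) * ht

end

/-! ### Miniversal deformations of type `II` -/

/-- Spanning is reduced to one entry at a time by `inTangentSL_sub_symII`; independence is
transferred to the odd function by `InTangentSL.inTangentROdd`. -/
theorem isSLMiniversal_matII {τ : ℕ} {p q : ℂ[X]}
    {F : (Fin τ → ℂ) → (Fin 4 → ℂ) → Matrix (Fin 3) (Fin 3) ℂ} {G H : Fin τ → ℂ[X]}
    (hF : ∀ l u, F l u
      = matII p q u + ∑ i, l i • symII ((G i).eval (u 3), (H i).eval (u 3)))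
    (hg : ∀ g : (Fin 4 → ℂ) → ℂ, AnalyticAt ℂ g 0 → InTangentSpanSL (matII p q)
      (fun l u => symII ((G l).eval (u 3), (H l).eval (u 3))) fun u => symII (g u, 0))
    (hh : ∀ h : (Fin 4 → ℂ) → ℂ, AnalyticAt ℂ h 0 → InTangentSpanSL (matII p q)
      (fun l u => symII ((G l).eval (u 3), (H l).eval (u 3))) fun u => symII (0, h u))
    (hind : ∀ c : Fin τ → ℂ, (InTangentROdd (oddII p q) fun v =>
      ∑ l, c l * (v 1 * (G l).eval (v 1 ^ 2) + v 0 * (H l).eval (v 1 ^ 2))) → c = 0) :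
    IsSLMiniversal (matII p q) F := by
  refine isSLMiniversal_of_affine hF (contDiff_matII p q) ?_ (isSymm_matII p q)
    (fun _ _ => isSymm_symII _) ?_ ?_
  · intro l i j
    have hG := contDiff_eval_coord (s := 4) (G l) 3
    have hH := contDiff_eval_coord (s := 4) (H l) 3
    fin_cases i <;> fin_cases j <;> simp [symII] <;> fun_prop
  · intro V hV hs
    have h1 := inTangentSL_sub_symII (p := p) (q := q) hV hs
    refine (((hg (fun u => V u 0 1 - p.derivative.eval (u 3) * V u 2 2) ?_).add
      (hh (fun u => V u 0 2 - V u 1 1 - q.derivative.eval (u 3) * V u 2 2) ?_)).add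
      (.of_inTangentSL h1)).congr (Filter.Eventually.of_forall fun u => ?_)
    · exact (hV 0 1).fun_sub ((analyticAt_eval_coord _ _ _).fun_mul (hV 2 2))
    · exact ((hV 0 2).fun_sub (hV 1 1)).fun_sub ((analyticAt_eval_coord _ _ _).fun_mul (hV 2 2))
    · rw [← map_add, Prod.mk_add_mk, add_zero, zero_add, add_sub_cancel]
  · intro c hc
    have h1 : InTangentSL (matII p q) fun u => symII
        (∑ l, c l * (G l).eval (u 3), ∑ l, c l * (H l).eval (u 3)) := by
      refine hc.congr (Filter.Eventually.of_forall fun u => ?_)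
      simp only [← map_smul, ← map_sum, Prod.smul_mk, smul_eq_mul]
      congr 1
      ext <;> simp [Prod.fst_sum, Prod.snd_sum]
    have h2 := hind ((2 : ℂ) • c) (by
      convert h1.inTangentROdd using 2 with v
      simp only [planeMapII, Matrix.cons_val, Pi.smul_apply, Finset.mul_sum,
        ← Finset.sum_add_distrib]
      exact Finset.sum_congr rfl fun l _ => by simp; ring)
    simpa using h2

/-- Write `e₁ = symII (1, 0)` and `e₂ = symII (0, 1)`. In the quotient module `x` and `y` act by
zero, `z e₂ = 0`, `z e₁ = -w e₂` and `w^(m+1) = 0`, so it is spanned by the `wⁱe₁`, `wⁱe₂` with `i ≤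
m`. -/
theorem inTangentSL_matII_pow (m : ℕ) :
    (InTangentSL (matII (X ^ (m + 1)) 0) fun u => symII (u 0, 0)) ∧
    (InTangentSL (matII (X ^ (m + 1)) 0) fun u => symII (0, u 0)) ∧
    (InTangentSL (matII (X ^ (m + 1)) 0) fun u => symII (u 1, 0)) ∧
    (InTangentSL (matII (X ^ (m + 1)) 0) fun u => symII (0, u 1)) ∧
    (InTangentSL (matII (X ^ (m + 1)) 0) fun u => symII (0, u 2)) ∧
    (InTangentSL (matII (X ^ (m + 1)) 0) fun u => symII (u 2, u 3)) ∧
    (InTangentSL (matII (X ^ (m + 1)) 0) fun u => symII (u 3 ^ (m + 1), 0)) ∧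
    InTangentSL (matII (X ^ (m + 1)) 0) fun u => symII (0, u 3 ^ (m + 1)) := by
  obtain ⟨a, b, c, d, e, f, g, i⟩ := inTangentSL_matII (p := X ^ (m + 1)) (q := 0)
  simp only [derivative_X_pow, derivative_zero, eval_mul, eval_pow, eval_X, eval_C, eval_zero,
    add_zero, mul_zero, zero_mul, sub_zero, Nat.add_sub_cancel] at a b c d e f g i
  have hm : (2 * m + 3 : ℂ) ≠ 0 := by exact_mod_cast (by omega : 2 * m + 3 ≠ 0)
  have hw : AnalyticAt ℂ (fun u : Fin 4 → ℂ => u 3 ^ m) 0 := (analyticAt_coord 3 0).fun_pow m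
  have hc : ∀ c : ℂ, AnalyticAt ℂ (fun _ : Fin 4 → ℂ => c) 0 := fun _ => analyticAt_const
  have y0 := a.comb (g := fun u => u 1) (h := fun _ => 0) d (hc (2 / 3)) (hc (1 / 3))
    (fun u => by ring) (fun u => by ring)
  have z0 := a.comb (g := fun _ => 0) (h := fun u => u 2) d (hc (1 / 3)) (hc (-1 / 3))
    (fun u => by ring) (fun u => by ring)
  have w0 := i.scale (g := fun u => u 3 ^ (m + 1)) (h := fun _ => 0) (hc (1 / (2 * m + 3)))
    (fun u => by field_simp; push_cast; ring) (fun u => by ring)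
  have w1 := f.comb (g := fun _ => 0) (h := fun u => u 3 ^ (m + 1)) b (hc (1 / (2 * m + 3)))
    ((hc (2 * (m + 1) / (2 * m + 3))).fun_mul hw)
    (fun u => by field_simp; push_cast; ring) (fun u => by field_simp; ring)
  refine ⟨?_, ?_, y0, ?_, z0, b, w0, w1⟩
  · exact c.comb w1 (hc 1) (hc 2) (fun u => by ring) (fun u => by ring)
  · exact e.comb y0 (hc 1) ((hc (2 * (m + 1))).fun_mul hw) (fun u => by push_cast; ring)
      (fun u => by ring)
  · exact g.scale (hc (1 / 3)) (fun u => by ring) (fun u => by ring)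

theorem inTangentSpanSL_matII_pow {m τ : ℕ}
    {N : Fin τ → (Fin 4 → ℂ) → Matrix (Fin 3) (Fin 3) ℂ}
    (h1 : ∀ i ≤ m, InTangentSpanSL (matII (X ^ (m + 1)) 0) N fun u => symII (u 3 ^ i, 0))
    (h2 : ∀ i ≤ m, InTangentSpanSL (matII (X ^ (m + 1)) 0) N fun u => symII (0, u 3 ^ i))
    {g : (Fin 4 → ℂ) → ℂ} (hg : AnalyticAt ℂ g 0) :
    (InTangentSpanSL (matII (X ^ (m + 1)) 0) N fun u => symII (g u, 0)) ∧
      InTangentSpanSL (matII (X ^ (m + 1)) 0) N fun u => symII (0, g u) := by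
  obtain ⟨x0, x1, y0, y1, z1, zw, w0, w1⟩ := inTangentSL_matII_pow m
  have hw : ∀ i, AnalyticAt ℂ (fun u : Fin 4 → ℂ => u 3 ^ i) 0 := fun i =>
    (analyticAt_coord 3 0).fun_pow i
  -- Descending induction on the exponent `i = m + 1 - j`. The second entry is treated first,
  -- because `z wⁱe₁ = -w^(i+1) e₂` leads from the first entry to the second.
  have H2 : ∀ j i, i + j = m + 1 → ∀ a : (Fin 4 → ℂ) → ℂ, AnalyticAt ℂ a 0 →
      InTangentSpanSL (matII (X ^ (m + 1)) 0) N fun u => symII (a u * 0, a u * u 3 ^ i) := by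
    intro j
    induction j with
    | zero =>
      rintro i rfl a ha
      exact .of_inTangentSL (w1.scale ha (fun u => rfl) (fun u => rfl))
    | succ j ih =>
      intro i hij a ha
      refine (h2 i (by omega)).hadamard_pair (fun l a ha => ?_) ha
      have ha' := ha.fun_mul (hw i)
      fin_cases l
      · exact .of_inTangentSL (x1.scale ha' (fun u => by simp) (fun u => by simp; ring))
      · exact .of_inTangentSL (y1.scale ha' (fun u => by simp) (fun u => by simp; ring))
      · exact .of_inTangentSL (z1.scale ha' (fun u => by simp) (fun u => by simp; ring))
      · refine (ih (i + 1) (by omega) a ha).congr (Filter.Eventually.of_forall fun u => ?_)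
        simp [pow_succ']
  have H1 : ∀ j i, i + j = m + 1 → ∀ a : (Fin 4 → ℂ) → ℂ, AnalyticAt ℂ a 0 →
      InTangentSpanSL (matII (X ^ (m + 1)) 0) N fun u => symII (a u * u 3 ^ i, a u * 0) := by
    intro j
    induction j with
    | zero =>
      rintro i rfl a ha
      exact .of_inTangentSL (w0.scale ha (fun u => rfl) (fun u => rfl))
    | succ j ih =>
      intro i hij a ha
      refine (h1 i (by omega)).hadamard_pair (fun l a ha => ?_) ha
      have ha' := ha.fun_mul (hw i)
      fin_cases l
      · exact .of_inTangentSL (x0.scale ha' (fun u => by simp; ring) (fun u => by simp))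
      · exact .of_inTangentSL (y0.scale ha' (fun u => by simp; ring) (fun u => by simp))
      · exact (H2 j (i + 1) (by omega) _ ha.fun_neg).add_rel (zw.scale ha' (fun _ => rfl) fun _ => rfl)
          (fun u => by simp; ring) (fun u => by simp; ring)
      · refine (ih (i + 1) (by omega) a ha).congr (Filter.Eventually.of_forall fun u => ?_)
        simp [pow_succ']
  constructor
  · exact (H1 (m + 1) 0 (by omega) g hg).congr (Filter.Eventually.of_forall fun u => by simp)
  · exact (H2 (m + 1) 0 (by omega) g hg).congr (Filter.Eventually.of_forall fun u => by simp)

theorem isSLMiniversal_II4 : IsSLMiniversal Family.II4.matrix matrixDefII4 := by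
  have hM : Family.II4.matrix = matII (X ^ (1 + 1)) 0 := by
    funext u
    simp [Family.matrix, matII]
  have hf : cubicFun 0 (X ^ (4 + 1)) = oddII (X ^ (1 + 1)) 0 := by
    funext v
    simp [cubicFun, oddII]
    ring
  rw [hM]
  have hmem := InTangentSpanSL.mem (M := matII (X ^ (1 + 1)) 0) (N := fun (l : Fin 4) u =>
    symII (((![1, X, 0, 0] : Fin 4 → ℂ[X]) l).eval (u 3),
      ((![0, 0, 1, X] : Fin 4 → ℂ[X]) l).eval (u 3)))
  have key := @inTangentSpanSL_matII_pow 1 4 _ (fun i hi => by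
    interval_cases i
    · exact (hmem 0).congr (Filter.Eventually.of_forall fun u => by simp)
    · exact (hmem 1).congr (Filter.Eventually.of_forall fun u => by simp)) (fun i hi => by
    interval_cases i
    · exact (hmem 2).congr (Filter.Eventually.of_forall fun u => by simp)
    · exact (hmem 3).congr (Filter.Eventually.of_forall fun u => by simp))
  refine isSLMiniversal_matII (fun l u => ?_) (fun g hg => (key hg).1) (fun g hg => (key hg).2)
    fun c hc => eq_zero_of_inTangentROdd_II4 ?_
  · ext i j
    fin_cases i <;> fin_cases j <;>
      simp [matrixDefII4, matII, symII_apply, Fin.sum_univ_succ] <;> ring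
  · rw [hf]
    convert hc using 2 with v
    refine Finset.sum_congr rfl fun l _ => ?_
    fin_cases l <;> (simp [monomialsII4, -mul_eq_mul_left_iff, -mul_eq_mul_right_iff]; try ring)

theorem isSLMiniversal_II6 : IsSLMiniversal Family.II6.matrix matrixDefII6 := by
  have hM : Family.II6.matrix = matII (X ^ (2 + 1)) 0 := by
    funext u
    simp [Family.matrix, matII]
  have hf : cubicFun 0 (X ^ (6 + 1)) = oddII (X ^ (2 + 1)) 0 := by
    funext v
    simp [cubicFun, oddII]
    ring
  rw [hM]
  have hmem := InTangentSpanSL.mem (M := matII (X ^ (2 + 1)) 0) (N := fun (l : Fin 6) u =>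
    symII (((![1, X, X ^ 2, 0, 0, 0] : Fin 6 → ℂ[X]) l).eval (u 3),
      ((![0, 0, 0, 1, X, X ^ 2] : Fin 6 → ℂ[X]) l).eval (u 3)))
  have key := @inTangentSpanSL_matII_pow 2 6 _ (fun i hi => by
    interval_cases i
    · exact (hmem 0).congr (Filter.Eventually.of_forall fun u => by simp)
    · exact (hmem 1).congr (Filter.Eventually.of_forall fun u => by simp)
    · exact (hmem 2).congr (Filter.Eventually.of_forall fun u => by simp)) (fun i hi => by
    interval_cases i
    · exact (hmem 3).congr (Filter.Eventually.of_forall fun u => by simp)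
    · exact (hmem 4).congr (Filter.Eventually.of_forall fun u => by simp)
    · exact (hmem 5).congr (Filter.Eventually.of_forall fun u => by simp))
  refine isSLMiniversal_matII (fun l u => ?_) (fun g hg => (key hg).1) (fun g hg => (key hg).2)
    fun c hc => eq_zero_of_inTangentROdd_II6 ?_
  · ext i j
    fin_cases i <;> fin_cases j <;>
      simp [matrixDefII6, matII, symII_apply, Fin.sum_univ_succ] <;> ring
  · rw [hf]
    convert hc using 2 with v
    refine Finset.sum_congr rfl fun l _ => ?_
    fin_cases l <;> simp [monomialsII6, -mul_eq_mul_left_iff, -mul_eq_mul_right_iff] <;> ring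

/-- With `e₁ = symII (1, 0)` and `e₂ = symII (0, 1)`, the quotient satisfies `y e₁ = -z e₂`, `z e₁ =
-w e₂`, `w²e₁ = 3z e₂`, while `x e₁`, `x e₂`, `y e₂`, `zw e₂`, `w²e₂` vanish. It is spanned by `e₁,
we₁, w²e₁, e₂, we₂`. -/
theorem inTangentSL_matII_sq :
    (InTangentSL (matII 0 (X ^ 2)) fun u => symII (u 0, 0)) ∧
    (InTangentSL (matII 0 (X ^ 2)) fun u => symII (0, u 0)) ∧
    (InTangentSL (matII 0 (X ^ 2)) fun u => symII (u 1, u 2)) ∧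
    (InTangentSL (matII 0 (X ^ 2)) fun u => symII (0, u 1)) ∧
    (InTangentSL (matII 0 (X ^ 2)) fun u => symII (u 3 ^ 2, -3 * u 2)) ∧
    (InTangentSL (matII 0 (X ^ 2)) fun u => symII (0, u 2 * u 3)) ∧
    (InTangentSL (matII 0 (X ^ 2)) fun u => symII (u 2, u 3)) ∧
    InTangentSL (matII 0 (X ^ 2)) fun u => symII (0, u 3 ^ 2) := by
  obtain ⟨a, b, c, d, e, f, g, i⟩ := inTangentSL_matII (p := 0) (q := X ^ 2)
  simp only [derivative_X_pow, derivative_zero, eval_mul, eval_pow, eval_X, eval_C, eval_zero,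
    add_zero, mul_zero, zero_mul, zero_sub] at a b c d e f g i
  have hw : AnalyticAt ℂ (fun u : Fin 4 → ℂ => u 3) 0 := analyticAt_coord 3 0
  have hc : ∀ c : ℂ, AnalyticAt ℂ (fun _ : Fin 4 → ℂ => c) 0 := fun _ => analyticAt_const
  have w1 := i.scale (g := fun _ => 0) (h := fun u => u 3 ^ 2) (hc (1 / 4))
    (fun u => by ring) (fun u => by push_cast; ring)
  have y1 := g.comb (g := fun _ => 0) (h := fun u => u 1) w1 (hc (1 / 3)) (hc (-1 / 3))
    (fun u => by ring) (fun u => by ring)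
  have wy := y1.comb (g := fun _ => 0) (h := fun u => 4 * u 3 * (u 1 + u 3 ^ 2)) w1
    ((hc 4).fun_mul hw) ((hc 4).fun_mul hw) (fun u => by ring) (fun u => by ring)
  refine ⟨c, ?_, a, y1, ?_, ?_, b, w1⟩
  · exact e.comb wy (hc 1) (hc 1) (fun u => by ring) (fun u => by push_cast; ring)
  · exact d.comb a (hc 1) (hc (-1)) (fun u => by ring) (fun u => by ring)
  · exact f.scale (hc (-1 / 4)) (fun u => by ring) (fun u => by push_cast; ring)

theorem inTangentSpanSL_matII_sq {τ : ℕ}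
    {N : Fin τ → (Fin 4 → ℂ) → Matrix (Fin 3) (Fin 3) ℂ}
    (h1 : ∀ i ≤ 2, InTangentSpanSL (matII 0 (X ^ 2)) N fun u => symII (u 3 ^ i, 0))
    (h2 : ∀ i ≤ 1, InTangentSpanSL (matII 0 (X ^ 2)) N fun u => symII (0, u 3 ^ i))
    {g : (Fin 4 → ℂ) → ℂ} (hg : AnalyticAt ℂ g 0) :
    (InTangentSpanSL (matII 0 (X ^ 2)) N fun u => symII (g u, 0)) ∧
      InTangentSpanSL (matII 0 (X ^ 2)) N fun u => symII (0, g u) := by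
  obtain ⟨x0, x1, yz, y1, wz, zw1, zw, w1⟩ := inTangentSL_matII_sq
  have hw : AnalyticAt ℂ (fun u : Fin 4 → ℂ => u 3) 0 := analyticAt_coord 3 0
  have hc : ∀ c : ℂ, AnalyticAt ℂ (fun _ : Fin 4 → ℂ => c) 0 := fun _ => analyticAt_const
  have wy0 := yz.comb (g := fun u => u 1 * u 3) (h := fun _ => 0) zw1 hw (hc (-1))
    (fun u => by ring) (fun u => by ring)
  have wz0 := zw.comb (g := fun u => u 2 * u 3) (h := fun _ => 0) w1 hw (hc (-1))
    (fun u => by ring) (fun u => by ring)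
  have w30 := wz.comb (g := fun u => u 3 ^ 3) (h := fun _ => 0) zw1 hw (hc 3)
    (fun u => by ring) (fun u => by ring)
  -- The generators are taken in such an order that a coordinate times the current one lies in the
  -- tangent space or among the multiples already treated.
  have A2 : ∀ a : (Fin 4 → ℂ) → ℂ, AnalyticAt ℂ a 0 →
      InTangentSpanSL (matII 0 (X ^ 2)) N fun u => symII (a u * u 3 ^ 2, a u * 0) := by
    refine fun a ha => (h1 2 le_rfl).hadamard_pair (fun l a ha => ?_) ha
    refine .of_inTangentSL ?_
    fin_cases l
    · exact x0.scale (ha.fun_mul (hw.fun_pow 2)) (fun u => by simp; ring) (fun u => by simp)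
    · exact wy0.scale (ha.fun_mul hw) (fun u => by simp; ring) (fun u => by simp)
    · exact wz0.scale (ha.fun_mul hw) (fun u => by simp; ring) (fun u => by simp)
    · exact w30.scale ha (fun u => by simp [-mul_eq_mul_left_iff, -mul_eq_mul_right_iff]; ring)
        (fun u => by simp)
  have A1 : ∀ a : (Fin 4 → ℂ) → ℂ, AnalyticAt ℂ a 0 →
      InTangentSpanSL (matII 0 (X ^ 2)) N fun u => symII (a u * u 3 ^ 1, a u * 0) := by
    refine fun a ha => (h1 1 one_le_two).hadamard_pair (fun l a ha => ?_) ha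
    fin_cases l
    · exact .of_inTangentSL
        (x0.scale (ha.fun_mul hw) (fun u => by simp; ring) (fun u => by simp))
    · exact .of_inTangentSL (wy0.scale ha (fun u => by simp) (fun u => by simp))
    · exact .of_inTangentSL (wz0.scale ha (fun u => by simp) (fun u => by simp))
    · exact (A2 a ha).congr (Filter.Eventually.of_forall fun u => by simp [sq])
  have B1 : ∀ a : (Fin 4 → ℂ) → ℂ, AnalyticAt ℂ a 0 →
      InTangentSpanSL (matII 0 (X ^ 2)) N fun u => symII (a u * 0, a u * u 3 ^ 1) := by
    refine fun a ha => (h2 1 le_rfl).hadamard_pair (fun l a ha => ?_) ha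
    refine .of_inTangentSL ?_
    fin_cases l
    · exact x1.scale (ha.fun_mul hw) (fun u => by simp) (fun u => by simp; ring)
    · exact y1.scale (ha.fun_mul hw) (fun u => by simp) (fun u => by simp; ring)
    · exact zw1.scale ha (fun u => by simp) (fun u => by simp)
    · exact w1.scale ha (fun u => by simp)
        (fun u => by simp [-mul_eq_mul_left_iff, -mul_eq_mul_right_iff]; ring)
  -- The relation `z e₂ = w²e₁/3` reduces this to the stage `A2`.
  have Bz : ∀ a : (Fin 4 → ℂ) → ℂ, AnalyticAt ℂ a 0 →
      InTangentSpanSL (matII 0 (X ^ 2)) N fun u => symII (0, a u * u 2) := fun a ha =>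
    (A2 _ ((hc (1 / 3)).fun_mul ha)).add_rel
      (wz.scale ((hc (-1 / 3)).fun_mul ha) (fun u => rfl) fun u => rfl)
      (fun u => by ring) (fun u => by ring)
  have B0 := (h2 0 zero_le_one).hadamard_pair (fun l a ha => by
    fin_cases l
    · exact .of_inTangentSL (x1.scale ha (fun u => by simp) (fun u => by simp))
    · exact .of_inTangentSL (y1.scale ha (fun u => by simp) (fun u => by simp))
    · exact (Bz a ha).congr (Filter.Eventually.of_forall fun u => by simp)
    · exact (B1 a ha).congr (Filter.Eventually.of_forall fun u => by simp)) hg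
  have A0 := (h1 0 zero_le_two).hadamard_pair (fun l a ha => by
    fin_cases l
    · exact .of_inTangentSL (x0.scale ha (fun u => by simp) (fun u => by simp))
    · exact (Bz _ ha.fun_neg).add_rel (yz.scale ha (fun u => rfl) fun u => rfl)
        (fun u => by simp) (fun u => by simp)
    · exact (B1 _ ha.fun_neg).add_rel (zw.scale ha (fun u => rfl) fun u => rfl)
        (fun u => by simp) (fun u => by simp)
    · exact (A1 a ha).congr (Filter.Eventually.of_forall fun u => by simp)) hg
  exact ⟨A0.congr (Filter.Eventually.of_forall fun u => by simp),
    B0.congr (Filter.Eventually.of_forall fun u => by simp)⟩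

theorem isSLMiniversal_II5 : IsSLMiniversal Family.II5.matrix matrixDefII5 := by
  have hM : Family.II5.matrix = matII 0 (X ^ 2) := by
    funext u
    simp [Family.matrix, matII]
  have hf : cubicFun (C 1 * X ^ 4) 0 = oddII 0 (X ^ 2) := by
    funext v
    simp [cubicFun, oddII, -mul_eq_mul_left_iff, -mul_eq_mul_right_iff]
    ring
  rw [hM]
  have hmem := InTangentSpanSL.mem (M := matII 0 (X ^ 2)) (N := fun (l : Fin 5) u =>
    symII (((![1, X, X ^ 2, 0, 0] : Fin 5 → ℂ[X]) l).eval (u 3),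
      ((![0, 0, 0, 1, X] : Fin 5 → ℂ[X]) l).eval (u 3)))
  have key := @inTangentSpanSL_matII_sq 5 _ (fun i hi => by
    interval_cases i
    · exact (hmem 0).congr (Filter.Eventually.of_forall fun u => by simp)
    · exact (hmem 1).congr (Filter.Eventually.of_forall fun u => by simp)
    · exact (hmem 2).congr (Filter.Eventually.of_forall fun u => by simp)) (fun i hi => by
    interval_cases i
    · exact (hmem 3).congr (Filter.Eventually.of_forall fun u => by simp)
    · exact (hmem 4).congr (Filter.Eventually.of_forall fun u => by simp))
  refine isSLMiniversal_matII (fun l u => ?_) (fun g hg => (key hg).1) (fun g hg => (key hg).2)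
    fun c hc => eq_zero_of_inTangentROdd_II5 one_ne_zero ?_
  · ext i j
    fin_cases i <;> fin_cases j <;>
      simp [matrixDefII5, matII, symII_apply, Fin.sum_univ_succ] <;> ring
  · rw [hf]
    convert hc using 2 with v
    refine Finset.sum_congr rfl fun l _ => ?_
    fin_cases l <;> simp [monomialsII5, -mul_eq_mul_left_iff, -mul_eq_mul_right_iff] <;> ring

/-! ### Tangent spaces of the families of type `I` -/

/-- Symmetric matrices with non-zero entries in the positions `12` and `22` only. -/
def symI : ℂ × ℂ →ₗ[ℂ] Matrix (Fin 3) (Fin 3) ℂ where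
  toFun a := !![0, a.1, 0; a.1, a.2, 0; 0, 0, 0]
  map_add' a b := by ext i j; fin_cases i <;> fin_cases j <;> simp
  map_smul' r a := by ext i j; fin_cases i <;> fin_cases j <;> simp

theorem symI_apply (a b : ℂ) : symI (a, b) = !![0, a, 0; a, b, 0; 0, 0, 0] := rfl

theorem isSymm_symI (a : ℂ × ℂ) : (symI a).IsSymm := by
  ext i j; fin_cases i <;> fin_cases j <;> rfl

section
variable (P : ℂ[X]) (μ : ℂ)

theorem isSymm_matI (u : Fin 4 → ℂ) : (matI P μ u).IsSymm := by
  ext i j; fin_cases i <;> fin_cases j <;> rfl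

theorem contDiff_matI (i j : Fin 3) : ContDiff ℂ ⊤ fun u => matI P μ u i j := by
  have hP := contDiff_eval_coord (s := 4) P 0
  fin_cases i <;> fin_cases j <;> simp [matI] <;> fun_prop

theorem fderiv_matI_apply (u ξ : Fin 4 → ℂ) (i j : Fin 3) :
    fderiv ℂ (fun y => matI P μ y i j) u ξ =
      !![ξ 0, 0, ξ 2;
         0, ξ 1 + P.derivative.eval (u 0) * ξ 0, ξ 3;
         ξ 2, ξ 3, ξ 1] i j := by
  have hc : ∀ i : Fin 4, fderiv ℂ (fun y : Fin 4 → ℂ => y i) u ξ = ξ i := fun i => by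
    rw [(hasFDerivAt_coord i u).fderiv]; rfl
  have hμ : fderiv ℂ (fun _ : Fin 4 → ℂ => μ) u ξ = 0 := by simp
  have hP : fderiv ℂ (fun y : Fin 4 → ℂ => y 1 + P.eval (y 0)) u ξ
      = ξ 1 + P.derivative.eval (u 0) * ξ 0 := by
    rw [((hasFDerivAt_coord 1 u).fun_add (hasFDerivAt_eval_coord P 0 u)).fderiv]; rfl
  fin_cases i <;> fin_cases j <;> first | exact hc _ | exact hμ | exact hP

variable {P μ}

/-- Modulo the velocities of coordinate changes every symmetric germ has non-zero entries in the
positions `12` and `22` only. -/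
theorem inTangentSL_sub_symI {V : (Fin 4 → ℂ) → Matrix (Fin 3) (Fin 3) ℂ}
    (hV : ∀ i j, AnalyticAt ℂ (fun x => V x i j) 0) (hs : ∀ᶠ x in 𝓝 0, (V x).IsSymm) :
    InTangentSL (matI P μ) fun u => V u - symI
      (V u 0 1, V u 1 1 - V u 2 2 - P.derivative.eval (u 0) * V u 0 0) := by
  refine ⟨fun u => ![V u 0 0, V u 2 2, V u 0 2, V u 1 2], fun _ => 0, ?_, fun _ _ =>
    analyticAt_const, by simp, ?_⟩
  · refine AnalyticAt.pi fun i => ?_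
    fin_cases i
    exacts [hV _ _, hV _ _, hV _ _, hV _ _]
  · filter_upwards [hs] with u hu i j
    rw [fderiv_matI_apply, symI_apply]
    have h10 := hu.apply 0 1
    have h20 := hu.apply 0 2
    have h21 := hu.apply 1 2
    fin_cases i <;> fin_cases j <;> (simp [h10, h20, h21]; try ring)

theorem inTangentSL_symI_of_trace {A : Matrix (Fin 3) (Fin 3) ℂ} (hA : A.trace = 0)
    {g h : (Fin 4 → ℂ) → ℂ}
    (hg : ∀ u, g u = (A * matI P μ u + matI P μ u * A.transpose) 0 1)
    (hh : ∀ u, h u = (A * matI P μ u + matI P μ u * A.transpose) 1 1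
      - (A * matI P μ u + matI P μ u * A.transpose) 2 2
      - P.derivative.eval (u 0) * (A * matI P μ u + matI P μ u * A.transpose) 0 0) :
    InTangentSL (matI P μ) fun u => symI (g u, h u) := by
  have hM : ∀ i j, AnalyticAt ℂ (fun u => matI P μ u i j) 0 := fun i j =>
    (contDiff_matI P μ i j).contDiffAt.analyticAt
  have h1 : InTangentSL (matI P μ) fun u => A * matI P μ u + matI P μ u * A.transpose :=
    ⟨fun _ => 0, fun _ => A, analyticAt_const, fun _ _ => analyticAt_const,
      Filter.Eventually.of_forall fun _ => hA, Filter.Eventually.of_forall fun u i j => by simp⟩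
  have h2 := inTangentSL_sub_symI (P := P) (μ := μ)
    (V := fun u => A * matI P μ u + matI P μ u * A.transpose) (fun i j => ?_)
    (Filter.Eventually.of_forall fun u => ?_)
  · refine (h1.sub h2).congr (Filter.Eventually.of_forall fun u => ?_)
    rw [sub_sub_cancel, hg, hh]
  · simp only [Matrix.add_apply, Matrix.mul_apply]
    refine AnalyticAt.fun_add ?_ ?_
    · exact Finset.analyticAt_fun_sum _ fun l _ => analyticAt_const.fun_mul (hM _ _)
    · exact Finset.analyticAt_fun_sum _ fun l _ => (hM _ _).fun_mul analyticAt_const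
  · rw [Matrix.IsSymm, Matrix.transpose_add, Matrix.transpose_mul, Matrix.transpose_mul,
      Matrix.transpose_transpose, (isSymm_matI P μ u).eq, add_comm]

end

/-- In the quotient every coordinate kills `symI (1, 0)`, while `y`, `z`, `w` and `x^(m+1)` kill
`symI (0, 1)`. This leaves `symI (1, 0)` and `symI (0, xⁱ)` with `i ≤ m`, that is, `k + 1`
generators for `k = m + 1`. -/
theorem inTangentSL_matI_pow (m : ℕ) :
    (∀ i, InTangentSL (matI (X ^ (m + 1)) 0) fun u => symI (u i, 0)) ∧
    (∀ i, i ≠ 0 → InTangentSL (matI (X ^ (m + 1)) 0) fun u => symI (0, u i)) ∧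
    InTangentSL (matI (X ^ (m + 1)) 0) fun u => symI (0, u 0 ^ (m + 1)) := by
  have H : ∀ {A : Matrix (Fin 3) (Fin 3) ℂ}, A.trace = 0 → _ := fun {A} hA {g h} =>
    inTangentSL_symI_of_trace (A := A) (P := X ^ (m + 1)) (μ := 0) hA (g := g) (h := h)
  simp only [derivative_X_pow, eval_mul, eval_pow, eval_X, eval_C, Nat.add_sub_cancel,
    Matrix.add_apply, Matrix.mul_apply, Matrix.transpose_apply, Fin.sum_univ_three,
    matI, Matrix.of_apply, Matrix.cons_val] at H
  have hm : (2 * m + 3 : ℂ) ≠ 0 := by exact_mod_cast (by omega : 2 * m + 3 ≠ 0)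
  have hx : AnalyticAt ℂ (fun u : Fin 4 → ℂ => u 0 ^ m) 0 := (analyticAt_coord 0 0).fun_pow m
  have hc : ∀ c : ℂ, AnalyticAt ℂ (fun _ : Fin 4 → ℂ => c) 0 := fun _ => analyticAt_const
  have a := @H !![0, 1, 0; 0, 0, 0; 0, 0, 0] (by simp [Matrix.trace_fin_three])
    (fun u => u 1 + u 0 ^ (m + 1)) (fun u => 0)
    (fun u => by simp only [Matrix.of_apply, Matrix.cons_val]; ring)
    (fun u => by simp only [Matrix.of_apply, Matrix.cons_val]; ring)
  have b := @H !![0, 0, 1; 0, 0, 0; 0, 0, 0] (by simp [Matrix.trace_fin_three])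
    (fun u => u 3) (fun u => -2 * (m + 1) * u 0 ^ m * u 2)
    (fun u => by simp only [Matrix.of_apply, Matrix.cons_val]; ring)
    (fun u => by simp only [Matrix.of_apply, Matrix.cons_val]; push_cast; ring)
  have c := @H !![0, 0, 0; 1, 0, 0; 0, 0, 0] (by simp [Matrix.trace_fin_three])
    (fun u => u 0) (fun u => 0)
    (fun u => by simp only [Matrix.of_apply, Matrix.cons_val]; ring)
    (fun u => by simp only [Matrix.of_apply, Matrix.cons_val]; ring)
  have d := @H !![0, 0, 0; 0, 0, 1; 0, 0, 0] (by simp [Matrix.trace_fin_three])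
    (fun u => u 2) (fun u => 2 * u 3)
    (fun u => by simp only [Matrix.of_apply, Matrix.cons_val]; ring)
    (fun u => by simp only [Matrix.of_apply, Matrix.cons_val]; ring)
  have e := @H !![0, 0, 0; 0, 0, 0; 1, 0, 0] (by simp [Matrix.trace_fin_three])
    (fun u => 0) (fun u => -2 * u 2)
    (fun u => by simp only [Matrix.of_apply, Matrix.cons_val]; ring)
    (fun u => by simp only [Matrix.of_apply, Matrix.cons_val]; ring)
  have f := @H !![0, 0, 0; 0, 0, 0; 0, 1, 0] (by simp [Matrix.trace_fin_three])
    (fun u => 0) (fun u => -2 * u 3)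
    (fun u => by simp only [Matrix.of_apply, Matrix.cons_val]; ring)
    (fun u => by simp only [Matrix.of_apply, Matrix.cons_val]; ring)
  have g := @H !![1, 0, 0; 0, -1, 0; 0, 0, 0] (by simp [Matrix.trace_fin_three])
    (fun u => 0) (fun u => -2 * (u 1 + u 0 ^ (m + 1)) - 2 * (m + 1) * u 0 ^ (m + 1))
    (fun u => by simp only [Matrix.of_apply, Matrix.cons_val]; ring)
    (fun u => by simp only [Matrix.of_apply, Matrix.cons_val]; push_cast; ring)
  have i := @H !![1, 0, 0; 0, 0, 0; 0, 0, -1] (by simp [Matrix.trace_fin_three])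
    (fun u => 0) (fun u => 2 * u 1 - 2 * (m + 1) * u 0 ^ (m + 1))
    (fun u => by simp only [Matrix.of_apply, Matrix.cons_val]; ring)
    (fun u => by simp only [Matrix.of_apply, Matrix.cons_val]; push_cast; ring)
  have xx := g.comb (g := fun _ => 0) (h := fun u => u 0 ^ (m + 1)) i
    (hc (-1 / (2 * (2 * m + 3)))) (hc (-1 / (2 * (2 * m + 3))))
    (fun u => by ring) (fun u => by field_simp; ring)
  have y := i.comb (g := fun _ => 0) (h := fun u => u 1) xx (hc (1 / 2)) (hc (m + 1))
    (fun u => by ring) (fun u => by ring)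
  have z := e.scale (g := fun _ => 0) (h := fun u => u 2) (hc (-1 / 2))
    (fun u => by ring) (fun u => by ring)
  have w := f.scale (g := fun _ => 0) (h := fun u => u 3) (hc (-1 / 2))
    (fun u => by ring) (fun u => by ring)
  refine ⟨fun l => ?_, fun l hl => ?_, xx⟩
  · fin_cases l
    · exact c
    · exact a.comb c (hc 1) hx.fun_neg (fun u => by simp; ring) (fun u => by ring)
    · exact d.comb w (hc 1) (hc (-2)) (fun u => by simp) (fun u => by ring)
    · exact b.comb z (hc 1) ((hc (2 * (m + 1))).fun_mul hx) (fun u => by simp) (fun u => by ring)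
  · fin_cases l
    · exact absurd rfl hl
    · exact y
    · exact z
    · exact w

theorem inTangentSpanSL_matI_pow {m τ : ℕ}
    {N : Fin τ → (Fin 4 → ℂ) → Matrix (Fin 3) (Fin 3) ℂ}
    (h1 : InTangentSpanSL (matI (X ^ (m + 1)) 0) N fun _ => symI (1, 0))
    (h2 : ∀ i ≤ m, InTangentSpanSL (matI (X ^ (m + 1)) 0) N fun u => symI (0, u 0 ^ i))
    {g : (Fin 4 → ℂ) → ℂ} (hg : AnalyticAt ℂ g 0) :
    (InTangentSpanSL (matI (X ^ (m + 1)) 0) N fun u => symI (g u, 0)) ∧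
      InTangentSpanSL (matI (X ^ (m + 1)) 0) N fun u => symI (0, g u) := by
  obtain ⟨r1, r2, x1⟩ := inTangentSL_matI_pow m
  have H2 : ∀ j i, i + j = m + 1 → ∀ a : (Fin 4 → ℂ) → ℂ, AnalyticAt ℂ a 0 →
      InTangentSpanSL (matI (X ^ (m + 1)) 0) N fun u => symI (a u * 0, a u * u 0 ^ i) := by
    intro j
    induction j with
    | zero =>
      rintro i rfl a ha
      exact .of_inTangentSL (x1.scale ha (fun u => rfl) (fun u => rfl))
    | succ j ih =>
      intro i hij a ha
      refine (h2 i (by omega)).hadamard_pair (fun l a ha => ?_) ha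
      by_cases hl : l = 0
      · subst hl
        refine (ih (i + 1) (by omega) a ha).congr (Filter.Eventually.of_forall fun u => ?_)
        simp [pow_succ']
      · exact .of_inTangentSL ((r2 l hl).scale (ha.fun_mul ((analyticAt_coord 0 0).fun_pow i))
          (fun u => by simp) (fun u => by ring))
  constructor
  · refine (h1.hadamard_pair (fun l a ha => ?_) hg).congr
      (Filter.Eventually.of_forall fun u => by simp)
    exact .of_inTangentSL ((r1 l).scale ha (fun u => by simp) (fun u => by simp))
  · exact (H2 (m + 1) 0 (by omega) g hg).congr (Filter.Eventually.of_forall fun u => by simp)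

/-- The entry `12` of the family is constant and the family vanishes at the origin, so `g 0 = 0`. On
the `x`-axis the family is `diag(t, tᵏ, 0)`, and the combination `V₁₁ - V₂₂ - k t^(k-1) V₀₀`
eliminates the vector field, leaving `h = 2tᵏ(A₁₁ - k A₀₀)`. -/
theorem isBigO_of_inTangentSL_symI {k : ℕ} (hk : 1 ≤ k) {g h : (Fin 4 → ℂ) → ℂ}
    (H : InTangentSL (matI (X ^ k) 0) fun u => symI (g u, h u)) :
    g 0 = 0 ∧ (fun t => h ![t, 0, 0, 0]) =O[𝓝 0] fun t : ℂ => t ^ k := by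
  obtain ⟨ξ, A, -, hA, -, he⟩ := H
  constructor
  · have := he.self_of_nhds 0 1
    simp only [fderiv_matI_apply, symI_apply, Matrix.add_apply, Matrix.mul_apply,
      Matrix.transpose_apply, Fin.sum_univ_three] at this
    simpa [matI, show k ≠ 0 by omega] using this
  · let γ : ℂ → Fin 4 → ℂ := fun t => ![t, 0, 0, 0]
    have hγ : Continuous γ := by
      refine continuous_pi fun i => ?_
      fin_cases i
      · exact continuous_id
      all_goals exact continuous_const
    have hγ0 : γ 0 = 0 := by
      funext i; fin_cases i <;> rfl
    have e1 := (hγ0 ▸ hγ.tendsto 0 : Filter.Tendsto γ (𝓝 0) (𝓝 0)).eventually he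
    have h1 : (fun t => 2 * (A (γ t) 1 1 - k * A (γ t) 0 0)) =O[𝓝 0] fun t : ℂ => t ^ 0 := by
      simp only [pow_zero]
      exact ((continuousAt_isBigO_one (hA 1 1).continuousAt hγ hγ0).sub
        ((continuousAt_isBigO_one (hA 0 0).continuousAt hγ hγ0).const_mul_left _)).const_mul_left _
    refine (isBigO_pow_mul (n := k) h1).congr' ?_ Filter.EventuallyEq.rfl
    filter_upwards [e1] with t ht
    have e00 := ht 0 0
    have e11 := ht 1 1
    have e22 := ht 2 2
    obtain ⟨m, rfl⟩ := Nat.exists_eq_add_of_le' hk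
    simp only [fderiv_matI_apply] at e00 e11 e22
    simp only [symI_apply, derivative_X_pow, eval_mul, eval_pow, eval_X, eval_C,
      Nat.add_sub_cancel, Matrix.add_apply, Matrix.mul_apply, Matrix.transpose_apply,
      Fin.sum_univ_three, matI, γ, Matrix.of_apply, Matrix.cons_val] at e00 e11 e22
    simp only [γ]
    push_cast at e00 e11 e22 ⊢
    linear_combination e22 - e11 + (m + 1) * t ^ m * e00

/-- The initial velocities of the deformations of type `I_{k+1}`. -/
def velocitiesI (k : ℕ) : Fin (k + 1) → (Fin 4 → ℂ) → Matrix (Fin 3) (Fin 3) ℂ :=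
  Fin.snoc (α := fun _ => (Fin 4 → ℂ) → Matrix (Fin 3) (Fin 3) ℂ)
    (fun i : Fin k => fun u => symI (0, u 0 ^ (i : ℕ))) fun _ => symI (1, 0)

theorem velocitiesI_castSucc {k : ℕ} (i : Fin k) (u : Fin 4 → ℂ) :
    velocitiesI k i.castSucc u = symI (0, u 0 ^ (i : ℕ)) := by
  simp [velocitiesI]

theorem velocitiesI_last (k : ℕ) (u : Fin 4 → ℂ) :
    velocitiesI k (Fin.last k) u = symI (1, 0) := by
  simp [velocitiesI]

theorem sum_velocitiesI {k : ℕ} (c : Fin (k + 1) → ℂ) (u : Fin 4 → ℂ) :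
    ∑ l, c l • velocitiesI k l u
      = symI (c (Fin.last k), ∑ i : Fin k, c i.castSucc * u 0 ^ (i : ℕ)) := by
  simp only [Fin.sum_univ_castSucc, velocitiesI_castSucc, velocitiesI_last, ← map_smul, ← map_sum,
    ← map_add]
  congr 1
  ext <;> simp [Prod.fst_sum, Prod.snd_sum]

theorem isSLMiniversal_I {k : ℕ} (hk : 1 ≤ k) :
    IsSLMiniversal (Family.I k hk).matrix (matrixDefI k) := by
  have hM : (Family.I k hk).matrix = matI (X ^ k) 0 := by
    funext u
    simp [Family.matrix, matI]
  rw [hM]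
  have key : ∀ g : (Fin 4 → ℂ) → ℂ, AnalyticAt ℂ g 0 →
      (InTangentSpanSL (matI (X ^ k) 0) (velocitiesI k) fun u => symI (g u, 0)) ∧
        InTangentSpanSL (matI (X ^ k) 0) (velocitiesI k) fun u => symI (0, g u) := by
    obtain ⟨m, rfl⟩ := Nat.exists_eq_add_of_le' hk
    intro g hg
    refine inTangentSpanSL_matI_pow ?_ (fun i hi => ?_) hg
    · refine (InTangentSpanSL.mem (Fin.last _)).congr (Filter.Eventually.of_forall fun u => ?_)
      rw [velocitiesI_last]
    · refine (InTangentSpanSL.mem (Fin.castSucc ⟨i, by omega⟩)).congr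
        (Filter.Eventually.of_forall fun u => ?_)
      rw [velocitiesI_castSucc]
  refine isSLMiniversal_of_affine (N := velocitiesI k) (fun l u => ?_) (contDiff_matI _ _)
    (fun l => ?_) (isSymm_matI _ _) (fun l u => ?_) (fun V hV hs => ?_) (fun c hc => ?_)
  · rw [sum_velocitiesI]
    ext i j
    fin_cases i <;> fin_cases j <;> simp [matrixDefI, matI, symI_apply, add_assoc]
  · intro i j
    refine Fin.lastCases ?_ (fun a => ?_) l
    · simp only [velocitiesI_last]
      exact contDiff_const
    · simp only [velocitiesI_castSucc]
      fin_cases i <;> fin_cases j <;> simp [symI_apply] <;> fun_prop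
  · refine Fin.lastCases ?_ (fun a => ?_) l
    · rw [velocitiesI_last]
      exact isSymm_symI _
    · rw [velocitiesI_castSucc]
      exact isSymm_symI _
  · have h1 := inTangentSL_sub_symI (P := X ^ k) (μ := 0) hV hs
    refine (((key (fun u => V u 0 1) (hV 0 1)).1.add
      (key (fun u => V u 1 1 - V u 2 2 - (X ^ k : ℂ[X]).derivative.eval (u 0) * V u 0 0) ?_).2).add
      (.of_inTangentSL h1)).congr (Filter.Eventually.of_forall fun u => ?_)
    · exact ((hV 1 1).fun_sub (hV 2 2)).fun_sub ((analyticAt_eval_coord _ _ _).fun_mul (hV 0 0))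
    · rw [← map_add, Prod.mk_add_mk, add_zero, zero_add, add_sub_cancel]
  · simp only [sum_velocitiesI] at hc
    obtain ⟨h1, h2⟩ := isBigO_of_inTangentSL_symI hk (g := fun _ => c (Fin.last k))
      (h := fun u => ∑ i : Fin k, c i.castSucc * u 0 ^ (i : ℕ)) hc
    have h3 : ∑ i : Fin k, C (c i.castSucc) * X ^ (i : ℕ) = (0 : ℂ[X]) := by
      refine eq_zero_of_isBigO_pow (natDegree_sum_lt (e := id) (fun i hi => hi) hk _) ?_
      simpa [eval_finsetSum] using h2
    have h4 := coeff_eq_zero_of_sum_eq_zero (e := id) Function.injective_id h3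
    funext l
    refine Fin.lastCases h1 (fun i => ?_) l
    exact congrFun h4 i

end MatrixSing

end

open MatrixSing in
theorem proposition6p2 (S : MatrixSing.Family) :
    IsSLMiniversal S.matrix S.matrixDef ∧
    IsROddMiniversal S.oddFun S.oddDef ∧
    ∃ Φ : (Fin S.tau → ℂ) ≃ (Fin S.tau → ℂ),
      Differentiable ℂ Φ ∧ Differentiable ℂ Φ.symm ∧ Φ 0 = 0 ∧
      Φ '' matrixFullDiagram S.matrixDef = oddFullDiagram S.oddDef := by
  cases S with
  | I k hk => exact ⟨isSLMiniversal_I hk, isROddMiniversal_I hk, exists_equiv_I hk⟩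
  | II4 => exact ⟨isSLMiniversal_II4, isROddMiniversal_II4, exists_equiv_II4⟩
  | II5 => exact ⟨isSLMiniversal_II5, isROddMiniversal_II5, exists_equiv_II5⟩
  | II6 => exact ⟨isSLMiniversal_II6, isROddMiniversal_II6, exists_equiv_II6⟩
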